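/- **Giant graviton expansion for the index.** Let $f(q)=\sum_{k\ge1}a_kq^k\in q\,\mathbb Z[[q]]$ be a power series of order $\alpha$ (the smallest $k$ with $a_k\neq0$; $\alpha=\infty$ if $f=0$), and let $N\ge 0$ be an integer. Let $$I^f_N(q)=\int_{U(N)}dU\,\exp\Bigl(\sum_{k\ge1}\tfrac1k f(q^k)\,\mathrm{Tr}\,U^k\,\mathrm{Tr}\,U^{-k}\Bigr),\qquad I^f_\infty(q)=\prod_{k\ge1}\frac1{1-f(q^k)},$$ where $dU$ is the invariant measure of total volume $1$ and the integrand is a power series in $q$ that is integrated coefficient by coefficient. Let $\mathbf t^\pm=(t^\pm_1,t^\pm_2,\dots)$ and $\mathbf g=(g_1,g_2,\dots)$ be formal variables and put $$\widetilde Z_\infty=\exp\Bigl(\sum_{k\ge1}\tfrac1k t^+_kt^-_k\Bigr),\quad Z_\infty(\mathbf g)=\prod_{k\ge1}\frac1{1-g_k},\quad J(z)=\exp\Bigl(\sum_{k\ge1}\tfrac1k t^+_kz^k-\sum_{k\ge1}\tfrac1k t^-_kz^{-k}\Bigr).$$ For $r,s\in\mathbb Z+\frac12$ let $\widetilde K(r,s)\in\mathbb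 C[[\mathbf t^+,\mathbf t^-]]$ be the coefficient of $z^rw^{-s}$ in $\frac{J(z)}{J(w)}\frac{\sqrt{zw}}{z-w}$, expanded in $|w|<|z|$, that is, with $\frac{\sqrt{zw}}{z-w}=\sum_{n\ge0}z^{-n-1/2}w^{n+1/2}$. Let $\langle\,\cdot\,\rangle_{\mathbf g}:\mathbb C[[\mathbf t^+,\mathbf t^-]]\to\mathbb C[[\mathbf g]]$ be the coefficientwise linear map that sends the monomial $\prod_k(t^+_k)^{a_k}(t^-_k)^{b_k}$ to $\prod_k a_k!\,(kg_k)^{a_k}$ if $a_k=b_k$ for all $k$, and to $0$ otherwise. For half-integers $r_1,\dots,r_m$ put $$K^{(m)}_{\mathbf g}(r_1,\dots,r_m)=\frac1{Z_\infty(\mathbf g)}\Bigl\langle\widetilde Z_\infty\det\bigl(\widetilde K(r_i,r_j)\bigr)_{i,j=1}^m\Bigr\rangle_{\mathbf g},$$ and let $G^{(0)}_N(\mathbf g)=1$ and $$G^{(m)}_N(\mathbf g)=(-1)^m\sum_{\substack{N<r_1<\dots<r_m\\ r_i\in\mathbb Z+\frac12}}K^{(m)}_{\mathbf g}(r_1,\dots,r_m)\qquad(m\ge1).$$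 Let $G^{(m)}_{f,N}(q)$ be $G^{(m)}_N(\mathbf g)$ specialised to $g_k=f(q^k)$, $k\ge1$. Then the sums over $r_1<\dots<r_m$ converge in the power-series sense (each coefficient receives finitely many non-zero contributions); for every $m\ge0$ the series $G^{(m)}_{f,N}(q)$ has order at least $\alpha mN+\alpha\frac{m(m+1)}2$ as a power series in $q$ (where $\infty\cdot0=0$); the sum $\sum_{m\ge0}G^{(m)}_{f,N}(q)$ converges in the power-series sense; and $$\frac{I^f_N(q)}{I^f_\infty(q)}=\sum_{m=0}^\infty G^{(m)}_{f,N}(q).$$ -/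

import Mathlib

open scoped Nat

noncomputable section

namespace GiantGraviton

/-! ### Formal sums of power series -/

section FormalSum

variable {ι σ R : Type*} [CommRing R]

/-- A family of formal power series is summable in the power-series sense if every fixed
coefficient vanishes for all but finitely many members of the family. -/
def FormalSummable (F : ι → MvPowerSeries σ R) : Prop :=
  ∀ d : σ →₀ ℕ, {i | MvPowerSeries.coeff d (F i) ≠ 0}.Finite

/-- The coefficientwise sum of a family of formal power series (meaningful if the family is
`FormalSummable`). -/
def formalSum (F : ι → MvPowerSeries σ R) : MvPowerSeries σ R :=
  fun d => ∑ᶠ i, MvPowerSeries.coeff d (F i)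

/-- The exponential of a power series without constant term. -/
def expSeries [Algebra ℂ R] (F : MvPowerSeries σ R) : MvPowerSeries σ R :=
  (PowerSeries.exp ℂ).subst F

end FormalSum

/-! ### The matrix integral -/

/-- The unitary group `U(N)`. -/
abbrev U (N : ℕ) : Type := Matrix.unitaryGroup (Fin N) ℂ

instance instMeasurableSpaceU (N : ℕ) : MeasurableSpace (U N) := borel _

instance instBorelSpaceU (N : ℕ) : BorelSpace (U N) := ⟨rfl⟩

instance instCompactSpaceU (N : ℕ) : CompactSpace (U N) := by
  have hc : IsCompact (Set.pi Set.univ fun _ : Fin N => Set.pi Set.univ fun _ : Fin N =>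
      Metric.closedBall (0 : ℂ) 1) :=
    isCompact_univ_pi fun _ => isCompact_univ_pi fun _ => isCompact_closedBall _ _
  refine isCompact_iff_compactSpace.mp (hc.of_isClosed_subset
    (isClosed_unitary (R := Matrix (Fin N) (Fin N) ℂ)) ?_)
  intro V hV i _ j _
  simpa using entry_norm_bound_of_unitary hV i j

/-- The invariant measure on `U(N)` of total volume `1`. -/
def haarU (N : ℕ) : MeasureTheory.Measure (U N) :=
  MeasureTheory.Measure.haarMeasure ⊤

/-- `Tr V`. -/
def tr {N : ℕ} (V : U N) : ℂ := Matrix.trace (V : Matrix (Fin N) (Fin N) ℂ)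

/-- The series `f(q^k)`, with its integer coefficients regarded as complex numbers. -/
def coupling (f : PowerSeries ℤ) (k : ℕ+) : PowerSeries ℂ :=
  PowerSeries.expand (k : ℕ) k.ne_zero (f.map (Int.castRingHom ℂ))

/-- The exponent `∑_{k ≥ 1} (1/k) f(q^k) Tr V^k Tr V^{-k}`. -/
def action (f : PowerSeries ℤ) {N : ℕ} (V : U N) : PowerSeries ℂ :=
  formalSum fun k : ℕ+ =>
    ((k : ℂ)⁻¹ * tr (V ^ (k : ℕ)) * tr (V⁻¹ ^ (k : ℕ))) • coupling f k

/-- The matrix integral `I^f_N(q) = ∫_{U(N)} dV exp (∑_k (1/k) f(q^k) Tr V^k Tr V^{-k})`, a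
power series in `q`; the coefficients of the integrand are integrated over `U(N)`. -/
def index (f : PowerSeries ℤ) (N : ℕ) : PowerSeries ℂ :=
  PowerSeries.mk fun n =>
    ∫ V : U N, PowerSeries.coeff n (expSeries (action f V) : PowerSeries ℂ) ∂(haarU N)

open scoped PowerSeries.WithPiTopology in
/-- `I^f_∞(q) = ∏_{k ≥ 1} 1 / (1 - f(q^k))`. -/
def indexInfty (f : PowerSeries ℤ) : PowerSeries ℂ :=
  ∏' k : ℕ+, (1 - coupling f k)⁻¹

/-! ### The auxiliary model in the variables `t⁺_k`, `t⁻_k` -/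

/-- The variables `t⁺_k` (left) and `t⁻_k` (right), `k ≥ 1`. -/
abbrev TVar : Type := ℕ+ ⊕ ℕ+

/-- `Z̃_∞(t⁺, t⁻) = exp (∑_k (1/k) t⁺_k t⁻_k)`. -/
def ZtildeInfty : MvPowerSeries TVar ℂ :=
  expSeries (formalSum fun k : ℕ+ =>
    (k : ℂ)⁻¹ • (MvPowerSeries.X (Sum.inl k) * MvPowerSeries.X (Sum.inr k)))

/-- `J(u; t⁺, t⁻) = exp (∑_k (1/k) t⁺_k u^k - ∑_k (1/k) t⁻_k u^{-k})`, for a unit `u` of a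
coefficient ring `A`. -/
def J {A : Type*} [CommRing A] [Algebra ℂ A] (u : Aˣ) : MvPowerSeries TVar A :=
  expSeries
    ((formalSum fun k : ℕ+ => (k : ℂ)⁻¹ •
        (MvPowerSeries.C ((u ^ (k : ℕ) : Aˣ) : A) * MvPowerSeries.X (Sum.inl k))) -
      (formalSum fun k : ℕ+ => (k : ℂ)⁻¹ •
        (MvPowerSeries.C ((u⁻¹ ^ (k : ℕ) : Aˣ) : A) * MvPowerSeries.X (Sum.inr k))))

/-- The ring `ℂ[z, z⁻¹, w, w⁻¹]`; the exponent `(a, b)` stands for `z^a w^b`. -/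
abbrev Laurent₂ : Type := AddMonoidAlgebra ℂ (ℤ × ℤ)

/-- The Laurent monomial `z^a w^b` as a unit. -/
def laurentUnit (a b : ℤ) : Laurent₂ˣ where
  val := AddMonoidAlgebra.single (a, b) 1
  inv := AddMonoidAlgebra.single (-a, -b) 1
  val_inv := by
    simp [AddMonoidAlgebra.single_mul_single, AddMonoidAlgebra.one_def, ← Prod.zero_eq_mk]
  inv_val := by
    simp [AddMonoidAlgebra.single_mul_single, AddMonoidAlgebra.one_def, ← Prod.zero_eq_mk]

/-- The quotient `J(z; t⁺, t⁻) / J(w; t⁺, t⁻)`. Every coefficient with respect to the variables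
`t^±` is a Laurent polynomial in `z` and `w`. -/
def Jquot : MvPowerSeries TVar Laurent₂ :=
  J (laurentUnit 1 0) * MvPowerSeries.invOfUnit (J (laurentUnit 0 1)) 1

/-- The two-point function `K̃(r, s; t⁺, t⁻)` for the half-integers `r = i + 1/2`, `s = j + 1/2`:
the coefficient of `z^r w^{-s}` in `(J(z) / J(w)) * √(z w) / (z - w)`, where for `|w| < |z|`
one has `√(z w) / (z - w) = ∑_{n ≥ 0} z^{-n-1/2} w^{n+1/2}`. -/
def Ktilde (i j : ℤ) : MvPowerSeries TVar ℂ :=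
  fun d => ∑ᶠ n : ℕ, (MvPowerSeries.coeff d Jquot).coeff (i + n + 1, -j - n - 1)

/-! ### Averaging, and the giant graviton terms in the variables `g_k` -/

/-- The averaging operator `⟨·⟩_g` on power series in `t^±`: it is linear and continuous,
multiplicative over distinct `k`, and maps `(t⁺_k)^a (t⁻_k)^b` to `a! (k g_k)^a` if `a = b` and to
`0` otherwise. -/
def average (F : MvPowerSeries TVar ℂ) : MvPowerSeries ℕ+ ℂ :=
  fun d => (d.prod fun k n => (n ! : ℂ) * (k : ℂ) ^ n) *
    MvPowerSeries.coeff (Finsupp.sumElim d d) F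

open scoped MvPowerSeries.WithPiTopology in
/-- `Z_∞(g) = ∏_{k ≥ 1} 1 / (1 - g_k)`. -/
def ZInfty : MvPowerSeries ℕ+ ℂ :=
  ∏' k : ℕ+, (1 - MvPowerSeries.X k)⁻¹

/-- `K^{(m)}_g(r_1, …, r_m) = Z_∞(g)⁻¹ ⟨Z̃_∞ det (K̃(r_a, r_b))⟩_g` with `r_a = i_a + 1/2`. -/
def Kg {m : ℕ} (i : Fin m → ℤ) : MvPowerSeries ℕ+ ℂ :=
  ZInfty⁻¹ * average (ZtildeInfty * (Matrix.of fun a b => Ktilde (i a) (i b)).det)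

/-- The tuples of half-integers `N < r_1 < … < r_m`, encoded by the integers `i_a = r_a - 1/2`. -/
abbrev Levels (N m : ℕ) : Type :=
  {i : Fin m → ℤ // StrictMono i ∧ ∀ a, (N : ℤ) ≤ i a}

/-- `G^{(0)}_N(g) = 1` and
`G^{(m)}_N(g) = (-1)^m ∑_{N < r_1 < … < r_m} K^{(m)}_g(r_1, …, r_m)` for `m ≥ 1`. -/
def giant (N : ℕ) : ℕ → MvPowerSeries ℕ+ ℂ
  | 0 => 1
  | m + 1 => (-1) ^ (m + 1) * formalSum fun r : Levels N (m + 1) => Kg r.1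

/-- `G^{(m)}_{f,N}(q)`: the series `G^{(m)}_N(g)` at `g_k = f(q^k)`. -/
def giantIndex (f : PowerSeries ℤ) (N m : ℕ) : PowerSeries ℂ :=
  MvPowerSeries.subst (coupling f) (giant N m)

end GiantGraviton

end

open scoped Nat

set_option linter.unusedSectionVars false

noncomputable section

namespace GiantGraviton

/-! Let Z̃_N be the generating series of the integrals over U(N) of exp(-∑ (t⁺_k Tr V^k + t⁻_k Tr
V^{-k})/k) (`haarSeries`). Expanding exponentials shows that ⟨Z̃_N⟩_g at g_k = f(q^k) is I^f_N
(`index_eq`), while ⟨Z̃_∞⟩_g = Z_∞ specialises to I^f_∞. The theorem therefore reduces to Z̃_N =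
Z̃_∞ · det(1 - K̃) over the levels ≥ N (`haarSeries_eq`): sorting the Fredholm expansion by the
number m of levels yields the giant terms.

In J(z) the power of z equals the charge of the accompanying monomial, where t⁺_k has charge k and
t⁻_k has charge -k. One may set z = 1 and replace Laurent coefficients by homogeneous components
(`cut`). A Toeplitz matrix then has as entries the components of charge i - j of one series.

Three facts give `haarSeries_eq`. Weyl integration (`haarIntegral_eq_coeff`) turns Z̃_N into a
Toeplitz determinant. It is derived from Haar invariance alone: the loop equations say that the
integral kills the image of a Casimir operator conjugated by the Vandermonde determinant, and on
antisymmetric Laurent polynomials the kernel of that operator is spanned by the Vandermonde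
determinant. The Borodin–Okounkov identity (`fredholm_zero_mul_det_toeplitz`) says that this
determinant times det(1 - K̃) over all levels is det(1 - K̃) over the levels ≥ N. It holds because 1
- K̃ maps explicit columns (`dressedColumn_sub`) to unitriangular ones. The strong Szegő limit
(`stableSeries_eq`) identifies the inverse of det(1 - K̃) over all levels with Z̃_∞: it is the
large-N limit of Z̃_N, where the loop equations become the Wick rule for independent Gaussians.

Convergence and orders come from one estimate: row i of K̃ starts at t⁺-weight i + 1
(`Ktilde_coeff_eq_zero`). Increasing levels ≥ N thus force weight at least mN + m(m+1)/2, and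
setting g_k = f(q^k) multiplies the weight by α. -/

open Finset

/-! ### Exponentials of linear forms -/

section ExpGen

variable {σ A : Type*} [CommRing A] [Algebra ℂ A]

/-- The exponential of the linear form with coefficients `c`: its coefficient at `d` is
`∏ c_v ^ d_v / d_v!`. -/
def expLinear (c : σ → A) : MvPowerSeries σ A :=
  fun d => d.prod fun v n => (n ! : ℂ)⁻¹ • c v ^ n

/-- The linear form `∑ c_v X_v`. -/
def linearSeries (c : σ → A) : MvPowerSeries σ A :=
  fun d => ∑ᶠ v, open Classical in if d = Finsupp.single v 1 then c v else 0

lemma coeff_expLinear (c : σ → A) (d : σ →₀ ℕ) :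
    MvPowerSeries.coeff d (expLinear c) = d.prod fun v n => (n ! : ℂ)⁻¹ • c v ^ n := rfl

lemma coeff_linearSeries_single (c : σ → A) (v : σ) :
    MvPowerSeries.coeff (Finsupp.single v 1) (linearSeries c) = c v := by
  classical
  change ∑ᶠ w, (if Finsupp.single v 1 = Finsupp.single w 1 then c w else 0) = c v
  rw [finsum_eq_single _ v]
  · simp
  · intro w hw
    rw [if_neg]
    intro h
    exact hw (Finsupp.single_left_injective one_ne_zero h).symm

lemma coeff_linearSeries_of_ne (c : σ → A) (d : σ →₀ ℕ) (h : ∀ v, d ≠ Finsupp.single v 1) :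
    MvPowerSeries.coeff d (linearSeries c) = 0 := by
  classical
  change ∑ᶠ w, (if d = Finsupp.single w 1 then c w else 0) = 0
  simp [h]

lemma constantCoeff_linearSeries (c : σ → A) :
    MvPowerSeries.constantCoeff (linearSeries c) = 0 := by
  rw [← MvPowerSeries.coeff_zero_eq_constantCoeff_apply]
  apply coeff_linearSeries_of_ne
  intro v h
  have := DFunLike.congr_fun h v
  simp at this

lemma pderiv_linearSeries (c : σ → A) (v : σ) :
    MvPowerSeries.pderiv A v (linearSeries c) = MvPowerSeries.C (c v) := by
  classical
  ext d
  rw [MvPowerSeries.coeff_pderiv, MvPowerSeries.coeff_C]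
  split_ifs with h
  · subst h
    simp [coeff_linearSeries_single]
  · rw [coeff_linearSeries_of_ne, zero_mul]
    intro w hw
    apply h
    have hdeg := congrArg Finsupp.degree hw
    rw [map_add, Finsupp.degree_single, Finsupp.degree_single, Nat.add_eq_right] at hdeg
    exact (Finsupp.degree_eq_zero_iff d).mp hdeg

/-- This is ∂_v E = c_v E read on coefficients, the recursion behind the inductions on the degree
and, later, behind the Wick rule. -/
lemma expLinear_succ (c : σ → A) (d : σ →₀ ℕ) (v : σ) :
    ((d v : A) + 1) * MvPowerSeries.coeff (d + Finsupp.single v 1) (expLinear c) =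
      c v * MvPowerSeries.coeff d (expLinear c) := by
  classical
  rw [coeff_expLinear, coeff_expLinear]
  have hz : ∀ w : σ, ((0 ! : ℂ))⁻¹ • c w ^ 0 = 1 := by simp
  have h1 := Finsupp.mul_prod_erase' (d + Finsupp.single v 1) v
    (fun v n => (n ! : ℂ)⁻¹ • c v ^ n) (fun w => hz w)
  have h2 := Finsupp.mul_prod_erase' d v (fun v n => (n ! : ℂ)⁻¹ • c v ^ n) (fun w => hz w)
  have h3 : (d + Finsupp.single v 1).erase v = d.erase v := by
    rw [Finsupp.erase_add]
    simp
  rw [← h1, ← h2, h3, ← mul_assoc, ← mul_assoc]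
  congr 1
  have hc : ((d v : A) + 1) = algebraMap ℂ A ((d v : ℂ) + 1) := by simp
  have hne : ((d v : ℂ) + 1) ≠ 0 := by exact_mod_cast Nat.succ_ne_zero (d v)
  simp only [Finsupp.add_apply, Finsupp.single_eq_same, Nat.factorial_succ, Algebra.smul_def,
    Nat.cast_mul, mul_inv, map_mul, pow_succ]
  push_cast
  rw [hc, show algebraMap ℂ A ((d v : ℂ) + 1) *
      (algebraMap ℂ A ((d v : ℂ) + 1)⁻¹ * algebraMap ℂ A (((d v)! : ℂ))⁻¹ * (c v ^ d v * c v)) =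
      (algebraMap ℂ A ((d v : ℂ) + 1) *
      algebraMap ℂ A ((d v : ℂ) + 1)⁻¹) * (algebraMap ℂ A (((d v)! : ℂ))⁻¹ * (c v ^ d v * c v)) by
      ring]
  rw [← map_mul (algebraMap ℂ A) ((d v : ℂ) + 1), mul_inv_cancel₀ hne, map_one]
  ring

lemma exists_eq_add_single {d : σ →₀ ℕ} (hd : d ≠ 0) :
    ∃ (e : σ →₀ ℕ) (v : σ), d = e + Finsupp.single v 1 := by
  classical
  obtain ⟨v, hv⟩ := Finsupp.ne_iff.mp hd
  refine ⟨d - Finsupp.single v 1, v, ?_⟩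
  rw [tsub_add_cancel_of_le]
  simp only [Finsupp.coe_zero, Pi.zero_apply] at hv
  simpa [Finsupp.single_le_iff] using Nat.one_le_iff_ne_zero.mpr hv

lemma natCast_succ_mul_cancel (n : ℕ) {a b : A} (h : ((n : A) + 1) * a = ((n : A) + 1) * b) :
    a = b := by
  have hc : ((n : A) + 1) = algebraMap ℂ A ((n : ℂ) + 1) := by simp
  have hne : ((n : ℂ) + 1) ≠ 0 := by exact_mod_cast Nat.succ_ne_zero n
  have hu : IsUnit ((n : A) + 1) := by
    rw [hc]; exact (IsUnit.mk0 _ hne).map (algebraMap ℂ A)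
  exact hu.mul_left_cancel h

lemma pderiv_expLinear (c : σ → A) (v : σ) :
    MvPowerSeries.pderiv A v (expLinear c) = MvPowerSeries.C (c v) * expLinear c := by
  ext d
  rw [MvPowerSeries.coeff_pderiv, MvPowerSeries.coeff_C_mul, ← expLinear_succ, mul_comm]

lemma constantCoeff_expLinear (c : σ → A) :
    MvPowerSeries.constantCoeff (expLinear c) = 1 := by
  rw [← MvPowerSeries.coeff_zero_eq_constantCoeff_apply, coeff_expLinear, Finsupp.prod_zero_index]

/-- The exponential of a linear form is determined by its first order differential equations. -/
lemma eq_expLinear_of_pderiv (c : σ → A) (F : MvPowerSeries σ A)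
    (h0 : MvPowerSeries.constantCoeff F = 1)
    (h : ∀ v, MvPowerSeries.pderiv A v F = MvPowerSeries.C (c v) * F) : F = expLinear c := by
  ext d
  induction hn : d.degree generalizing d with
  | zero =>
    obtain rfl : d = 0 := (Finsupp.degree_eq_zero_iff d).mp hn
    rw [MvPowerSeries.coeff_zero_eq_constantCoeff_apply,
      MvPowerSeries.coeff_zero_eq_constantCoeff_apply, h0, constantCoeff_expLinear]
  | succ n ih =>
    have hd : d ≠ 0 := by rintro rfl; simp at hn
    obtain ⟨e, v, rfl⟩ := exists_eq_add_single hd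
    have he : e.degree = n := by simpa [map_add] using hn
    apply natCast_succ_mul_cancel (e v)
    rw [expLinear_succ, ← ih e he]
    have := congrArg (MvPowerSeries.coeff e) (h v)
    rw [MvPowerSeries.coeff_pderiv, MvPowerSeries.coeff_C_mul] at this
    rw [← this, mul_comm]

lemma expLinear_add (c c' : σ → A) : expLinear (c + c') = expLinear c * expLinear c' := by
  symm
  apply eq_expLinear_of_pderiv
  · rw [map_mul, constantCoeff_expLinear, constantCoeff_expLinear, one_mul]
  · intro v
    rw [Derivation.leibniz, pderiv_expLinear, pderiv_expLinear, smul_eq_mul, smul_eq_mul,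
      Pi.add_apply, map_add]
    ring

lemma expLinear_zero : expLinear (0 : σ → A) = 1 := by
  symm
  apply eq_expLinear_of_pderiv
  · simp
  · intro v
    simp

lemma expLinear_sum {ι : Type*} (s : Finset ι) (c : ι → σ → A) :
    expLinear (∑ i ∈ s, c i) = ∏ i ∈ s, expLinear (c i) := by
  classical
  induction s using Finset.induction_on with
  | empty => simp [expLinear_zero]
  | insert a s ha ih => rw [Finset.sum_insert ha, Finset.prod_insert ha, expLinear_add, ih]

/-- The multinomial theorem, valid for infinitely many variables: ∂_v L^(n+1) = (n+1) c_v L^n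
matches the recursion of `expLinear_succ`. -/
lemma coeff_linearSeries_pow (c : σ → A) (n : ℕ) (d : σ →₀ ℕ) :
    MvPowerSeries.coeff d (linearSeries c ^ n) =
      if d.degree = n then (n ! : A) * MvPowerSeries.coeff d (expLinear c) else 0 := by
  classical
  induction n generalizing d with
  | zero =>
    rw [pow_zero, MvPowerSeries.coeff_one]
    by_cases h : d = 0
    · subst h
      simp [coeff_expLinear]
    · rw [if_neg h, if_neg]
      rwa [Finsupp.degree_eq_zero_iff]
  | succ n ih =>
    by_cases hd : d = 0
    · subst hd
      rw [MvPowerSeries.coeff_zero_eq_constantCoeff_apply, map_pow, constantCoeff_linearSeries]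
      simp
    · obtain ⟨e, v, rfl⟩ := exists_eq_add_single hd
      apply natCast_succ_mul_cancel (e v)
      have := congrArg (MvPowerSeries.coeff e)
        (MvPowerSeries.pderiv_pow (R := A) (i := v) (linearSeries c) (n + 1))
      rw [MvPowerSeries.coeff_pderiv, pderiv_linearSeries, Nat.add_sub_cancel] at this
      rw [mul_comm, this, mul_right_comm, mul_comm _ (MvPowerSeries.C _)]
      rw [show (MvPowerSeries.C (c v) * ((n + 1 : ℕ) : MvPowerSeries σ A)) =
        MvPowerSeries.C (c v * ((n + 1 : ℕ) : A)) by simp, MvPowerSeries.coeff_C_mul, ih]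
      simp only [map_add, Finsupp.degree_single, Nat.add_right_cancel_iff]
      split_ifs with h
      · rw [mul_left_comm ((e v : A) + 1), expLinear_succ, Nat.factorial_succ]
        push_cast
        ring
      · simp

lemma expSeries_linearSeries (c : σ → A) : expSeries (linearSeries c) = expLinear c := by
  ext d
  rw [expSeries, PowerSeries.coeff_subst
    (PowerSeries.HasSubst.of_constantCoeff_zero (constantCoeff_linearSeries c)),
    finsum_eq_single _ d.degree]
  · rw [coeff_linearSeries_pow, if_pos rfl, PowerSeries.coeff_exp, Algebra.smul_def, ← mul_assoc]
    have : (algebraMap ℂ A) ((algebraMap ℚ ℂ) (1 / (d.degree ! : ℚ))) * (d.degree ! : A) = 1 := by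
      rw [← map_natCast (algebraMap ℂ A), ← map_mul]
      have : (d.degree ! : ℂ) ≠ 0 := by exact_mod_cast Nat.factorial_ne_zero _
      simp [this]
    rw [this, one_mul]
  · intro n hn
    rw [coeff_linearSeries_pow, if_neg (Ne.symm hn), smul_zero]

end ExpGen

/-! ### Exponentials and substitution -/

section Subst

variable {σ τ : Type*}

lemma expSeries_subst {a : σ → MvPowerSeries τ ℂ} (ha : MvPowerSeries.HasSubst a)
    (G : MvPowerSeries σ ℂ) (hG : MvPowerSeries.constantCoeff G = 0) :
    expSeries (MvPowerSeries.subst a G) = MvPowerSeries.subst a (expSeries G) := by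
  have h := PowerSeries.HasSubst.of_constantCoeff_zero hG
  unfold expSeries PowerSeries.subst
  rw [MvPowerSeries.subst_comp_subst_apply h.const ha]

lemma subst_linearSeries {a : σ → MvPowerSeries τ ℂ} (ha : MvPowerSeries.HasSubst a)
    (c : σ → ℂ) : MvPowerSeries.subst a (linearSeries c) = formalSum fun v => c v • a v := by
  classical
  ext e
  rw [MvPowerSeries.coeff_subst ha]
  change _ = ∑ᶠ v, MvPowerSeries.coeff e (c v • a v)
  have hinj : Function.Injective fun v : σ => Finsupp.single v 1 :=
    Finsupp.single_left_injective one_ne_zero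
  rw [← finsum_mem_univ (f := fun v => MvPowerSeries.coeff e (c v • a v))]
  rw [show (∑ᶠ v ∈ Set.univ, MvPowerSeries.coeff e (c v • a v)) =
    ∑ᶠ v ∈ Set.univ, (fun d : σ →₀ ℕ => MvPowerSeries.coeff d (linearSeries c) •
      MvPowerSeries.coeff e (d.prod fun s e => a s ^ e)) (Finsupp.single v 1) by
    simp [coeff_linearSeries_single]]
  rw [← finsum_mem_image (g := fun v : σ => Finsupp.single v 1)
    (f := fun d : σ →₀ ℕ => MvPowerSeries.coeff d (linearSeries c) •
      MvPowerSeries.coeff e (d.prod fun s e => a s ^ e)) hinj.injOn]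
  rw [← finsum_mem_univ]
  apply finsum_mem_inter_support_eq
  ext d
  simp only [Set.image_univ, Set.mem_inter_iff, Set.mem_range, Set.mem_univ, true_and,
    Function.mem_support]
  refine ⟨fun hd => ⟨?_, hd⟩, fun h => h.2⟩
  by_contra hne
  push Not at hne
  rw [coeff_linearSeries_of_ne c d (fun v h => hne v h.symm), zero_smul] at hd
  exact hd rfl

/-- Exponentiating in independent variables and substituting afterwards keeps all coefficients
explicit. -/
lemma expSeries_formalSum {a : σ → MvPowerSeries τ ℂ} (ha : MvPowerSeries.HasSubst a)
    (c : σ → ℂ) : expSeries (formalSum fun v => c v • a v) =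
      MvPowerSeries.subst a (expLinear c) := by
  rw [← subst_linearSeries ha, expSeries_subst ha _ (constantCoeff_linearSeries c),
    expSeries_linearSeries]

end Subst

/-! ### The charge grading and the t⁺-weight -/

section Weights

/-- The weight of a monomial in the variables `t⁺_k`, where `t⁺_k` has weight `k`. -/
def plusWeight : (TVar →₀ ℕ) →+ ℕ := Finsupp.weight (Sum.elim (fun k : ℕ+ => (k : ℕ)) fun _ => 0)

/-- The power of the eigenvalues that is paired with the variable `v`. -/
def charge : TVar → ℤ := Sum.elim (fun k => (k : ℤ)) fun k => -(k : ℤ)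

/-- The charge of a monomial: `t⁺_k` has charge `k` and `t⁻_k` has charge `-k`. -/
def totalCharge : (TVar →₀ ℕ) →+ ℤ := Finsupp.weight charge

/-- The variables t⁻ only lower the charge. This links the grading, in which the identities live, to
the filtration used for truncation. -/
lemma totalCharge_le_plusWeight (d : TVar →₀ ℕ) : totalCharge d ≤ plusWeight d := by
  simp only [totalCharge, plusWeight, Finsupp.weight_apply, Finsupp.sum]
  push_cast
  apply Finset.sum_le_sum
  rintro (k | k) _ <;> simp [charge]

/-- The part of a series that consists of the monomials with charge in `T`. -/
def cut (T : Set ℤ) : MvPowerSeries TVar ℂ →ₗ[ℂ] MvPowerSeries TVar ℂ where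
  toFun F := fun d => open Classical in if totalCharge d ∈ T then MvPowerSeries.coeff d F else 0
  map_add' F G := by
    classical
    ext d
    change (if totalCharge d ∈ T then MvPowerSeries.coeff d (F + G) else 0) =
      (if totalCharge d ∈ T then MvPowerSeries.coeff d F else 0) +
      (if totalCharge d ∈ T then MvPowerSeries.coeff d G else 0)
    split_ifs <;> simp
  map_smul' c F := by
    classical
    ext d
    change (if totalCharge d ∈ T then MvPowerSeries.coeff d (c • F) else 0) =
      c • (if totalCharge d ∈ T then MvPowerSeries.coeff d F else 0)
    split_ifs <;> simp

open Classical in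
lemma coeff_cut (T : Set ℤ) (F : MvPowerSeries TVar ℂ) (d : TVar →₀ ℕ) :
    MvPowerSeries.coeff d (cut T F) =
      if totalCharge d ∈ T then MvPowerSeries.coeff d F else 0 := rfl

/-- All monomials of `F` have charge in `T`. -/
def ChargeIn (T : Set ℤ) (F : MvPowerSeries TVar ℂ) : Prop :=
  ∀ d, MvPowerSeries.coeff d F ≠ 0 → totalCharge d ∈ T

variable {T T' : Set ℤ} {F G : MvPowerSeries TVar ℂ}

lemma cut_eq_self (h : ChargeIn T F) : cut T F = F := by
  classical
  ext d
  rw [coeff_cut]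
  split_ifs with hd
  · rfl
  · by_contra hne
    exact hd (h d (Ne.symm hne))

lemma cut_eq_zero (h : ChargeIn T' F) (hT : Disjoint T T') : cut T F = 0 := by
  classical
  ext d
  rw [coeff_cut]
  split_ifs with hd
  · by_contra hne
    exact Set.disjoint_left.mp hT hd (h d hne)
  · simp

lemma chargeIn_cut (T : Set ℤ) (F : MvPowerSeries TVar ℂ) : ChargeIn T (cut T F) := by
  classical
  intro d hd
  rw [coeff_cut] at hd
  by_contra h
  simp [h] at hd

lemma ChargeIn.mono (h : ChargeIn T F) (hT : T ⊆ T') : ChargeIn T' F := fun d hd => hT (h d hd)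

lemma exists_of_coeff_mul_ne_zero {σ A : Type*} [CommRing A] {F G : MvPowerSeries σ A}
    {d : σ →₀ ℕ} (h : MvPowerSeries.coeff d (F * G) ≠ 0) :
    ∃ d₁ d₂, d₁ + d₂ = d ∧ MvPowerSeries.coeff d₁ F ≠ 0 ∧ MvPowerSeries.coeff d₂ G ≠ 0 := by
  classical
  rw [MvPowerSeries.coeff_mul] at h
  obtain ⟨⟨d₁, d₂⟩, hd, hne⟩ := Finset.exists_ne_zero_of_sum_ne_zero h
  exact ⟨d₁, d₂, by simpa using hd, left_ne_zero_of_mul hne, right_ne_zero_of_mul hne⟩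

lemma ChargeIn.mul {T₃ : Set ℤ} (h : ChargeIn T F) (h' : ChargeIn T' G)
    (hT : ∀ a ∈ T, ∀ b ∈ T', a + b ∈ T₃) : ChargeIn T₃ (F * G) := by
  intro d hd
  obtain ⟨d₁, d₂, rfl, h₁, h₂⟩ := exists_of_coeff_mul_ne_zero hd
  rw [map_add]
  exact hT _ (h d₁ h₁) _ (h' d₂ h₂)

lemma cut_add_cut_compl (T : Set ℤ) (F : MvPowerSeries TVar ℂ) : cut T F + cut Tᶜ F = F := by
  classical
  ext d
  rw [map_add, coeff_cut, coeff_cut]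
  by_cases h : totalCharge d ∈ T <;> simp [h]

lemma cut_cut (T T' : Set ℤ) (F : MvPowerSeries TVar ℂ) : cut T (cut T' F) = cut (T ∩ T') F := by
  classical
  ext d
  simp only [coeff_cut, Set.mem_inter_iff]
  by_cases h : totalCharge d ∈ T <;> by_cases h' : totalCharge d ∈ T' <;> simp [h, h']

/-- Multiplication by a series of charge `c` shifts the charges by `c`. -/
lemma cut_mul_of_homogeneous {c : ℤ} (h : ChargeIn {c} G) (T T' : Set ℤ)
    (hT : ∀ x, x ∈ T' ↔ x + c ∈ T) (F : MvPowerSeries TVar ℂ) :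
    cut T (F * G) = cut T' F * G := by
  classical
  have h1 : cut T (cut T' F * G) = cut T' F * G :=
    cut_eq_self ((chargeIn_cut T' F).mul h fun a ha b hb => by
      rw [Set.mem_singleton_iff] at hb
      subst hb
      exact (hT a).mp ha)
  have h2 : cut T (cut T'ᶜ F * G) = 0 := by
    refine cut_eq_zero (T' := Tᶜ) ((chargeIn_cut T'ᶜ F).mul h fun a ha b hb => ?_)
      disjoint_compl_right
    rw [Set.mem_singleton_iff] at hb
    subst hb
    exact fun hh => ha ((hT a).mpr hh)
  conv_lhs => rw [← cut_add_cut_compl T' F, add_mul, map_add, h1, h2, add_zero]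

end Weights

/-! ### Vertex series at z = 1 -/

section Vacuum

/-- The series `exp (a ∑ t⁺_k / k + b ∑ t⁻_k / k)`. -/
def vertex (a b : ℂ) : MvPowerSeries TVar ℂ :=
  expLinear (Sum.elim (fun k : ℕ+ => a * (k : ℂ)⁻¹) fun k : ℕ+ => b * (k : ℂ)⁻¹)

lemma vertex_mul (a b a' b' : ℂ) : vertex a b * vertex a' b' = vertex (a + a') (b + b') := by
  rw [vertex, vertex, vertex, ← expLinear_add]
  congr 1
  funext v
  rcases v with k | k <;> simp [add_mul]

lemma vertex_zero : vertex 0 0 = 1 := by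
  rw [vertex, ← expLinear_zero]
  congr 1
  funext v
  rcases v with k | k <;> simp

lemma coeff_expLinear_eq_zero {σ A : Type*} [CommRing A] [Algebra ℂ A] (c : σ → A)
    {d : σ →₀ ℕ} {v : σ} (hc : c v = 0) (hd : d v ≠ 0) :
    MvPowerSeries.coeff d (expLinear c) = 0 := by
  rw [coeff_expLinear, Finsupp.prod]
  apply Finset.prod_eq_zero (Finsupp.mem_support_iff.mpr hd)
  rw [hc, zero_pow hd, smul_zero]

lemma chargeIn_vertex_plus (a : ℂ) : ChargeIn (Set.Ici 0) (vertex a 0) := by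
  intro d hd
  rw [Set.mem_Ici, totalCharge, Finsupp.weight_apply]
  apply Finset.sum_nonneg
  rintro (k | k) hk
  · simp [charge]
  · exact absurd (coeff_expLinear_eq_zero _ (by simp) (Finsupp.mem_support_iff.mp hk)) hd

lemma chargeIn_vertex_minus (b : ℂ) : ChargeIn (Set.Iic 0) (vertex 0 b) := by
  intro d hd
  rw [Set.mem_Iic, totalCharge, Finsupp.weight_apply]
  apply Finset.sum_nonpos
  rintro (k | k) hk
  · exact absurd (coeff_expLinear_eq_zero _ (by simp) (Finsupp.mem_support_iff.mp hk)) hd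
  · simp [charge]

lemma constantCoeff_vertex (a b : ℂ) : MvPowerSeries.constantCoeff (vertex a b) = 1 :=
  constantCoeff_expLinear _

end Vacuum

/-! ### The two-point function through the charge grading -/

section TwoPoint

lemma coeff_formalSum_C_mul_X {σ A : Type*} [CommRing A] [Algebra ℂ A] (c : ℕ+ → A)
    (g : ℕ+ → σ) (d : σ →₀ ℕ) :
    MvPowerSeries.coeff d (formalSum fun k : ℕ+ => (k : ℂ)⁻¹ •
      (MvPowerSeries.C (c k) * MvPowerSeries.X (g k))) =
    ∑ᶠ k : ℕ+, open Classical in if d = Finsupp.single (g k) 1 then (k : ℂ)⁻¹ • c k else 0 := by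
  classical
  change ∑ᶠ k : ℕ+, MvPowerSeries.coeff d _ = _
  refine finsum_congr fun k => ?_
  change (k : ℂ)⁻¹ • MvPowerSeries.coeff d (MvPowerSeries.C (c k) * MvPowerSeries.X (g k)) = _
  rw [MvPowerSeries.coeff_C_mul, MvPowerSeries.coeff_X]
  split_ifs <;> simp

lemma J_eq_expLinear {A : Type*} [CommRing A] [Algebra ℂ A] (u : Aˣ) :
    J u = expLinear (Sum.elim (fun k : ℕ+ => (k : ℂ)⁻¹ • ((u ^ (k : ℕ) : Aˣ) : A))
      fun k : ℕ+ => -((k : ℂ)⁻¹ • ((u⁻¹ ^ (k : ℕ) : Aˣ) : A))) := by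
  classical
  rw [← expSeries_linearSeries, J]
  congr 1
  have hs : ∀ v w : TVar, Finsupp.single v 1 = (Finsupp.single w 1 : TVar →₀ ℕ) ↔ v = w :=
    fun v w => (Finsupp.single_left_injective one_ne_zero).eq_iff
  ext d
  rw [map_sub, coeff_formalSum_C_mul_X _ Sum.inl, coeff_formalSum_C_mul_X _ Sum.inr]
  by_cases h : ∃ v, d = Finsupp.single v 1
  · obtain ⟨v, rfl⟩ := h
    rw [coeff_linearSeries_single]
    rcases v with k | k
    · rw [finsum_eq_single _ k fun l hl => by simp [hs, Ne.symm hl]]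
      simp [hs]
    · simp only [hs, reduceCtorEq, if_false, finsum_zero, zero_sub]
      rw [finsum_eq_single _ k fun l hl => by simp [Ne.symm hl]]
      simp
  · push Not at h
    rw [coeff_linearSeries_of_ne _ _ h]
    simp [h]

/-- Each variable comes with the power of the Laurent variable given by its charge, so the Laurent
exponent of a monomial is redundant and may be forgotten. -/
lemma coeff_expLinear_single {M : Type*} [AddCommGroup M] (g : M) (γ : TVar → ℂ)
    (d : TVar →₀ ℕ) :
    MvPowerSeries.coeff d
      (expLinear fun v => AddMonoidAlgebra.single (charge v • g) (γ v)) =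
      AddMonoidAlgebra.single (totalCharge d • g) (MvPowerSeries.coeff d (expLinear γ)) := by
  rw [coeff_expLinear, coeff_expLinear, totalCharge, Finsupp.weight_apply, Finsupp.prod,
    Finsupp.prod, Finsupp.sum, Finset.sum_smul, ← AddMonoidAlgebra.prod_single]
  refine Finset.prod_congr rfl fun v _ => ?_
  rw [AddMonoidAlgebra.single_pow, AddMonoidAlgebra.smul_single, smul_assoc]

lemma coe_laurentUnit_pow (a b : ℤ) (n : ℕ) :
    ((laurentUnit a b ^ n : Laurent₂ˣ) : Laurent₂) = AddMonoidAlgebra.single (n * a, n * b) 1 := by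
  rw [Units.val_pow_eq_pow_val]
  change (AddMonoidAlgebra.single (a, b) 1) ^ n = _
  rw [AddMonoidAlgebra.single_pow, one_pow]
  simp

lemma coe_laurentUnit_inv_pow (a b : ℤ) (n : ℕ) :
    (((laurentUnit a b)⁻¹ ^ n : Laurent₂ˣ) : Laurent₂) =
      AddMonoidAlgebra.single (-n * a, -n * b) 1 := by
  rw [Units.val_pow_eq_pow_val]
  change (AddMonoidAlgebra.single (-a, -b) 1) ^ n = _
  rw [AddMonoidAlgebra.single_pow, one_pow]
  simp

lemma J_laurentUnit (a b : ℤ) : J (laurentUnit a b) =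
    expLinear fun v => AddMonoidAlgebra.single (charge v • (a, b))
      ((Sum.elim (fun k : ℕ+ => 1 * (k : ℂ)⁻¹) fun k : ℕ+ => (-1) * (k : ℂ)⁻¹ : TVar → ℂ) v) := by
  rw [J_eq_expLinear]
  congr 1
  funext v
  rcases v with k | k
  · simp only [Sum.elim_inl]
    rw [coe_laurentUnit_pow, AddMonoidAlgebra.smul_single]
    simp [charge]
  · simp only [Sum.elim_inr]
    rw [coe_laurentUnit_inv_pow, AddMonoidAlgebra.smul_single]
    simp [charge, AddMonoidAlgebra.single_neg]

lemma Jquot_eq : Jquot =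
    (expLinear fun v => AddMonoidAlgebra.single (charge v • ((1, 0) : ℤ × ℤ))
      ((Sum.elim (fun k : ℕ+ => 1 * (k : ℂ)⁻¹) fun k : ℕ+ => (-1) * (k : ℂ)⁻¹ : TVar → ℂ) v)) *
    (expLinear fun v => AddMonoidAlgebra.single (charge v • ((0, 1) : ℤ × ℤ))
      ((Sum.elim (fun k : ℕ+ => (-1) * (k : ℂ)⁻¹) fun k : ℕ+ => 1 * (k : ℂ)⁻¹ : TVar → ℂ) v)) := by
  rw [Jquot, J_laurentUnit]
  congr 1
  have h := MvPowerSeries.mul_invOfUnit (J (laurentUnit 0 1)) 1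
    (by rw [J_laurentUnit, constantCoeff_expLinear]; rfl)
  refine (eq_comm.mp (left_inv_eq_right_inv ?_ h))
  rw [J_laurentUnit, ← expLinear_add, ← expLinear_zero]
  congr 1
  funext v
  rcases v with k | k <;> simp

/-- The kernel in terms of series in the variables `t^±` alone. -/
lemma Ktilde_eq_cut (i j : ℤ) :
    Ktilde i j = cut {i - j} (vertex 1 (-1) * cut (Set.Iio (-j)) (vertex (-1) 1)) := by
  classical
  ext d
  change ∑ᶠ n : ℕ, (MvPowerSeries.coeff d Jquot).coeff (i + n + 1, -j - n - 1) = _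
  simp_rw [Jquot_eq, MvPowerSeries.coeff_mul, coeff_expLinear_single,
    AddMonoidAlgebra.single_mul_single, AddMonoidAlgebra.coeff_sum, Finsupp.finsetSum_apply,
    AddMonoidAlgebra.coeff_single]
  have key : ∀ p ∈ antidiagonal d, ∀ n : ℕ,
      (Finsupp.single (totalCharge p.1 • ((1, 0) : ℤ × ℤ) + totalCharge p.2 • ((0, 1) : ℤ × ℤ))
        (MvPowerSeries.coeff p.1 (vertex 1 (-1)) * MvPowerSeries.coeff p.2 (vertex (-1) 1)))
        (i + n + 1, -j - n - 1) =
      if totalCharge p.1 = i + n + 1 ∧ totalCharge p.2 = -j - n - 1 then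
        MvPowerSeries.coeff p.1 (vertex 1 (-1)) * MvPowerSeries.coeff p.2 (vertex (-1) 1)
      else 0 := by
    intro p _ n
    rw [Finsupp.single_apply]
    simp
  change ∑ᶠ n : ℕ, ∑ p ∈ antidiagonal d,
    (Finsupp.single (totalCharge p.1 • ((1, 0) : ℤ × ℤ) + totalCharge p.2 • ((0, 1) : ℤ × ℤ))
        (MvPowerSeries.coeff p.1 (vertex 1 (-1)) * MvPowerSeries.coeff p.2 (vertex (-1) 1)))
        (i + n + 1, -j - n - 1) = _
  rw [finsum_congr fun n => Finset.sum_congr rfl fun p hp => key p hp n, finsum_sum_comm]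
  · rw [coeff_cut, MvPowerSeries.coeff_mul]
    trans ∑ p ∈ antidiagonal d, if totalCharge d ∈ ({i - j} : Set ℤ) then
      MvPowerSeries.coeff p.1 (vertex 1 (-1)) *
        MvPowerSeries.coeff p.2 (cut (Set.Iio (-j)) (vertex (-1) 1)) else 0
    swap
    · split_ifs <;> simp
    refine Finset.sum_congr rfl fun p hp => ?_
    have hd : totalCharge d = totalCharge p.1 + totalCharge p.2 := by
      rw [← map_add, HasAntidiagonal.mem_antidiagonal.mp hp]
    rw [coeff_cut, hd]
    by_cases h : totalCharge p.1 + totalCharge p.2 = i - j ∧ totalCharge p.2 < -j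
    -- The exponent of w determines n, and n ≥ 0 says exactly that the second factor has charge
    -- below -j.
    · rw [finsum_eq_single _ (-j - 1 - totalCharge p.2).toNat, if_pos, if_pos, if_pos]
      · exact h.2
      · exact h.1
      · omega
      · intro n hn
        rw [if_neg]
        omega
    · rw [finsum_eq_zero_of_forall_eq_zero fun n => if_neg (by omega)]
      simp only [Set.mem_singleton_iff, Set.mem_Iio]
      split_ifs <;> simp_all
  · intro p _
    refine (Set.finite_singleton (-j - 1 - totalCharge p.2).toNat).subset fun n hn => ?_
    rw [Function.mem_support] at hn
    by_contra hne
    apply hn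
    rw [if_neg]
    rw [Set.mem_singleton_iff] at hne
    omega

end TwoPoint

/-! ### Truncation by t⁺-weight -/

section LowIdeal

/-- The ideal of series all of whose monomials have `t⁺`-weight larger than `D`. -/
def lowIdeal (D : ℕ) : Ideal (MvPowerSeries TVar ℂ) where
  carrier := {F | ∀ d, plusWeight d ≤ D → MvPowerSeries.coeff d F = 0}
  zero_mem' := fun d _ => map_zero _
  add_mem' := fun {F G} hF hG d hd => by rw [map_add, hF d hd, hG d hd, add_zero]
  smul_mem' := fun F G hG d hd => by
    by_contra hne
    obtain ⟨d₁, d₂, rfl, -, h₂⟩ := exists_of_coeff_mul_ne_zero hne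
    rw [map_add] at hd
    exact h₂ (hG d₂ (by omega))

lemma cut_mem_lowIdeal {D : ℕ} {F : MvPowerSeries TVar ℂ} (hF : F ∈ lowIdeal D) (T : Set ℤ) :
    cut T F ∈ lowIdeal D := by
  classical
  intro d hd
  rw [coeff_cut, hF d hd, ite_self]

lemma mem_lowIdeal_of_chargeIn {D : ℕ} {F : MvPowerSeries TVar ℂ}
    (hF : ChargeIn (Set.Ioi (D : ℤ)) F) : F ∈ lowIdeal D := by
  intro d hd
  by_contra hne
  have h1 := hF d hne
  have h2 := totalCharge_le_plusWeight d
  rw [Set.mem_Ioi] at h1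
  omega

/-- The total charge is i - j and the right factor has charge below -j, so the left factor has
charge above i and hence t⁺-weight above i. -/
lemma Ktilde_coeff_eq_zero (i j : ℤ) (d : TVar →₀ ℕ) (hd : (plusWeight d : ℤ) ≤ i) :
    MvPowerSeries.coeff d (Ktilde i j) = 0 := by
  classical
  rw [Ktilde_eq_cut, coeff_cut]
  split_ifs with h
  · by_contra hne
    obtain ⟨d₁, d₂, rfl, -, h₂⟩ := exists_of_coeff_mul_ne_zero hne
    have h3 := chargeIn_cut _ _ d₂ h₂
    have h4 := totalCharge_le_plusWeight d₁
    rw [Set.mem_Iio] at h3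
    rw [Set.mem_singleton_iff, map_add] at h
    rw [map_add] at hd
    push_cast at hd
    omega
  · rfl

end LowIdeal

/-! ### Columns that triangularise the operator 1 - K̃ -/

section BorodinOkounkov

lemma cut_Ici_eq_sum (c : ℤ) (n : ℕ) (F : MvPowerSeries TVar ℂ) :
    cut (Set.Ici c) F = ∑ a ∈ range n, cut {c + a} F + cut (Set.Ici (c + n)) F := by
  classical
  induction n with
  | zero => simp
  | succ n ih =>
    rw [ih, Finset.sum_range_succ, add_assoc]
    congr 1
    ext d
    rw [map_add]
    simp only [coeff_cut, Set.mem_Ici, Set.mem_singleton_iff]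
    push_cast
    by_cases h1 : totalCharge d = c + n
    · rw [if_pos (by omega), if_pos h1, if_neg (by omega), add_zero]
    · rw [if_neg h1, zero_add]
      by_cases h2 : c + n ≤ totalCharge d
      · rw [if_pos h2, if_pos (by omega)]
      · rw [if_neg h2, if_neg (by omega)]

/-- The column, indexed by `j`, of a matrix that the operator `1 - K` maps to a
triangular one. -/
def dressedColumn (j : ℕ) : MvPowerSeries TVar ℂ :=
  vertex 1 0 * cut (Set.Ici (-(j : ℤ))) (vertex (-1) (-1))

lemma chargeIn_dressedColumn (j : ℕ) : ChargeIn (Set.Ici (-(j : ℤ))) (dressedColumn j) := by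
  refine (chargeIn_vertex_plus 1).mul (chargeIn_cut _ _) fun a ha b hb => ?_
  rw [Set.mem_Ici] at *
  omega

/-- A column with entries of charge i - j, i ≥ 0, is the same as a series of charges ≥ -j, on which
K̃ acts as F ↦ P(v Q(v⁻¹ F)) with v = `vertex 1 (-1)`. The column is chosen by Wiener–Hopf
factorisation so that P(v⁻¹ F) is the plain series `vertex (-1) 0`; multiplying back by v leaves P
of `vertex 0 (-1)`. -/
lemma dressedColumn_sub (j : ℕ) :
    dressedColumn j - cut (Set.Ici (-(j : ℤ))) (vertex 1 (-1) *
      cut (Set.Iio (-(j : ℤ))) (vertex (-1) 1 * dressedColumn j)) =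
      cut (Set.Ici (-(j : ℤ))) (vertex 0 (-1)) := by
  set P := cut (Set.Ici (-(j : ℤ))) with hP
  set Q := cut (Set.Iio (-(j : ℤ))) with hQ
  have hPQ : ∀ F, P F + Q F = F := fun F => by
    rw [hP, hQ, ← Set.compl_Ici]
    exact cut_add_cut_compl _ _
  have h1 : vertex (-1) 1 * dressedColumn j = vertex 0 1 * P (vertex (-1) (-1)) := by
    change _ * (_ * P _) = _
    rw [← mul_assoc, vertex_mul, neg_add_cancel, add_zero]
  -- The factor in t⁻ can only lower the charge, so charges below -j stay below -j.
  have h2 : P (vertex 0 1 * Q (vertex (-1) (-1))) = 0 := by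
    refine cut_eq_zero (T' := Set.Iio (-(j : ℤ)))
      ((chargeIn_vertex_minus 1).mul (chargeIn_cut _ _) fun a ha b hb => ?_) ?_
    · rw [Set.mem_Iic] at ha
      rw [Set.mem_Iio] at *
      omega
    · rw [Set.disjoint_left]
      intro x hx hx'
      rw [Set.mem_Ici] at hx
      rw [Set.mem_Iio] at hx'
      omega
  have h3 : P (vertex (-1) 1 * dressedColumn j) = vertex (-1) 0 := by
    rw [h1, show vertex 0 1 * P (vertex (-1) (-1)) = vertex (-1) 0 -
      vertex 0 1 * Q (vertex (-1) (-1)) by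
        rw [eq_sub_iff_add_eq, ← mul_add, hPQ, vertex_mul]; norm_num, map_sub, h2, sub_zero]
    refine cut_eq_self ((chargeIn_vertex_plus _).mono fun x hx => ?_)
    rw [Set.mem_Ici] at *
    omega
  have h4 : Q (vertex (-1) 1 * dressedColumn j) =
      vertex (-1) 1 * dressedColumn j - vertex (-1) 0 := by
    rw [eq_sub_iff_add_eq, ← h3, add_comm, hPQ]
  rw [h4, mul_sub, ← mul_assoc, vertex_mul, vertex_mul, map_sub]
  norm_num
  rw [vertex_zero, one_mul, cut_eq_self (chargeIn_dressedColumn j)]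
  ring

/-- The entries of the matrix with columns `dressedColumn`. -/
def dressed (i j : ℕ) : MvPowerSeries TVar ℂ := cut {(i : ℤ) - j} (dressedColumn j)

/-- This is `dressedColumn_sub` at charge i - j. Pulling the homogeneous entry of charge k - j out
of both cuts turns the operator into the matrix entries K̃(i, k). The discarded levels k ≥ M have
charge at least M - j > D and lie in the ideal. -/
lemma dressed_relation (D M i j : ℕ) (hM : D + j < M) :
    dressed i j - ∑ k ∈ range M, Ktilde i k * dressed k j - cut {(i : ℤ) - j} (vertex 0 (-1)) ∈
      lowIdeal D := by
  have h1 := congrArg (cut {(i : ℤ) - j}) (dressedColumn_sub j)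
  have hint : ({(i : ℤ) - j} ∩ Set.Ici (-(j : ℤ)) : Set ℤ) = {(i : ℤ) - j} := by
    rw [Set.inter_eq_left, Set.singleton_subset_iff, Set.mem_Ici]
    omega
  rw [map_sub, cut_cut, cut_cut, hint] at h1
  have h2 : ∀ k : ℕ, cut {(i : ℤ) - j} (vertex 1 (-1) * cut (Set.Iio (-(j : ℤ)))
      (vertex (-1) 1 * dressed k j)) = Ktilde i k * dressed k j := by
    intro k
    have hc : ChargeIn {(k : ℤ) - j} (dressed k j) := chargeIn_cut _ _
    rw [cut_mul_of_homogeneous hc _ (Set.Iio (-(k : ℤ))), ← mul_assoc,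
      cut_mul_of_homogeneous hc _ {(i : ℤ) - k}, Ktilde_eq_cut]
    · intro x
      simp only [Set.mem_singleton_iff]
      omega
    · intro x
      simp only [Set.mem_Iio]
      omega
  have h3 : dressedColumn j = ∑ k ∈ range M, dressed k j +
      cut (Set.Ici (-(j : ℤ) + M)) (dressedColumn j) := by
    conv_lhs => rw [← cut_eq_self (chargeIn_dressedColumn j), cut_Ici_eq_sum _ M]
    congr 1
    refine Finset.sum_congr rfl fun k _ => ?_
    rw [dressed, neg_add_eq_sub]
  have h4 : cut (Set.Ici (-(j : ℤ) + M)) (dressedColumn j) ∈ lowIdeal D := by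
    refine mem_lowIdeal_of_chargeIn ((chargeIn_cut _ _).mono fun x hx => ?_)
    rw [Set.mem_Ici] at hx
    rw [Set.mem_Ioi]
    omega
  rw [dressed, ← h1]
  conv in (cut (Set.Iio (-(j : ℤ))) (vertex (-1) 1 * dressedColumn j)) =>
    rw [h3, mul_add, Finset.mul_sum, map_add, map_sum]
  rw [mul_add, Finset.mul_sum, map_add, map_sum]
  simp_rw [h2]
  have h5 := cut_mem_lowIdeal (Ideal.mul_mem_left _ (vertex 1 (-1)) (cut_mem_lowIdeal
    (Ideal.mul_mem_left _ (vertex (-1) 1) h4) (Set.Iio (-(j : ℤ))))) {(i : ℤ) - j}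
  convert h5 using 1
  ring

/-- The Toeplitz matrix of a series in `t^±`, graded by the charge. -/
def toeplitz (N : ℕ) (F : MvPowerSeries TVar ℂ) :
    Matrix (Fin N) (Fin N) (MvPowerSeries TVar ℂ) :=
  Matrix.of fun i j => cut {(i : ℤ) - j} F

/-- Compression to the first N levels respects this product because the Toeplitz matrix of `vertex 1
0` is lower triangular: levels k ≥ N do not reach rows below N. -/
lemma dressed_eq_mul (N : ℕ) :
    (Matrix.of fun i j : Fin N => dressed i j) =
      toeplitz N (vertex 1 0) * toeplitz N (vertex (-1) (-1)) := by
  ext1 i j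
  rw [Matrix.mul_apply]
  simp only [Matrix.of_apply, toeplitz]
  rw [Fin.sum_univ_eq_sum_range (fun k : ℕ => cut {(i : ℤ) - k} (vertex 1 0) *
    cut {(k : ℤ) - j} (vertex (-1) (-1))) N, dressed, dressedColumn, cut_Ici_eq_sum _ N, mul_add,
    Finset.mul_sum, map_add, map_sum]
  have h1 : cut {(i : ℤ) - j} (vertex 1 0 *
      cut (Set.Ici (-(j : ℤ) + N)) (vertex (-1) (-1))) = 0 := by
    refine cut_eq_zero (T' := Set.Ici (-(j : ℤ) + N))
      ((chargeIn_vertex_plus 1).mul (chargeIn_cut _ _) fun a ha b hb => ?_) ?_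
    · rw [Set.mem_Ici] at *
      omega
    · rw [Set.disjoint_singleton_left, Set.mem_Ici]
      omega
  rw [h1, add_zero]
  refine Finset.sum_congr rfl fun k _ => ?_
  rw [cut_mul_of_homogeneous (chargeIn_cut _ _) _ {(i : ℤ) - k}, neg_add_eq_sub]
  intro x
  simp only [Set.mem_singleton_iff]
  omega

lemma cut_zero_of_charge {F : MvPowerSeries TVar ℂ} (h0 : MvPowerSeries.constantCoeff F = 1)
    (h : ∀ d, MvPowerSeries.coeff d F ≠ 0 → totalCharge d = 0 → d = 0) : cut {0} F = 1 := by
  classical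
  ext d
  rw [coeff_cut, MvPowerSeries.coeff_one]
  by_cases hd : d = 0
  · subst hd
    simpa using h0
  · rw [if_neg hd]
    split_ifs with hc
    · by_contra hne
      exact hd (h d hne hc)
    · rfl

lemma cut_zero_vertex_plus (a : ℂ) : cut {0} (vertex a 0) = 1 := by
  refine cut_zero_of_charge (constantCoeff_vertex _ _) fun d hd hc => ?_
  rw [totalCharge, Finsupp.weight_apply, Finsupp.sum, Finset.sum_eq_zero_iff_of_nonneg] at hc
  · by_contra hne
    obtain ⟨v, hv⟩ := Finsupp.support_nonempty_iff.mpr hne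
    have h1 := hc v hv
    have h2 := Finsupp.mem_support_iff.mp hv
    rcases v with k | k
    · simp [charge] at h1
      omega
    · exact hd (coeff_expLinear_eq_zero _ (by simp) h2)
  · rintro (k | k) hk
    · simp [charge]
    · exact absurd (coeff_expLinear_eq_zero _ (by simp) (Finsupp.mem_support_iff.mp hk)) hd

lemma cut_zero_vertex_minus (b : ℂ) : cut {0} (vertex 0 b) = 1 := by
  refine cut_zero_of_charge (constantCoeff_vertex _ _) fun d hd hc => ?_
  rw [totalCharge, Finsupp.weight_apply, Finsupp.sum, Finset.sum_eq_zero_iff_of_nonpos] at hc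
  · by_contra hne
    obtain ⟨v, hv⟩ := Finsupp.support_nonempty_iff.mpr hne
    have h1 := hc v hv
    have h2 := Finsupp.mem_support_iff.mp hv
    rcases v with k | k
    · exact hd (coeff_expLinear_eq_zero _ (by simp) h2)
    · simp [charge] at h1
      omega
  · rintro (k | k) hk
    · exact absurd (coeff_expLinear_eq_zero _ (by simp) (Finsupp.mem_support_iff.mp hk)) hd
    · simp [charge]

/-- Only nonnegative charges occur, and the only monomial of charge zero that occurs is the constant
one; so the matrix is lower unitriangular. -/
lemma det_toeplitz_vertex_plus (N : ℕ) (a : ℂ) : (toeplitz N (vertex a 0)).det = 1 := by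
  rw [Matrix.det_of_isLowerTriangular]
  · simp [toeplitz, cut_zero_vertex_plus]
  · intro i j hij
    have hij' : (i : ℤ) < j := by simpa using hij
    refine cut_eq_zero (chargeIn_vertex_plus a) ?_
    rw [Set.disjoint_singleton_left, Set.mem_Ici]
    omega

lemma det_toeplitz_vertex_minus (N : ℕ) (b : ℂ) : (toeplitz N (vertex 0 b)).det = 1 := by
  rw [Matrix.det_of_isUpperTriangular]
  · simp [toeplitz, cut_zero_vertex_minus]
  · intro i j hij
    have hij' : (j : ℤ) < i := by simpa using hij
    refine cut_eq_zero (chargeIn_vertex_minus b) ?_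
    rw [Set.disjoint_singleton_left, Set.mem_Iic]
    omega

end BorodinOkounkov

/-! ### Fredholm determinants of 1 - K̃ -/

section Fredholm

/-- Expand multilinearly in the rows, taking from each either the row of -X or the row of the
identity; the identity rows cut the determinant down to a principal minor. -/
lemma det_one_sub_eq_sum_minors {ι R : Type*} [Fintype ι] [DecidableEq ι] [CommRing R]
    (X : Matrix ι ι R) :
    (1 - X).det = ∑ s : Finset ι, (-1) ^ #s *
      (X.submatrix (Subtype.val : s → ι) (Subtype.val : s → ι)).det := by
  rw [sub_eq_neg_add]
  let D := (Matrix.detRowAlternating : (ι → R) [⋀^ι]→ₗ[R] R)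
  change D (fun i => (-X).row i + (1 : Matrix ι ι R).row i) = _
  refine (D.map_add_univ (-X).row (1 : Matrix ι ι R).row).trans ?_
  refine Finset.sum_congr rfl fun s _ => ?_
  change (Matrix.of (s.piecewise (-X).row (1 : Matrix ι ι R).row)).det = _
  rw [Matrix.det_piecewise_one_eq_submatrix_det, Matrix.submatrix_neg]
  change (-(X.submatrix (Subtype.val : s → ι) (Subtype.val : s → ι))).det = _
  rw [Matrix.det_neg, Fintype.card_coe]

/-- The contribution of the finite set `s` of levels to the Fredholm determinant of `1 - K`. -/
def fredholmTerm (s : Finset ℕ) : MvPowerSeries TVar ℂ :=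
  (-1) ^ #s * (Matrix.of fun a b : s => Ktilde (a : ℕ) (b : ℕ)).det

/-- The Fredholm determinant of `1 - K` on the levels `i ≥ N`. -/
def fredholm (N : ℕ) : MvPowerSeries TVar ℂ :=
  fun d => ∑ s ∈ (Ico N (plusWeight d)).powerset, MvPowerSeries.coeff d (fredholmTerm s)

lemma mem_lowIdeal_det {ι : Type*} [Fintype ι] [DecidableEq ι] {D : ℕ}
    (A : Matrix ι ι (MvPowerSeries TVar ℂ)) (i : ι) (h : ∀ j, A i j ∈ lowIdeal D) :
    A.det ∈ lowIdeal D := by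
  rw [Matrix.det_apply]
  refine Ideal.sum_mem _ fun σ _ => ?_
  rw [Units.smul_def, zsmul_eq_mul]
  refine Ideal.mul_mem_left _ _ ?_
  obtain ⟨k, rfl⟩ := σ.surjective i
  exact Ideal.mem_of_dvd _ (Finset.dvd_prod_of_mem _ (Finset.mem_univ k)) (h k)

lemma fredholmTerm_mem_lowIdeal {s : Finset ℕ} {D i : ℕ} (hi : i ∈ s) (hD : D ≤ i) :
    fredholmTerm s ∈ lowIdeal D := by
  refine Ideal.mul_mem_left _ _ (mem_lowIdeal_det _ ⟨i, hi⟩ fun j d hd => ?_)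
  exact Ktilde_coeff_eq_zero _ _ _ (by simp; omega)

/-- A set containing a level at or above the weight of d has a vanishing row up to that weight. The
cutoff in `fredholm` is therefore immaterial once it is large enough. -/
lemma coeff_fredholm (N : ℕ) (d : TVar →₀ ℕ) (M : ℕ) (hM : plusWeight d ≤ M) :
    MvPowerSeries.coeff d (fredholm N) =
      ∑ s ∈ (Ico N M).powerset, MvPowerSeries.coeff d (fredholmTerm s) := by
  change ∑ s ∈ (Ico N (plusWeight d)).powerset, MvPowerSeries.coeff d (fredholmTerm s) = _
  refine Finset.sum_subset (Finset.powerset_mono.mpr (Finset.Ico_subset_Ico_right hM))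
    fun s hs hs' => ?_
  rw [Finset.mem_powerset] at hs hs'
  obtain ⟨i, hi, hi'⟩ := Finset.not_subset.mp hs'
  have h1 := Finset.mem_Ico.mp (hs hi)
  rw [Finset.mem_Ico] at hi'
  exact fredholmTerm_mem_lowIdeal (D := plusWeight d) hi (by omega) d le_rfl

lemma det_one_sub_Ktilde {ι : Type*} [Fintype ι] [DecidableEq ι] (e : ι ↪ ℕ) :
    (1 - Matrix.of fun a b : ι => Ktilde (e a : ℕ) (e b : ℕ)).det =
      ∑ s ∈ (univ.map e).powerset, fredholmTerm s := by
  classical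
  rw [det_one_sub_eq_sum_minors]
  refine Finset.sum_bij (fun s _ => s.map e) ?_ ?_ ?_ ?_
  · intro s _
    rw [Finset.mem_powerset]
    exact Finset.map_subset_map.mpr (Finset.subset_univ _)
  · intro s _ t _ h
    exact Finset.map_injective e h
  · intro t ht
    rw [Finset.mem_powerset, Finset.subset_map_iff] at ht
    obtain ⟨s, -, rfl⟩ := ht
    exact ⟨s, Finset.mem_univ _, rfl⟩
  · intro s _
    rw [fredholmTerm, Finset.card_map]
    congr 1
    rw [← Matrix.det_submatrix_equiv_self (s.equivMap e)]
    rfl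

lemma fredholm_sub_det_mem {ι : Type*} [Fintype ι] [DecidableEq ι] (e : ι ↪ ℕ) {N M D : ℕ}
    (he : univ.map e = Ico N M) (hD : D ≤ M) :
    (1 - Matrix.of fun a b : ι => Ktilde (e a : ℕ) (e b : ℕ)).det - fredholm N ∈ lowIdeal D := by
  intro d hd
  rw [det_one_sub_Ktilde, he, map_sub, coeff_fredholm N d M (hd.trans hD), map_sum, sub_self]

end Fredholm

/-! ### The Borodin–Okounkov identity -/

section Jacobi

/-- The Borodin-Okounkov identity. -/
theorem fredholm_zero_mul_det_toeplitz (N : ℕ) :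
    fredholm 0 * (toeplitz N (vertex (-1) (-1))).det = fredholm N := by
  classical
  suffices h : ∀ D, fredholm 0 * (toeplitz N (vertex (-1) (-1))).det - fredholm N ∈ lowIdeal D by
    ext d
    have := h (plusWeight d) d le_rfl
    rwa [map_sub, sub_eq_zero] at this
  intro D
  -- The cutoff N + D + 1 exceeds D + j for every column j < N, as `dressed_relation` demands.
  set r := D + 1 with hr
  let q := Ideal.Quotient.mk (lowIdeal D)
  let e₂ : Fin r ↪ ℕ := ⟨fun b => N + b, fun a b h => by simpa [Fin.ext_iff] using h⟩
  let e : Fin N ⊕ Fin r ↪ ℕ := ⟨Sum.elim (fun a => (a : ℕ)) fun b => N + b, by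
    rintro (a | a) (b | b) h
    · simpa [Fin.ext_iff] using h
    · have := a.2
      simp at h
      omega
    · have := b.2
      simp at h
      omega
    · simpa [Fin.ext_iff] using h⟩
  have he₂ : univ.map e₂ = Ico N (N + r) := by
    ext x
    simp only [Finset.mem_map, Finset.mem_univ, true_and, Finset.mem_Ico]
    constructor
    · rintro ⟨b, rfl⟩
      have := b.2
      change N ≤ N + b ∧ N + b < N + r
      omega
    · rintro ⟨h1, h2⟩
      exact ⟨⟨x - N, by omega⟩, by change N + (x - N) = x; omega⟩
  have he : univ.map e = Ico 0 (N + r) := by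
    ext x
    simp only [Finset.mem_map, Finset.mem_univ, true_and, Finset.mem_Ico]
    constructor
    · rintro ⟨a | b, rfl⟩
      · have := a.2
        change 0 ≤ (a : ℕ) ∧ (a : ℕ) < N + r
        omega
      · have := b.2
        change 0 ≤ N + b ∧ N + b < N + r
        omega
    · rintro ⟨-, h2⟩
      by_cases hx : x < N
      · exact ⟨Sum.inl ⟨x, hx⟩, rfl⟩
      · exact ⟨Sum.inr ⟨x - N, by omega⟩, by change N + (x - N) = x; omega⟩
  have h1 := fredholm_sub_det_mem e he (show D ≤ N + r by omega)
  have h2 := fredholm_sub_det_mem e₂ he₂ (show D ≤ N + r by omega)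
  set B := (1 - Matrix.of fun a b => Ktilde (e a : ℕ) (e b : ℕ)) with hB
  set B₂ := (1 - Matrix.of fun a b => Ktilde (e₂ a : ℕ) (e₂ b : ℕ)) with hB₂
  -- The dressed columns below N are completed by standard basis vectors. Then det X is the Toeplitz
  -- determinant, and modulo the ideal (1 - K̃) X is block upper triangular with diagonal blocks a
  -- unitriangular matrix and 1 - K̃ on the levels ≥ N.
  let X : Matrix (Fin N ⊕ Fin r) (Fin N ⊕ Fin r) (MvPowerSeries TVar ℂ) :=
    Matrix.fromBlocks (Matrix.of fun i j => dressed i j) 0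
      (Matrix.of fun i j => dressed (N + i) j) 1
  have hrel : ∀ (i : Fin N ⊕ Fin r) (j : Fin N),
      q (∑ k, B i k * X k (Sum.inl j)) = q (cut {(e i : ℤ) - j} (vertex 0 (-1))) := by
    intro i j
    rw [Ideal.Quotient.eq]
    convert dressed_relation D (N + r) (e i) j (by omega) using 2
    have hX : ∀ k, X k (Sum.inl j) = dressed (e k) j := by
      rintro (k | k) <;> rfl
    simp_rw [hX, hB, Matrix.sub_apply, sub_mul, Finset.sum_sub_distrib]
    congr 1
    · simp [Matrix.one_apply]
    · rw [Finset.range_eq_Ico, ← he, Finset.sum_map]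
      rfl
  have hprod : (B * X).map q = Matrix.fromBlocks ((toeplitz N (vertex 0 (-1))).map q)
      (B.toBlocks₁₂.map q) 0 (B₂.map q) := by
    ext1 i j
    rcases j with j | j
    · rw [Matrix.map_apply, Matrix.mul_apply, hrel]
      rcases i with i | i
      · rfl
      · change _ = 0
        rw [cut_eq_zero (chargeIn_vertex_minus _), map_zero]
        rw [Set.disjoint_singleton_left, Set.mem_Iic]
        have := j.2
        change ¬(((N + i : ℕ) : ℤ) - j ≤ 0)
        omega
    · rw [Matrix.map_apply, Matrix.mul_apply, Fintype.sum_sum_type]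
      rcases i with i | i
      · simp [X, Matrix.one_apply, Matrix.toBlocks₁₂]
      · simp [X, Matrix.one_apply, hB, hB₂, Matrix.sub_apply]
        rfl
  have hdet := congrArg Matrix.det hprod
  rw [Matrix.det_fromBlocks_zero₂₁, ← RingHom.mapMatrix_apply, ← RingHom.mapMatrix_apply,
    ← RingHom.mapMatrix_apply, ← RingHom.map_det, ← RingHom.map_det, ← RingHom.map_det,
    Matrix.det_mul, det_toeplitz_vertex_minus, map_one, one_mul] at hdet
  have hX : X.det = (toeplitz N (vertex (-1) (-1))).det := by
    rw [Matrix.det_fromBlocks_zero₁₂, dressed_eq_mul, Matrix.det_mul, det_toeplitz_vertex_plus,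
      Matrix.det_one, one_mul, mul_one]
  rw [hX, map_mul] at hdet
  rw [← Ideal.Quotient.eq, map_mul]
  rw [← Ideal.Quotient.eq] at h1 h2
  rw [← h1, ← h2]
  exact hdet

end Jacobi

/-! ### The polynomial ring of power sums -/

section PowerSums

/-- The power sum `p_l`, `l ∈ ℤ`, as a polynomial in the variables `p_k`, `p_{-k}`, where
`p_0 = N`. -/
def powerVar (N : ℕ) : ℤ → MvPolynomial TVar ℂ
  | Int.ofNat 0 => MvPolynomial.C (N : ℂ)
  | Int.ofNat (k + 1) => MvPolynomial.X (Sum.inl k.succPNat)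
  | Int.negSucc k => MvPolynomial.X (Sum.inr k.succPNat)

lemma powerVar_zero (N : ℕ) : powerVar N 0 = MvPolynomial.C (N : ℂ) := rfl

lemma powerVar_charge (N : ℕ) (v : TVar) : powerVar N (charge v) = MvPolynomial.X v := by
  rcases v with k | k
  · obtain ⟨n, rfl⟩ : ∃ n : ℕ, k = n.succPNat := ⟨k.natPred, by simp⟩
    rfl
  · obtain ⟨n, rfl⟩ : ∃ n : ℕ, k = n.succPNat := ⟨k.natPred, by simp⟩
    rfl

lemma exists_charge_eq {l : ℤ} (hl : l ≠ 0) : ∃ v, charge v = l := by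
  rcases l with (_ | n) | n
  · exact absurd rfl hl
  · exact ⟨Sum.inl n.succPNat, rfl⟩
  · exact ⟨Sum.inr n.succPNat, rfl⟩

/-- An algebra homomorphism that sends the variables to power sums sends every `p_l` to one. -/
lemma map_powerVar {N : ℕ} {A : Type*} [CommRing A] [Algebra ℂ A]
    (e : MvPolynomial TVar ℂ →ₐ[ℂ] A) (p : ℤ → A) (h0 : p 0 = N)
    (h : ∀ v, e (MvPolynomial.X v) = p (charge v)) (l : ℤ) : e (powerVar N l) = p l := by
  by_cases hl : l = 0
  · subst hl
    rw [powerVar_zero, h0, ← MvPolynomial.algebraMap_eq, AlgHom.commutes, map_natCast]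
  · obtain ⟨v, rfl⟩ := exists_charge_eq hl
    rw [powerVar_charge, h]

/-- The first order operator that sends `p_l` to `l p_{k+l}`. -/
def shiftDer (N : ℕ) (k : ℤ) : Derivation ℂ (MvPolynomial TVar ℂ) (MvPolynomial TVar ℂ) :=
  MvPolynomial.mkDerivation ℂ fun v => (charge v : ℂ) • powerVar N (k + charge v)

/-- The quadratic expression `∑_{0 ≤ a < k} p_a p_{k-a}`, respectively
`-∑_{0 < a ≤ -k} p_{-a} p_{k+a}` for negative `k`. -/
def splitSum (N : ℕ) : ℤ → MvPolynomial TVar ℂ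
  | Int.ofNat n => ∑ a ∈ range n, powerVar N a * powerVar N (n - a)
  | Int.negSucc n => -∑ a ∈ range (n + 1),
      powerVar N (-(a + 1)) * powerVar N (-(n + 1) + (a + 1))

end PowerSums

/-! ### Derivatives of powers of a unitary matrix -/

section UnitaryDerivatives

variable {N : ℕ}

/-- The matrix of `V ^ k`. -/
def mpow (V : U N) (k : ℤ) : Matrix (Fin N) (Fin N) ℂ := ((V ^ k : U N) : Matrix _ _ ℂ)

lemma mpow_add (V : U N) (k l : ℤ) : mpow V (k + l) = mpow V k * mpow V l := by
  rw [mpow, zpow_add]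
  rfl

lemma mpow_zero (V : U N) : mpow V 0 = 1 := by
  rw [mpow, zpow_zero]
  rfl

lemma mpow_neg_one (V : U N) : mpow V (-1) = star (V : Matrix (Fin N) (Fin N) ℂ) := by
  rw [mpow, zpow_neg_one]
  rfl

lemma mpow_one (V : U N) : mpow V 1 = (V : Matrix (Fin N) (Fin N) ℂ) := by
  rw [mpow, zpow_one]

lemma trace_mpow (V : U N) (k : ℤ) : (mpow V k).trace = tr (V ^ k) := rfl

lemma continuous_mpow (k : ℤ) (i j : Fin N) : Continuous fun V : U N => mpow V k i j := by
  have h1 : Continuous fun V : U N => V ^ k := continuous_zpow k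
  have h2 : Continuous fun V : U N => (V : Matrix (Fin N) (Fin N) ℂ) := continuous_subtype_val
  exact ((h2.comp h1).matrix_elem i j)

/-- The derivative of `V ^ k` in the direction `A V`. -/
def mpowDeriv (V : U N) (A : Matrix (Fin N) (Fin N) ℂ) : ℤ → Matrix (Fin N) (Fin N) ℂ
  | Int.ofNat n => ∑ a ∈ range n, mpow V a * A * mpow V (n - a)
  | Int.negSucc n => -∑ a ∈ range (n + 1), mpow V (-(a + 1)) * A * mpow V (-(n + 1) + (a + 1))

lemma mpowDeriv_negSucc (V : U N) (A : Matrix (Fin N) (Fin N) ℂ) (n : ℕ) :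
    mpowDeriv V A (Int.negSucc n) =
      -∑ a ∈ range (n + 1), mpow V (-(a + 1)) * A * mpow V (-(n + 1) + (a + 1)) := rfl

lemma hasDerivAt_matrix_mul {X Y : ℝ → Matrix (Fin N) (Fin N) ℂ}
    {X' Y' : Matrix (Fin N) (Fin N) ℂ} {θ : ℝ}
    (hX : ∀ i j, HasDerivAt (fun t => X t i j) (X' i j) θ)
    (hY : ∀ i j, HasDerivAt (fun t => Y t i j) (Y' i j) θ) (i j : Fin N) :
    HasDerivAt (fun t => (X t * Y t) i j) ((X' * Y θ + X θ * Y') i j) θ := by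
  simp only [Matrix.mul_apply, Matrix.add_apply, ← Finset.sum_add_distrib]
  exact HasDerivAt.fun_sum fun k _ => (hX i k).mul (hY k j)

/-- Negative powers use V⁻¹ = V*; conjugating V' = A V gives (V⁻¹)' = -V⁻¹ A because A is
skew-Hermitian. -/
lemma hasDerivAt_mpow {X : ℝ → U N} {A : Matrix (Fin N) (Fin N) ℂ} (hA : star A = -A) {θ : ℝ}
    (hX : ∀ i j, HasDerivAt (fun t => (X t : Matrix (Fin N) (Fin N) ℂ) i j)
      ((A * (X θ : Matrix (Fin N) (Fin N) ℂ)) i j) θ) (k : ℤ) (i j : Fin N) :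
    HasDerivAt (fun t => mpow (X t) k i j) (mpowDeriv (X θ) A k i j) θ := by
  rcases k with n | n
  · induction n generalizing i j with
    | zero =>
      simp only [Int.ofNat_eq_natCast, Nat.cast_zero, mpow_zero]
      exact (hasDerivAt_const _ _).congr_deriv (by simp [mpowDeriv])
    | succ n ih =>
      have hX1 : ∀ i j, HasDerivAt (fun t => mpow (X t) 1 i j) ((A * mpow (X θ) 1) i j) θ := by
        simp only [mpow_one]
        exact hX
      have h := hasDerivAt_matrix_mul ih hX1 i j
      have he : ∀ t, mpow (X t) (Int.ofNat (n + 1)) =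
          mpow (X t) (Int.ofNat n) * mpow (X t) 1 := fun t => by
        rw [← mpow_add]
        rfl
      simp only [he]
      refine h.congr_deriv (congrFun (congrFun (Eq.symm ?_) i) j)
      change ∑ a ∈ range (n + 1), mpow (X θ) a * A * mpow (X θ) ((n + 1 : ℕ) - a) =
        (∑ a ∈ range n, mpow (X θ) a * A * mpow (X θ) (n - a)) * mpow (X θ) 1 +
          mpow (X θ) n * (A * mpow (X θ) 1)
      rw [Finset.sum_range_succ, Finset.sum_mul]
      congr 1
      · refine Finset.sum_congr rfl fun a _ => ?_
        rw [mul_assoc, mul_assoc, mul_assoc, ← mpow_add]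
        congr 3
        push_cast
        ring
      · rw [mul_assoc]
        congr 3
        push_cast
        ring
  · have hY : ∀ i j,
        HasDerivAt (fun t => mpow (X t) (-1) i j) ((-(mpow (X θ) (-1) * A)) i j) θ := by
      intro i j
      simp only [mpow_neg_one, Matrix.star_apply]
      refine (hX j i).star.congr_deriv ?_
      rw [← Matrix.star_apply, star_mul, hA, Matrix.mul_neg]
    induction n generalizing i j with
    | zero =>
      refine (hY i j).congr_deriv (congrFun (congrFun (Eq.symm ?_) i) j)
      change -∑ a ∈ range (0 + 1), mpow (X θ) (-(a + 1)) * A *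
        mpow (X θ) (-((0 : ℕ) + 1) + (a + 1)) = _
      simp [mpow_zero]
    | succ n ih =>
      have h := hasDerivAt_matrix_mul ih hY i j
      have he : ∀ t, mpow (X t) (Int.negSucc (n + 1)) =
          mpow (X t) (Int.negSucc n) * mpow (X t) (-1) := fun t => by
        rw [← mpow_add]
        rfl
      simp only [he]
      refine h.congr_deriv (congrFun (congrFun (Eq.symm ?_) i) j)
      rw [mpowDeriv_negSucc, mpowDeriv_negSucc]
      rw [Finset.sum_range_succ _ (n + 1), Matrix.neg_mul, Matrix.mul_neg]
      refine (neg_add _ _).trans (congrArg₂ _ (congrArg _ ?_) (congrArg _ ?_))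
      · rw [Finset.sum_mul]
        refine Finset.sum_congr rfl fun a _ => ?_
        rw [mul_assoc, mul_assoc, mul_assoc, ← mpow_add]
        congr 3
        push_cast
        ring
      · rw [← mul_assoc, ← mpow_add, neg_add_cancel, mpow_zero, mul_one]
        congr 2

lemma trace_mpowDeriv (V : U N) (A : Matrix (Fin N) (Fin N) ℂ) (k : ℤ) :
    (mpowDeriv V A k).trace = k * (A * mpow V k).trace := by
  have h : ∀ a b : ℤ, (mpow V a * A * mpow V b).trace = (A * mpow V (a + b)).trace := by
    intro a b
    rw [Matrix.trace_mul_comm, ← mul_assoc, ← mpow_add, Matrix.trace_mul_comm, add_comm]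
  rcases k with n | n
  · simp [mpowDeriv, Matrix.trace_sum, h]
  · have : ∀ a : ℕ, (-((a : ℤ) + 1) + (-((n : ℤ) + 1) + (a + 1))) = Int.negSucc n := by
      intro a
      rw [Int.negSucc_eq]
      ring
    simp only [mpowDeriv, Matrix.trace_neg, Matrix.trace_sum, h, this]
    simp [Int.negSucc_eq]
    ring

lemma mpowDeriv_add (V : U N) (A B : Matrix (Fin N) (Fin N) ℂ) (k : ℤ) :
    mpowDeriv V (A + B) k = mpowDeriv V A k + mpowDeriv V B k := by
  rcases k with n | n
  · simp [mpowDeriv, mul_add, add_mul, Finset.sum_add_distrib]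
  · simp only [mpowDeriv, mul_add, add_mul, Finset.sum_add_distrib, neg_add]

lemma mpowDeriv_smul (V : U N) (c : ℂ) (A : Matrix (Fin N) (Fin N) ℂ) (k : ℤ) :
    mpowDeriv V (c • A) k = c • mpowDeriv V A k := by
  rcases k with n | n
  · simp [mpowDeriv, Finset.smul_sum]
  · simp [mpowDeriv, Finset.smul_sum]

lemma continuous_mpowDeriv (A : Matrix (Fin N) (Fin N) ℂ) (k : ℤ) (i j : Fin N) :
    Continuous fun V : U N => mpowDeriv V A k i j := by
  have h : ∀ a b : ℤ, Continuous fun V : U N => (mpow V a * A * mpow V b) i j := by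
    intro a b
    simp only [Matrix.mul_apply]
    have := continuous_mpow (N := N)
    fun_prop
  rcases k with n | n
  · simp only [mpowDeriv, Matrix.sum_apply]
    exact continuous_finsetSum _ fun a _ => h _ _
  · simp only [mpowDeriv, Matrix.neg_apply, Matrix.sum_apply]
    exact (continuous_finsetSum _ fun a _ => h _ _).neg

end UnitaryDerivatives

/-! ### Haar invariance in infinitesimal form -/

section LoopEquation

variable {N : ℕ}

/-- Evaluation of a polynomial in the power sums at the eigenvalues of `V`. -/
def traceEval (V : U N) : MvPolynomial TVar ℂ →ₐ[ℂ] ℂ :=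
  MvPolynomial.aeval fun v => tr (V ^ charge v)

lemma traceEval_X (V : U N) (v : TVar) : traceEval V (MvPolynomial.X v) = tr (V ^ charge v) :=
  MvPolynomial.aeval_X _ _

lemma traceEval_powerVar (V : U N) (l : ℤ) : traceEval V (powerVar N l) = tr (V ^ l) := by
  refine map_powerVar (traceEval V) (fun l => tr (V ^ l)) ?_ (traceEval_X V) l
  rw [← trace_mpow, mpow_zero]
  simp

lemma continuous_tr_zpow (l : ℤ) : Continuous fun V : U N => tr (V ^ l) := by
  simp only [← trace_mpow, Matrix.trace, Matrix.diag_apply]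
  exact continuous_finsetSum _ fun i _ => continuous_mpow l i i

lemma continuous_traceEval (F : MvPolynomial TVar ℂ) :
    Continuous fun V : U N => traceEval V F := by
  induction F using MvPolynomial.induction_on with
  | C a => simpa [traceEval] using continuous_const
  | add F G hF hG => simpa using hF.fun_add hG
  | mul_X F v hF => simpa [traceEval_X] using hF.fun_mul (continuous_tr_zpow _)

/-- The derivation of the ring of power sums induced by `V ↦ A V`. -/
def traceDer (V : U N) (A : Matrix (Fin N) (Fin N) ℂ) :
    Derivation ℂ (MvPolynomial TVar ℂ) (MvPolynomial TVar ℂ) :=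
  MvPolynomial.mkDerivation ℂ fun v =>
    MvPolynomial.C ((charge v : ℂ) * (A * mpow V (charge v)).trace)

lemma traceEval_traceDer_mul (V : U N) (A : Matrix (Fin N) (Fin N) ℂ)
    (F G : MvPolynomial TVar ℂ) :
    traceEval V (traceDer V A (F * G)) = traceEval V F * traceEval V (traceDer V A G) +
      traceEval V G * traceEval V (traceDer V A F) := by
  rw [Derivation.leibniz, map_add, smul_eq_mul, smul_eq_mul, map_mul, map_mul]

lemma traceEval_traceDer_X (V : U N) (A : Matrix (Fin N) (Fin N) ℂ) (v : TVar) :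
    traceEval V (traceDer V A (MvPolynomial.X v)) =
      (charge v : ℂ) * (A * mpow V (charge v)).trace := by
  rw [traceDer, MvPolynomial.mkDerivation_X]
  simp [traceEval]

lemma traceEval_traceDer_C (V : U N) (A : Matrix (Fin N) (Fin N) ℂ) (c : ℂ) :
    traceEval V (traceDer V A (MvPolynomial.C c)) = 0 := by
  rw [← MvPolynomial.algebraMap_eq, Derivation.map_algebraMap, map_zero]

lemma hasDerivAt_traceEval {X : ℝ → U N} {A : Matrix (Fin N) (Fin N) ℂ} (hA : star A = -A) {θ : ℝ}
    (hX : ∀ i j, HasDerivAt (fun t => (X t : Matrix (Fin N) (Fin N) ℂ) i j)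
      ((A * (X θ : Matrix (Fin N) (Fin N) ℂ)) i j) θ) (F : MvPolynomial TVar ℂ) :
    HasDerivAt (fun t => traceEval (X t) F) (traceEval (X θ) (traceDer (X θ) A F)) θ := by
  induction F using MvPolynomial.induction_on with
  | C a =>
    rw [traceEval_traceDer_C]
    simpa [traceEval] using hasDerivAt_const θ a
  | add F G hF hG =>
    simp only [map_add]
    exact hF.add hG
  | mul_X F v hF =>
    have h : HasDerivAt (fun t => traceEval (X t) (MvPolynomial.X v))
        (traceEval (X θ) (traceDer (X θ) A (MvPolynomial.X v))) θ := by
      rw [traceEval_traceDer_X, ← trace_mpowDeriv]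
      simp only [traceEval_X, ← trace_mpow, Matrix.trace, Matrix.diag_apply]
      exact HasDerivAt.fun_sum fun i _ => hasDerivAt_mpow hA hX _ i i
    simp only [map_mul]
    refine (hF.mul h).congr_deriv ?_
    rw [traceEval_traceDer_mul]
    ring

lemma continuous_traceEval_traceDer (A : Matrix (Fin N) (Fin N) ℂ) (F : MvPolynomial TVar ℂ) :
    Continuous fun V : U N => traceEval V (traceDer V A F) := by
  induction F using MvPolynomial.induction_on with
  | C a => simpa [traceEval_traceDer_C] using continuous_const
  | add F G hF hG => simpa using hF.fun_add hG
  | mul_X F v hF =>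
    simp only [traceEval_traceDer_mul, traceEval_traceDer_X, traceEval_X]
    have h : Continuous fun V : U N => (A * mpow V (charge v)).trace := by
      simp only [Matrix.trace, Matrix.diag_apply, Matrix.mul_apply]
      have := continuous_mpow (N := N)
      fun_prop
    exact ((continuous_traceEval F).mul (continuous_const.mul h)).add
      ((continuous_tr_zpow _).mul hF)

instance : MeasureTheory.IsProbabilityMeasure (haarU N) :=
  ⟨MeasureTheory.Measure.haarMeasure_self⟩

instance : (haarU N).IsMulLeftInvariant :=
  inferInstanceAs (MeasureTheory.Measure.haarMeasure _).IsMulLeftInvariant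

lemma integrable_of_continuous {h : U N → ℂ} (hh : Continuous h) :
    MeasureTheory.Integrable h (haarU N) := by
  exact hh.integrable_of_hasCompactSupport (HasCompactSupport.of_compactSpace h)

/-- The integral of an infinitesimal left translate vanishes. -/
lemma integral_deriv_eq_zero {W : ℝ → U N} (hW : W 0 = 1) {h h' : U N → ℂ} (hh : Continuous h)
    (hh' : Continuous h')
    (hd : ∀ (V : U N) (θ : ℝ), HasDerivAt (fun t => h (W t * V)) (h' (W θ * V)) θ) :
    ∫ V, h' V ∂(haarU N) = 0 := by
  obtain ⟨C, hC⟩ := (isCompact_range hh').isBounded.exists_norm_le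
  have key := hasDerivAt_integral_of_dominated_loc_of_deriv_le (μ := haarU N)
    (F := fun (θ : ℝ) (V : U N) => h (W θ * V)) (F' := fun θ V => h' (W θ * V)) (x₀ := 0)
    (s := Set.univ) (bound := fun _ => C) Filter.univ_mem
    (Filter.Eventually.of_forall fun θ =>
      (hh.comp (continuous_const.mul continuous_id)).aestronglyMeasurable)
    (integrable_of_continuous (hh.comp (continuous_const.mul continuous_id)))
    (hh'.comp (continuous_const.mul continuous_id)).aestronglyMeasurable
    (Filter.Eventually.of_forall fun V θ _ => hC _ ⟨_, rfl⟩)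
    (MeasureTheory.integrable_const _)
    (Filter.Eventually.of_forall fun V θ _ => hd V θ)
  -- Left invariance makes the integral constant in θ, so its derivative at 0 vanishes; as `W 0 =
  -- 1`, that derivative is the integral in question.
  have h1 : (fun θ : ℝ => ∫ V, h (W θ * V) ∂(haarU N)) = fun _ => ∫ V, h V ∂(haarU N) := by
    funext θ
    exact MeasureTheory.integral_mul_left_eq_self h (W θ)
  have h2 := key.2
  rw [h1] at h2
  have h3 := h2.unique (hasDerivAt_const _ _)
  simpa [hW] using h3

end LoopEquation

/-! ### One-parameter groups generated by Hermitian projectors -/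

section OneParameter

variable {N : ℕ}

/-- For a projector this is exp(iθp): multiplication by e^{iθ} on the range of p, the identity on
its kernel. -/
lemma rotation_mem {p : Matrix (Fin N) (Fin N) ℂ} (hp : star p = p) (hpp : p * p = p) (θ : ℝ) :
    1 + (Complex.exp (θ * Complex.I) - 1) • p ∈ Matrix.unitaryGroup (Fin N) ℂ := by
  rw [Matrix.mem_unitaryGroup_iff']
  set u := Complex.exp (θ * Complex.I) with hu
  have h1 : star u * u = 1 := by
    rw [hu, Complex.star_def, ← Complex.exp_conj, ← Complex.exp_add]
    simp
  rw [star_add, star_one, star_smul, hp, star_sub, star_one]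
  rw [add_mul, one_mul, mul_add, mul_one, smul_mul_smul_comm, hpp, add_assoc, ← add_smul,
    ← add_smul]
  have h2 : u - 1 + (star u - 1 + (star u - 1) * (u - 1)) = 0 := by
    linear_combination h1
  rw [h2, zero_smul, add_zero]

/-- The one-parameter group of unitary matrices generated by a projector. -/
def rotation {p : Matrix (Fin N) (Fin N) ℂ} (hp : star p = p) (hpp : p * p = p) (θ : ℝ) : U N :=
  ⟨_, rotation_mem hp hpp θ⟩

lemma coe_rotation {p : Matrix (Fin N) (Fin N) ℂ} (hp : star p = p) (hpp : p * p = p) (θ : ℝ) :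
    (rotation hp hpp θ : Matrix (Fin N) (Fin N) ℂ) =
      1 + (Complex.exp (θ * Complex.I) - 1) • p := rfl

lemma rotation_zero {p : Matrix (Fin N) (Fin N) ℂ} (hp : star p = p) (hpp : p * p = p) :
    rotation hp hpp 0 = 1 := by
  apply Subtype.ext
  rw [coe_rotation]
  simp

lemma hasDerivAt_rotation_mul {p : Matrix (Fin N) (Fin N) ℂ} (hp : star p = p) (hpp : p * p = p)
    (V : U N) (θ : ℝ) (i j : Fin N) :
    HasDerivAt (fun t => ((rotation hp hpp t * V : U N) : Matrix (Fin N) (Fin N) ℂ) i j)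
      (((Complex.I • p) * ((rotation hp hpp θ * V : U N) : Matrix (Fin N) (Fin N) ℂ)) i j) θ := by
  have h1 : ∀ i j, HasDerivAt (fun t => (rotation hp hpp t : Matrix (Fin N) (Fin N) ℂ) i j)
      (((Complex.I • p) * (rotation hp hpp θ : Matrix (Fin N) (Fin N) ℂ)) i j) θ := by
    intro i j
    have h2 : HasDerivAt (fun t : ℝ => Complex.exp (t * Complex.I))
        (Complex.exp (θ * Complex.I) * Complex.I) θ := by
      have h3 : HasDerivAt (fun t : ℝ => (t : ℂ) * Complex.I) Complex.I θ := by
        simpa using (Complex.ofRealCLM.hasDerivAt (x := θ)).mul_const Complex.I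
      exact h3.cexp
    have h4 : (Complex.I • p) * (rotation hp hpp θ : Matrix (Fin N) (Fin N) ℂ) =
        (Complex.exp (θ * Complex.I) * Complex.I) • p := by
      rw [coe_rotation, mul_add, mul_one, smul_mul_smul_comm, hpp, ← add_smul]
      congr 1
      ring
    rw [h4]
    simp only [coe_rotation, Matrix.add_apply, Matrix.smul_apply, smul_eq_mul]
    exact ((h2.sub_const 1).mul_const (p i j)).const_add _
  have h5 := hasDerivAt_matrix_mul (X := fun t => (rotation hp hpp t : Matrix (Fin N) (Fin N) ℂ))
    (Y := fun _ => (V : Matrix (Fin N) (Fin N) ℂ)) (Y' := 0) h1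
    (fun i j => hasDerivAt_const _ _) i j
  refine h5.congr_deriv ?_
  rw [mul_zero, add_zero, mul_assoc]
  rfl

end OneParameter

/-! ### The loop equations -/

section LoopEquation

variable {N : ℕ}

/-- The derivative of `(V ^ k)_{ij} G(V)` in the direction `A V`. -/
def loopIntegrand (k : ℤ) (G : MvPolynomial TVar ℂ) (i j : Fin N)
    (A : Matrix (Fin N) (Fin N) ℂ) (V : U N) : ℂ :=
  mpowDeriv V A k i j * traceEval V G + mpow V k i j * traceEval V (traceDer V A G)

lemma continuous_loopIntegrand (k : ℤ) (G : MvPolynomial TVar ℂ) (i j : Fin N)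
    (A : Matrix (Fin N) (Fin N) ℂ) : Continuous (loopIntegrand k G i j A) :=
  ((continuous_mpowDeriv A k i j).mul (continuous_traceEval G)).add
    ((continuous_mpow k i j).mul (continuous_traceEval_traceDer A G))

lemma traceEval_traceDer_add (V : U N) (A B : Matrix (Fin N) (Fin N) ℂ)
    (G : MvPolynomial TVar ℂ) : traceEval V (traceDer V (A + B) G) =
      traceEval V (traceDer V A G) + traceEval V (traceDer V B G) := by
  induction G using MvPolynomial.induction_on with
  | C a => simp
  | add F G hF hG => rw [map_add, map_add, map_add, map_add, map_add, map_add, hF, hG]; ring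
  | mul_X F v hF =>
    simp only [traceEval_traceDer_mul, traceEval_traceDer_X, hF, add_mul, Matrix.trace_add]
    ring

lemma traceEval_traceDer_smul (V : U N) (c : ℂ) (A : Matrix (Fin N) (Fin N) ℂ)
    (G : MvPolynomial TVar ℂ) : traceEval V (traceDer V (c • A) G) =
      c * traceEval V (traceDer V A G) := by
  induction G using MvPolynomial.induction_on with
  | C a => simp
  | add F G hF hG => rw [map_add, map_add, map_add, map_add, hF, hG]; ring
  | mul_X F v hF =>
    simp only [traceEval_traceDer_mul, traceEval_traceDer_X, hF, Matrix.smul_mul,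
      Matrix.trace_smul, smul_eq_mul]
    ring

lemma loopIntegrand_add (k : ℤ) (G : MvPolynomial TVar ℂ) (i j : Fin N)
    (A B : Matrix (Fin N) (Fin N) ℂ) (V : U N) : loopIntegrand k G i j (A + B) V =
      loopIntegrand k G i j A V + loopIntegrand k G i j B V := by
  simp only [loopIntegrand, mpowDeriv_add, traceEval_traceDer_add, Matrix.add_apply]
  ring

lemma loopIntegrand_smul (k : ℤ) (G : MvPolynomial TVar ℂ) (i j : Fin N) (c : ℂ)
    (A : Matrix (Fin N) (Fin N) ℂ) (V : U N) : loopIntegrand k G i j (c • A) V =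
      c * loopIntegrand k G i j A V := by
  simp only [loopIntegrand, mpowDeriv_smul, traceEval_traceDer_smul, Matrix.smul_apply,
    smul_eq_mul]
  ring

/-- The directions `A` along which the integral of the derivative vanishes. -/
def nullDirections (k : ℤ) (G : MvPolynomial TVar ℂ) (i j : Fin N) :
    Submodule ℂ (Matrix (Fin N) (Fin N) ℂ) where
  carrier := {A | ∫ V, loopIntegrand k G i j A V ∂(haarU N) = 0}
  zero_mem' := by
    have : loopIntegrand k G i j (0 : Matrix (Fin N) (Fin N) ℂ) = 0 := by
      funext V
      simpa using loopIntegrand_smul k G i j 0 0 V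
    simp [this]
  add_mem' {A B} hA hB := by
    simp only [Set.mem_ofPred_eq, loopIntegrand_add] at *
    rw [MeasureTheory.integral_add (integrable_of_continuous (continuous_loopIntegrand k G i j A))
      (integrable_of_continuous (continuous_loopIntegrand k G i j B)), hA, hB, add_zero]
  smul_mem' c A hA := by
    simp only [Set.mem_ofPred_eq, loopIntegrand_smul] at *
    rw [MeasureTheory.integral_const_mul, hA, mul_zero]

/-- The group exp(iθp) has the skew-Hermitian direction ip, and complex linearity of the derivative
formula removes the factor i. -/
lemma projector_mem_nullDirections (k : ℤ) (G : MvPolynomial TVar ℂ) (i j : Fin N)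
    {p : Matrix (Fin N) (Fin N) ℂ} (hp : star p = p) (hpp : p * p = p) :
    p ∈ nullDirections k G i j := by
  have h : Complex.I • p ∈ nullDirections k G i j := by
    refine integral_deriv_eq_zero (rotation_zero hp hpp)
      (h := fun V => mpow V k i j * traceEval V G)
      ((continuous_mpow k i j).mul (continuous_traceEval G))
      (continuous_loopIntegrand k G i j _) fun V θ => ?_
    have hA : star (Complex.I • p) = -(Complex.I • p) := by
      rw [star_smul, hp]
      simp
    have hX := hasDerivAt_rotation_mul hp hpp V θ
    exact (hasDerivAt_mpow hA (X := fun t => rotation hp hpp t * V) hX k i j).mul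
      (hasDerivAt_traceEval hA (X := fun t => rotation hp hpp t * V) hX G)
  have h2 := (nullDirections k G i j).smul_mem (-Complex.I) h
  rw [smul_smul] at h2
  simpa using h2

/-- Hermitian projectors span all complex matrices: for |c| = 1 the matrix (E_aa + E_bb + cE_ab +
c̄E_ba)/2 is one, and combining c = 1 with c = i isolates E_ab. -/
lemma single_mem_nullDirections (k : ℤ) (G : MvPolynomial TVar ℂ) (i j a b : Fin N) :
    Matrix.single a b (1 : ℂ) ∈ nullDirections k G i j := by
  have hdiag : ∀ a, Matrix.single a a (1 : ℂ) ∈ nullDirections k G i j := fun a =>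
    projector_mem_nullDirections k G i j (by simp [Matrix.star_eq_conjTranspose]) (by simp)
  by_cases hab : a = b
  · subst hab
    exact hdiag a
  have hproj : ∀ c : ℂ, star c * c = 1 →
      c • Matrix.single a b (1 : ℂ) + star c • Matrix.single b a (1 : ℂ) ∈
        nullDirections k G i j := by
    intro c hc
    set p : Matrix (Fin N) (Fin N) ℂ := (2⁻¹ : ℂ) • (Matrix.single a a (1 : ℂ) +
      Matrix.single b b (1 : ℂ) +
      (c • Matrix.single a b (1 : ℂ) + star c • Matrix.single b a (1 : ℂ))) with hp
    have h1 : p ∈ nullDirections k G i j := by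
      refine projector_mem_nullDirections k G i j ?_ ?_
      · rw [hp, star_smul, star_add, star_add, star_add, star_smul, star_smul, star_star]
        simp only [Matrix.star_eq_conjTranspose, Matrix.conjTranspose_single, star_one]
        congr 1
        · simp
        · congr 1
          exact add_comm _ _
      · have hba : b ≠ a := Ne.symm hab
        rw [hp, smul_mul_smul_comm]
        simp only [mul_add, add_mul, smul_mul_assoc, mul_smul_comm, Matrix.single_mul_single_same,
          Matrix.single_mul_single_of_ne _ _ _ _ hab, Matrix.single_mul_single_of_ne _ _ _ _ hba,
          mul_one, smul_zero, add_zero, zero_add]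
        match_scalars
        all_goals first | ring1 | linear_combination (4⁻¹ : ℂ) * hc
    have h2 := Submodule.sub_mem _ ((nullDirections k G i j).smul_mem 2 h1)
      (Submodule.add_mem _ (hdiag a) (hdiag b))
    convert h2 using 1
    rw [hp, smul_smul]
    norm_num
  have h1 := hproj 1 (by simp)
  have h2 := (nullDirections k G i j).smul_mem (-Complex.I) (hproj Complex.I (by simp))
  have h3 := (nullDirections k G i j).smul_mem (2⁻¹ : ℂ) (Submodule.add_mem _ h1 h2)
  convert h3 using 1
  simp only [Complex.star_def, Complex.conj_I, map_one, one_smul, smul_add, smul_smul]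
  simp only [neg_mul, mul_neg, neg_neg, Complex.I_mul_I]
  module

/-- Integration of polynomials in the power sums of the eigenvalues over `U(N)`. -/
def haarIntegral (N : ℕ) : MvPolynomial TVar ℂ →ₗ[ℂ] ℂ where
  toFun F := ∫ V, traceEval V F ∂(haarU N)
  map_add' F G := by
    simp only [map_add]
    exact MeasureTheory.integral_add (integrable_of_continuous (continuous_traceEval F))
      (integrable_of_continuous (continuous_traceEval G))
  map_smul' c F := by
    simp only [map_smul, smul_eq_mul, RingHom.id_apply]
    exact MeasureTheory.integral_const_mul _ _

lemma sum_mul_mpow_single (a b : ℤ) (V : U N) :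
    ∑ i : Fin N, ∑ j : Fin N, (mpow V a * Matrix.single i j (1 : ℂ) * mpow V b :
      Matrix (Fin N) (Fin N) ℂ) i j =
      tr (V ^ a) * tr (V ^ b) := by
  rw [← trace_mpow, ← trace_mpow, Matrix.trace, Matrix.trace, Finset.sum_mul_sum]
  refine Finset.sum_congr rfl fun i _ => Finset.sum_congr rfl fun j _ => ?_
  rw [mul_assoc, Matrix.mul_apply, Finset.sum_eq_single i]
  · rw [Matrix.single_mul_apply_same]
    simp
  · intro l _ hl
    rw [Matrix.single_mul_apply_of_ne _ _ _ _ _ hl, mul_zero]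
  · simp

lemma sum_mpowDeriv_single (V : U N) (k : ℤ) :
    ∑ i, ∑ j, mpowDeriv V (Matrix.single i j 1) k i j = traceEval V (splitSum N k) := by
  have hcomm : ∀ (s : Finset ℕ) (f : ℕ → Fin N → Fin N → ℂ),
      ∑ i, ∑ j, ∑ a ∈ s, f a i j = ∑ a ∈ s, ∑ i, ∑ j, f a i j := fun s f =>
    (Finset.sum_congr rfl fun i _ => Finset.sum_comm).trans Finset.sum_comm
  rcases k with n | n
  · simp only [mpowDeriv, splitSum, map_sum, map_mul, traceEval_powerVar, Matrix.sum_apply, hcomm,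
      sum_mul_mpow_single]
  · simp only [mpowDeriv, splitSum, map_neg, map_sum, map_mul, traceEval_powerVar,
      Matrix.neg_apply, Matrix.sum_apply, Finset.sum_neg_distrib, hcomm, sum_mul_mpow_single]

/-- On a single power sum this is ∑_ij (V^k)_ij tr(E_ij V^l) = tr V^(k+l); both sides obey the
Leibniz rule. -/
lemma sum_traceDer_single (V : U N) (k : ℤ) (G : MvPolynomial TVar ℂ) :
    ∑ i, ∑ j, mpow V k i j * traceEval V (traceDer V (Matrix.single i j 1) G) =
      traceEval V (shiftDer N k G) := by
  induction G using MvPolynomial.induction_on with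
  | C a =>
    rw [← MvPolynomial.algebraMap_eq, Derivation.map_algebraMap, map_zero]
    simp
  | add F G hF hG =>
    rw [map_add, map_add, ← hF, ← hG]
    simp only [map_add, mul_add, Finset.sum_add_distrib]
  | mul_X F v hF =>
    rw [Derivation.leibniz, map_add, smul_eq_mul, smul_eq_mul, map_mul, map_mul, ← hF,
      shiftDer, MvPolynomial.mkDerivation_X, map_smul, traceEval_powerVar, ← trace_mpow, mpow_add]
    have h : ∀ i j : Fin N, (Matrix.single i j (1 : ℂ) * mpow V (charge v)).trace =
        mpow V (charge v) j i := by
      intro i j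
      simp [Matrix.trace_single_mul]
    simp only [traceEval_traceDer_mul, traceEval_traceDer_X, mul_add, Finset.sum_add_distrib, h]
    congr 1
    · simp only [Matrix.trace, Matrix.diag_apply, Matrix.mul_apply, Finset.mul_sum, smul_eq_mul]
      refine Finset.sum_congr rfl fun i _ => Finset.sum_congr rfl fun j _ => ?_
      ring
    · simp only [Finset.mul_sum]
      refine Finset.sum_congr rfl fun i _ => Finset.sum_congr rfl fun j _ => ?_
      ring

/-- Differentiate (V^k)_ij G(V) along E_ij and sum over i, j. The derivative of V^k splits into
products of two traces, the derivative of G merges two traces into one, and each summand integrates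
to zero. -/
theorem loop_equation (N : ℕ) (k : ℤ) (G : MvPolynomial TVar ℂ) :
    haarIntegral N (splitSum N k * G + shiftDer N k G) = 0 := by
  have h : ∀ V : U N, traceEval V (splitSum N k * G + shiftDer N k G) =
      ∑ i, ∑ j, loopIntegrand k G i j (Matrix.single i j 1) V := by
    intro V
    simp only [loopIntegrand, Finset.sum_add_distrib]
    rw [sum_traceDer_single, map_add, map_mul, ← sum_mpowDeriv_single]
    simp only [Finset.sum_mul]
  change ∫ V, traceEval V (splitSum N k * G + shiftDer N k G) ∂(haarU N) = 0
  simp only [h]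
  have hi : ∀ i j : Fin N, MeasureTheory.Integrable
      (loopIntegrand k G i j (Matrix.single i j 1)) (haarU N) := fun i j =>
    integrable_of_continuous (continuous_loopIntegrand k G i j _)
  rw [MeasureTheory.integral_finsetSum _ fun i _ =>
    MeasureTheory.integrable_finsetSum _ fun j _ => hi i j]
  refine Finset.sum_eq_zero fun i _ => ?_
  rw [MeasureTheory.integral_finsetSum _ fun j _ => hi i j]
  exact Finset.sum_eq_zero fun j _ => single_mem_nullDirections k G i j i j

end LoopEquation

/-! ### Laurent polynomials, Witt derivations and the Vandermonde determinant -/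

section LaurentPolynomials

variable {N : ℕ}

/-- The ring `ℂ[x_1^{±1}, …, x_N^{±1}]`. -/
abbrev LaurentN (N : ℕ) : Type := AddMonoidAlgebra ℂ (Fin N → ℤ)

/-- The power `x_i ^ l`. -/
def xpow (i : Fin N) (l : ℤ) : LaurentN N := AddMonoidAlgebra.single (Pi.single i l) 1

lemma xpow_add (i : Fin N) (k l : ℤ) : xpow i (k + l) = xpow i k * xpow i l := by
  rw [xpow, xpow, xpow, AddMonoidAlgebra.single_mul_single, mul_one, Pi.single_add]

lemma xpow_zero (i : Fin N) : xpow i 0 = 1 := by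
  rw [xpow, Pi.single_zero, AddMonoidAlgebra.one_def]

lemma xpow_injective (l : ℤ) (hl : l ≠ 0) : Function.Injective fun i : Fin N => xpow i l := by
  intro i j hij
  have h := (AddMonoidAlgebra.single_left_injective (one_ne_zero (α := ℂ))) hij
  by_contra hne
  have := congrFun h i
  rw [Pi.single_eq_same, Pi.single_eq_of_ne hne] at this
  exact hl this

lemma laurent_induction {p : LaurentN N → Prop} (f : LaurentN N) (h0 : p 0)
    (hadd : ∀ f g, p f → p g → p (f + g)) (hs : ∀ μ c, p (AddMonoidAlgebra.single μ c)) : p f :=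
  AddMonoidAlgebra.induction_linear f h0 hadd hs

/-- The linear map that multiplies the monomial `x^μ` by `ε μ`. -/
def diagonal (ε : (Fin N → ℤ) → ℂ) : LaurentN N →ₗ[ℂ] LaurentN N where
  toFun f := .ofCoeff (Finsupp.onFinset f.coeff.support (fun μ => ε μ * f.coeff μ)
    fun μ h => by
      rw [Finsupp.mem_support_iff]
      exact right_ne_zero_of_mul h)
  map_add' f g := by
    apply AddMonoidAlgebra.coeff_injective
    ext μ
    simp [mul_add]
  map_smul' c f := by
    apply AddMonoidAlgebra.coeff_injective
    ext μ
    simp [mul_left_comm]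

lemma coeff_diagonal (ε : (Fin N → ℤ) → ℂ) (f : LaurentN N) (μ : Fin N → ℤ) :
    (diagonal ε f).coeff μ = ε μ * f.coeff μ := rfl

lemma diagonal_single (ε : (Fin N → ℤ) → ℂ) (μ : Fin N → ℤ) (c : ℂ) :
    diagonal ε (AddMonoidAlgebra.single μ c) = AddMonoidAlgebra.single μ (ε μ * c) := by
  apply AddMonoidAlgebra.coeff_injective
  ext ν
  rw [coeff_diagonal, AddMonoidAlgebra.coeff_single, AddMonoidAlgebra.coeff_single]
  by_cases h : ν = μ
  · subst h
    simp
  · rw [Finsupp.single_eq_of_ne h, Finsupp.single_eq_of_ne h, mul_zero]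

/-- The Euler operator `x_i ∂/∂x_i`. -/
def euler (i : Fin N) : Derivation ℂ (LaurentN N) (LaurentN N) :=
  Derivation.mk' (diagonal fun μ => (μ i : ℂ)) fun f g => by
    induction f using laurent_induction with
    | h0 => simp
    | hadd f f' hf hf' =>
      rw [add_mul, map_add, hf, hf', map_add]
      simp only [smul_eq_mul]
      ring
    | hs μ c =>
      induction g using laurent_induction with
      | h0 => simp
      | hadd g g' hg hg' =>
        rw [mul_add, map_add, hg, hg', map_add]
        simp only [smul_eq_mul]
        ring
      | hs ν d =>
        simp only [AddMonoidAlgebra.single_mul_single, diagonal_single, smul_eq_mul]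
        rw [add_comm ν μ, ← AddMonoidAlgebra.single_add]
        congr 1
        rw [Pi.add_apply]
        push_cast
        ring

lemma euler_apply (i : Fin N) (f : LaurentN N) :
    euler i f = diagonal (fun μ => (μ i : ℂ)) f := rfl

lemma euler_xpow (i j : Fin N) (l : ℤ) :
    euler i (xpow j l) = if i = j then (l : LaurentN N) * xpow j l else 0 := by
  rw [euler_apply, xpow, diagonal_single]
  split_ifs with h
  · subst h
    rw [Pi.single_eq_same, ← AddMonoidAlgebra.smul_single', Int.cast_smul_eq_zsmul, zsmul_eq_mul]
  · rw [Pi.single_eq_of_ne h]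
    simp

/-- The derivation `∑_i x_i^{l+1} ∂/∂x_i`. -/
def witt (l : ℤ) : Derivation ℂ (LaurentN N) (LaurentN N) := ∑ i, xpow i l • euler i

lemma witt_apply (l : ℤ) (f : LaurentN N) : witt l f = ∑ i, xpow i l * euler i f := by
  have h : ∀ s : Finset (Fin N), (∑ i ∈ s, xpow i l • euler i) f =
      ∑ i ∈ s, xpow i l * euler i f := by
    intro s
    induction s using Finset.induction_on with
    | empty => simp
    | insert a s ha ih => simp [Finset.sum_insert ha, ih]
  exact h _

lemma witt_xpow (l : ℤ) (j : Fin N) (m : ℤ) :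
    witt l (xpow j m) = (m : LaurentN N) * xpow j (l + m) := by
  rw [witt_apply, Finset.sum_eq_single j]
  · rw [euler_xpow, if_pos rfl, xpow_add]
    ring
  · intro i _ hi
    rw [euler_xpow, if_neg hi, mul_zero]
  · simp

/-- The quotient `(x_i^{l+1} - x_j^{l+1}) / (x_i - x_j)`. -/
def dividedDiff (i j : Fin N) : ℤ → LaurentN N
  | Int.ofNat n => ∑ a ∈ range (n + 1), xpow i a * xpow j (n - a)
  | Int.negSucc n => -∑ a ∈ range n, xpow i (-(a + 1)) * xpow j (-(n + 1) + (a + 1))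

lemma sub_mul_dividedDiff (i j : Fin N) (l : ℤ) :
    (xpow i 1 - xpow j 1) * dividedDiff i j l = xpow i (l + 1) - xpow j (l + 1) := by
  rcases l with n | n
  · have h : ∀ a : ℕ, (xpow i 1 - xpow j 1) * (xpow i a * xpow j (n - a)) =
        xpow i ((a + 1 : ℕ) : ℤ) * xpow j (n + 1 - (a + 1 : ℕ)) -
          xpow i (a : ℤ) * xpow j (n + 1 - a) := by
      intro a
      rw [show (n + 1 - a : ℤ) = 1 + (n - a) by ring, xpow_add j, Nat.cast_succ,
        xpow_add i, add_sub_add_right_eq_sub]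
      ring
    rw [dividedDiff, Finset.mul_sum, Finset.sum_congr rfl fun a _ => h a,
      Finset.sum_range_sub (fun a : ℕ => xpow i (a : ℤ) * xpow j (n + 1 - a))]
    simp [xpow_zero]
  · have h : ∀ a : ℕ, (xpow i 1 - xpow j 1) * (xpow i (-(a + 1)) * xpow j (-(n + 1) + (a + 1))) =
        xpow i (-(a : ℤ)) * xpow j (-n + a) -
          xpow i (-((a + 1 : ℕ) : ℤ)) * xpow j (-n + (a + 1 : ℕ)) := by
      intro a
      have h1 : xpow i (-(a : ℤ)) = xpow i 1 * xpow i (-(a + 1)) := by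
        rw [← xpow_add]
        congr 1
        ring
      have h2 : xpow j (-n + (a + 1 : ℕ)) = xpow j 1 * xpow j (-(n + 1) + (a + 1)) := by
        rw [← xpow_add]
        congr 1
        push_cast
        ring
      rw [h1, h2, show (-(n + 1) + (a + 1) : ℤ) = -n + a by ring]
      push_cast
      ring
    rw [dividedDiff, mul_neg, Finset.mul_sum, Finset.sum_congr rfl fun a _ => h a,
      Finset.sum_range_sub' (fun a : ℕ => xpow i (-(a : ℤ)) * xpow j (-n + a)),
      show Int.negSucc n + 1 = -n by rw [Int.negSucc_eq]; ring]
    simp [xpow_zero]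

lemma dividedDiff_self (i : Fin N) (l : ℤ) :
    dividedDiff i i l = ((l + 1 : ℤ) : LaurentN N) * xpow i l := by
  rcases l with n | n
  · rw [dividedDiff, Finset.sum_congr rfl fun a _ => (xpow_add i _ _).symm]
    simp
  · have h : ∀ a : ℕ, (-((a : ℤ) + 1) + (-(n + 1) + (a + 1)) : ℤ) = Int.negSucc n := by
      intro a
      rw [Int.negSucc_eq]
      ring
    simp only [dividedDiff, ← xpow_add, h]
    rw [Finset.sum_const, Finset.card_range, nsmul_eq_mul, ← neg_mul,
      show Int.negSucc n + 1 = -n by rw [Int.negSucc_eq]; ring]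
    push_cast
    rfl

lemma dividedDiff_comm (i j : Fin N) (l : ℤ) : dividedDiff i j l = dividedDiff j i l := by
  by_cases hij : i = j
  · rw [hij]
  · have h : xpow i 1 - xpow j 1 ≠ 0 := sub_ne_zero.mpr fun h =>
      hij (xpow_injective 1 one_ne_zero h)
    refine mul_left_cancel₀ h ?_
    rw [sub_mul_dividedDiff, ← neg_sub (xpow j 1), neg_mul, sub_mul_dividedDiff, neg_sub]

/-- The power sums `p_l = ∑_i x_i^l`. -/
def powerEval (N : ℕ) : MvPolynomial TVar ℂ →ₐ[ℂ] LaurentN N :=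
  MvPolynomial.aeval fun v => ∑ i, xpow i (charge v)

lemma powerEval_X (v : TVar) :
    powerEval N (MvPolynomial.X v) = ∑ i, xpow i (charge v) := MvPolynomial.aeval_X _ _

lemma powerEval_powerVar (l : ℤ) : powerEval N (powerVar N l) = ∑ i, xpow i l :=
  map_powerVar (powerEval N) (fun l => ∑ i, xpow i l) (by simp [xpow_zero]) powerEval_X l

/-- Compared with `splitSum`, the sum in `dividedDiff` has one more term for l ≥ 0 and one fewer for
l < 0. Either way the discrepancy is a product with p_0 = N, and it contributes +N p_l. -/
lemma sum_dividedDiff (l : ℤ) : ∑ i : Fin N, ∑ j : Fin N, dividedDiff i j l =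
    powerEval N (splitSum N l) + (N : LaurentN N) * powerEval N (powerVar N l) := by
  have hcomm : ∀ (s : Finset ℕ) (f : ℕ → Fin N → Fin N → LaurentN N),
      ∑ i, ∑ j, ∑ a ∈ s, f a i j = ∑ a ∈ s, ∑ i, ∑ j, f a i j := fun s f =>
    (Finset.sum_congr rfl fun i _ => Finset.sum_comm).trans Finset.sum_comm
  have h0 : powerEval N (powerVar N 0) = N := by
    rw [powerVar_zero, ← MvPolynomial.algebraMap_eq, AlgHom.commutes, map_natCast]
  rcases l with n | n
  · simp only [dividedDiff, splitSum, map_sum, map_mul, hcomm]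
    rw [Finset.sum_range_succ, sub_self, powerEval_powerVar]
    simp only [powerEval_powerVar, Finset.sum_mul_sum, xpow_zero, mul_one, Finset.sum_const]
    simp [Finset.mul_sum]
  · simp only [dividedDiff, splitSum, map_neg, map_sum, map_mul, Finset.sum_neg_distrib, hcomm]
    rw [Finset.sum_range_succ _ n, neg_add_cancel, h0, Int.negSucc_eq]
    simp only [powerEval_powerVar, Finset.sum_mul_sum]
    ring

/-- The Vandermonde determinant `∏_{i < j} (x_j - x_i)`. -/
def vdm (N : ℕ) : LaurentN N := (Matrix.vandermonde fun i : Fin N => xpow i 1).det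

lemma derivation_prod_of_eigen {ι A : Type*} [CommRing A] [Algebra ℂ A] (d : Derivation ℂ A A)
    (s : Finset ι) (f h : ι → A) (hf : ∀ a ∈ s, d (f a) = h a * f a) :
    d (∏ a ∈ s, f a) = (∑ a ∈ s, h a) * ∏ a ∈ s, f a := by
  classical
  induction s using Finset.induction_on with
  | empty => simp
  | insert a s ha ih =>
    rw [Finset.prod_insert ha, Finset.sum_insert ha, Derivation.leibniz,
      ih fun b hb => hf b (Finset.mem_insert_of_mem hb), hf a (Finset.mem_insert_self _ _)]
    simp only [smul_eq_mul]
    ring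

/-- The Witt derivation multiplies each factor x_j - x_i by a divided difference. Passing to ordered
pairs costs the factor 2, and subtracting the diagonal pairs gives the term -(l + 1) p_l. -/
lemma two_mul_witt_vdm (l : ℤ) : 2 * witt l (vdm N) =
    (powerEval N (splitSum N l) +
      ((N - 1 - l : ℤ) : LaurentN N) * powerEval N (powerVar N l)) * vdm N := by
  have h1 : witt l (vdm N) = (∑ i, ∑ j ∈ Ioi i, dividedDiff j i l) * vdm N := by
    rw [vdm, Matrix.det_vandermonde]
    refine derivation_prod_of_eigen _ _ _ _ fun i _ =>
      derivation_prod_of_eigen _ _ _ _ fun j _ => ?_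
    rw [map_sub, witt_xpow, witt_xpow, mul_comm (dividedDiff _ _ _), sub_mul_dividedDiff]
    simp
  have h2 := Finset.sum_sum_Ioi_add_eq_sum_sum_off_diag (fun i j : Fin N => dividedDiff i j l)
  have h3 : ∀ i : Fin N, ∑ j ∈ {i}ᶜ, dividedDiff j i l =
      ∑ j, dividedDiff i j l - ((l + 1 : ℤ) : LaurentN N) * xpow i l := by
    intro i
    rw [← dividedDiff_self, eq_sub_iff_add_eq, add_comm,
      ← Fintype.sum_eq_add_sum_compl i (fun j => dividedDiff j i l)]
    exact Finset.sum_congr rfl fun j _ => dividedDiff_comm _ _ _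
  have h4 : ∑ i : Fin N, ∑ j ∈ Ioi i, (dividedDiff j i l + dividedDiff i j l) =
      2 * ∑ i : Fin N, ∑ j ∈ Ioi i, dividedDiff j i l := by
    rw [Finset.mul_sum]
    refine Finset.sum_congr rfl fun i _ => ?_
    rw [Finset.mul_sum]
    refine Finset.sum_congr rfl fun j _ => ?_
    rw [dividedDiff_comm i j, two_mul]
  have h5 : 2 * ∑ i : Fin N, ∑ j ∈ Ioi i, dividedDiff j i l = powerEval N (splitSum N l) +
      ((N - 1 - l : ℤ) : LaurentN N) * powerEval N (powerVar N l) := by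
    rw [← h4, h2, Finset.sum_congr rfl fun i _ => h3 i, Finset.sum_sub_distrib, sum_dividedDiff,
      ← Finset.mul_sum, powerEval_powerVar]
    push_cast
    ring
  rw [h1, ← mul_assoc, h5]

end LaurentPolynomials

/-! ### The Casimir operator and its conjugate by the Vandermonde determinant -/

section Casimir

variable {N : ℕ}

/-- The eigenvalue of the Casimir operator on `x^μ`. -/
def casimirValue (μ : Fin N → ℤ) : ℤ :=
  ∑ i, μ i * (μ i - (N - 1)) - ∑ i : Fin N, (i : ℤ) * ((i : ℤ) - (N - 1))

/-- The Casimir operator, whose kernel contains the Vandermonde determinant. -/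
def casimir : LaurentN N →ₗ[ℂ] LaurentN N := diagonal fun μ => (casimirValue μ : ℂ)

lemma casimir_apply (f : LaurentN N) :
    casimir f = ∑ i, euler i (euler i f) - ((N - 1 : ℤ) : LaurentN N) * ∑ i, euler i f -
      ((∑ i : Fin N, (i : ℤ) * ((i : ℤ) - (N - 1)) : ℤ) : LaurentN N) * f := by
  have h : ∀ (c : ℤ) (g : LaurentN N), (c : LaurentN N) * g = (c : ℂ) • g := by
    intro c g
    rw [Int.cast_smul_eq_zsmul, zsmul_eq_mul]
  rw [h, h]
  apply AddMonoidAlgebra.coeff_injective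
  ext μ
  simp only [casimir, casimirValue, euler_apply, coeff_diagonal, AddMonoidAlgebra.coeff_sub,
    AddMonoidAlgebra.coeff_smul, AddMonoidAlgebra.coeff_sum, Finsupp.sub_apply,
    Finsupp.smul_apply, Finsupp.finsetSum_apply, smul_eq_mul]
  push_cast
  simp only [mul_sub, Finset.sum_sub_distrib, sub_mul, Finset.sum_mul, Finset.mul_sum]
  congr 2
  · exact Finset.sum_congr rfl fun i _ => by ring
  · exact congrArg₂ _ (Finset.sum_congr rfl fun i _ => by ring)
      (Finset.sum_congr rfl fun i _ => by ring)

lemma casimir_mul (f g : LaurentN N) :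
    casimir (f * g) =
      (∑ i, euler i (euler i f) - ((N - 1 : ℤ) : LaurentN N) * ∑ i, euler i f) * g +
        2 * ∑ i, euler i f * euler i g + f * casimir g := by
  have h : ∀ i : Fin N, euler i (euler i (f * g)) = euler i (euler i f) * g +
      2 * (euler i f * euler i g) + f * euler i (euler i g) := by
    intro i
    simp only [Derivation.leibniz, map_add, smul_eq_mul]
    ring
  rw [casimir_apply, casimir_apply, Finset.sum_congr rfl fun i _ => h i]
  simp only [Derivation.leibniz, smul_eq_mul, Finset.sum_add_distrib, ← Finset.mul_sum,
    ← Finset.sum_mul]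
  have h2 : ∑ i, g * euler i f = (∑ i, euler i f) * g := by
    rw [Finset.sum_mul]
    exact Finset.sum_congr rfl fun i _ => mul_comm _ _
  rw [← Finset.mul_sum] at h2
  rw [h2]
  ring

/-- The exponent `ρ` of the leading monomial of the Vandermonde determinant. -/
def rho (N : ℕ) : Fin N → ℤ := fun i => i

lemma casimirValue_comp (μ : Fin N → ℤ) (σ : Equiv.Perm (Fin N)) :
    casimirValue (μ ∘ σ) = casimirValue μ := by
  simp only [casimirValue, Function.comp_apply]
  rw [Equiv.sum_comp σ fun i => μ i * (μ i - (N - 1))]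

lemma casimirValue_rho : casimirValue (rho N) = 0 := sub_self _

lemma vdm_eq_sum : vdm N = ∑ σ : Equiv.Perm (Fin N),
    AddMonoidAlgebra.single (rho N ∘ σ) ((Equiv.Perm.sign σ : ℤ) : ℂ) := by
  have hp : ∀ (i : Fin N) (n : ℕ), xpow i 1 ^ n = xpow i n := by
    intro i n
    rw [xpow, AddMonoidAlgebra.single_pow, one_pow, xpow, ← Pi.single_smul]
    simp
  have hprod : ∀ σ : Equiv.Perm (Fin N), ∀ s : Finset (Fin N), ∏ i ∈ s, xpow i (rho N (σ i)) =
      AddMonoidAlgebra.single (∑ i ∈ s, Pi.single i (rho N (σ i))) 1 := by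
    intro σ s
    induction s using Finset.induction_on with
    | empty => simp [AddMonoidAlgebra.one_def]
    | insert a s ha ih =>
      rw [Finset.prod_insert ha, Finset.sum_insert ha, ih, xpow,
        AddMonoidAlgebra.single_mul_single, mul_one]
  rw [vdm, ← Matrix.det_transpose, Matrix.det_apply']
  refine Finset.sum_congr rfl fun σ _ => ?_
  simp only [Matrix.transpose_apply, Matrix.vandermonde_apply, hp]
  rw [show ∏ i, xpow i ((σ i : ℕ) : ℤ) = AddMonoidAlgebra.single (rho N ∘ σ) 1 by
    refine (hprod σ univ).trans ?_
    rw [Finset.univ_sum_single]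
    rfl]
  have h : ∀ (c : ℤ) (g : LaurentN N), (c : LaurentN N) * g = (c : ℂ) • g := by
    intro c g
    rw [Int.cast_smul_eq_zsmul, zsmul_eq_mul]
  rw [h, AddMonoidAlgebra.smul_single', mul_one]

/-- All exponents of the Vandermonde determinant are permutations of ρ, where the eigenvalue is
normalised to zero. -/
lemma casimir_vdm : casimir (vdm N) = 0 := by
  rw [vdm_eq_sum, map_sum]
  refine Finset.sum_eq_zero fun σ _ => ?_
  rw [casimir, diagonal_single, casimirValue_comp, casimirValue_rho]
  simp

lemma coeff_mul_vdm (f : LaurentN N) (μ : Fin N → ℤ) : (f * vdm N).coeff μ =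
    ∑ σ : Equiv.Perm (Fin N), ((Equiv.Perm.sign σ : ℤ) : ℂ) * f.coeff (μ - rho N ∘ σ) := by
  rw [vdm_eq_sum, Finset.mul_sum, AddMonoidAlgebra.coeff_sum, Finsupp.finsetSum_apply]
  refine Finset.sum_congr rfl fun σ _ => ?_
  rw [AddMonoidAlgebra.coeff_mul_single_apply, mul_comm, sub_eq_add_neg]

/-- The chain rule. One finite set of variables has to serve all derivations at once, since it is
applied to every Euler operator; permitting larger sets makes the induction go through. -/
lemma derivation_powerEval (F : MvPolynomial TVar ℂ) : ∃ s₀ : Finset TVar, ∀ s, s₀ ⊆ s →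
    ∀ d : Derivation ℂ (LaurentN N) (LaurentN N), d (powerEval N F) =
      ∑ v ∈ s, powerEval N (MvPolynomial.pderiv v F) * d (powerEval N (MvPolynomial.X v)) := by
  classical
  induction F using MvPolynomial.induction_on with
  | C a =>
    refine ⟨∅, fun s _ d => ?_⟩
    rw [← MvPolynomial.algebraMap_eq, AlgHom.commutes, Derivation.map_algebraMap]
    simp
  | add F G hF hG =>
    obtain ⟨s, hs⟩ := hF
    obtain ⟨t, ht⟩ := hG
    refine ⟨s ∪ t, fun u hu d => ?_⟩
    rw [map_add, map_add, hs u (Finset.union_subset_left hu), ht u (Finset.union_subset_right hu),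
      ← Finset.sum_add_distrib]
    exact Finset.sum_congr rfl fun v _ => by rw [map_add, map_add, add_mul]
  | mul_X F w hF =>
    obtain ⟨s, hs⟩ := hF
    refine ⟨insert w s, fun u hu d => ?_⟩
    rw [map_mul, Derivation.leibniz, hs u ((Finset.subset_insert _ _).trans hu)]
    have h : ∀ v, powerEval N (MvPolynomial.pderiv v (F * MvPolynomial.X w)) =
        powerEval N (MvPolynomial.X w) * powerEval N (MvPolynomial.pderiv v F) +
          if v = w then powerEval N F else 0 := by
      intro v
      rw [Derivation.leibniz, MvPolynomial.pderiv_X, map_add, smul_eq_mul, smul_eq_mul, map_mul,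
        map_mul, Pi.single_apply]
      by_cases hvw : v = w
      · subst hvw
        simp [add_comm]
      · simp [hvw, Ne.symm hvw]
    simp only [h, add_mul, Finset.sum_add_distrib, ite_mul, zero_mul, Finset.sum_ite_eq',
      if_pos (hu (Finset.mem_insert_self w s)), smul_eq_mul, Finset.mul_sum, mul_assoc]
    rw [add_comm]

lemma powerEval_shiftDer (l : ℤ) (F : MvPolynomial TVar ℂ) :
    powerEval N (shiftDer N l F) = witt l (powerEval N F) := by
  induction F using MvPolynomial.induction_on with
  | C a =>
    rw [← MvPolynomial.algebraMap_eq, Derivation.map_algebraMap, AlgHom.commutes,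
      Derivation.map_algebraMap, map_zero]
  | add F G hF hG => simp only [map_add, hF, hG]
  | mul_X F v hF =>
    rw [Derivation.leibniz, map_mul, Derivation.leibniz, map_add, smul_eq_mul, smul_eq_mul,
      map_mul, map_mul, hF, shiftDer, MvPolynomial.mkDerivation_X, map_smul, powerEval_powerVar,
      powerEval_X, map_sum]
    simp only [witt_xpow, ← Finset.mul_sum]
    rw [Int.cast_smul_eq_zsmul, zsmul_eq_mul]
    rfl

/-- The operator on polynomials in the power sums that corresponds to the Casimir operator. -/
def loopOperator (N : ℕ) (s : Finset TVar) (F : MvPolynomial TVar ℂ) : MvPolynomial TVar ℂ :=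
  ∑ v ∈ s, (charge v : ℂ) • (splitSum N (charge v) * MvPolynomial.pderiv v F +
    shiftDer N (charge v) (MvPolynomial.pderiv v F))

lemma haarIntegral_loopOperator (s : Finset TVar) (F : MvPolynomial TVar ℂ) :
    haarIntegral N (loopOperator N s F) = 0 := by
  rw [loopOperator, map_sum]
  refine Finset.sum_eq_zero fun v _ => ?_
  rw [map_smul, loop_equation, smul_zero]

/-- In the second-order Leibniz rule for F Δ the term with the Casimir of Δ vanishes and the cross
term is given by `two_mul_witt_vdm`. The multiples of p_l ∂F then cancel, leaving exactly loop
equations with G = ∂_v F. Hence the conjugated Casimir has image of integral zero. -/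
lemma exists_loopOperator (F : MvPolynomial TVar ℂ) : ∃ s,
    powerEval N (loopOperator N s F) * vdm N = casimir (powerEval N F * vdm N) := by
  obtain ⟨s, hs⟩ := derivation_powerEval (N := N) F
  refine ⟨s, ?_⟩
  replace hs := hs s subset_rfl
  have he : ∀ (i : Fin N) (v : TVar), euler i (powerEval N (MvPolynomial.X v)) =
      (charge v : LaurentN N) * xpow i (charge v) := by
    intro i v
    rw [powerEval_X, map_sum, Finset.sum_eq_single i]
    · rw [euler_xpow, if_pos rfl]
    · intro j _ hj
      rw [euler_xpow, if_neg hj.symm]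
    · simp
  have hB : ∑ i, euler i (powerEval N F) = ∑ v ∈ s, (charge v : LaurentN N) *
      (powerEval N (MvPolynomial.pderiv v F) * powerEval N (powerVar N (charge v))) := by
    simp only [hs, he, powerEval_powerVar, Finset.mul_sum]
    rw [Finset.sum_comm]
    exact Finset.sum_congr rfl fun v _ => Finset.sum_congr rfl fun i _ => by ring
  have hA : ∑ i, euler i (powerEval N F) * euler i (vdm N) = ∑ v ∈ s, (charge v : LaurentN N) *
      (powerEval N (MvPolynomial.pderiv v F) * witt (charge v) (vdm N)) := by
    simp only [hs, he, witt_apply, Finset.mul_sum, Finset.sum_mul]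
    rw [Finset.sum_comm]
    exact Finset.sum_congr rfl fun v _ => Finset.sum_congr rfl fun i _ => by ring
  have hC : ∑ i, euler i (euler i (powerEval N F)) = ∑ v ∈ s, (charge v : LaurentN N) *
      ((charge v : LaurentN N) * (powerEval N (MvPolynomial.pderiv v F) *
        powerEval N (powerVar N (charge v))) +
          powerEval N (shiftDer N (charge v) (MvPolynomial.pderiv v F))) := by
    simp only [hs, he, powerEval_powerVar, powerEval_shiftDer, witt_apply, Finset.mul_sum,
      ← Finset.sum_add_distrib, map_sum]
    rw [Finset.sum_comm]
    refine Finset.sum_congr rfl fun v _ => Finset.sum_congr rfl fun i _ => ?_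
    rw [Derivation.leibniz, Derivation.leibniz, euler_xpow, if_pos rfl, Derivation.map_intCast]
    simp only [smul_eq_mul]
    ring
  rw [casimir_mul, casimir_vdm, hA, hB, hC, loopOperator, map_sum, Finset.mul_sum, Finset.mul_sum,
    ← Finset.sum_sub_distrib, Finset.sum_mul, Finset.sum_mul, ← Finset.sum_add_distrib, mul_zero,
    add_zero]
  refine Finset.sum_congr rfl fun v _ => ?_
  have h := two_mul_witt_vdm (N := N) (charge v)
  rw [map_smul, Int.cast_smul_eq_zsmul, zsmul_eq_mul, map_add, map_mul]
  push_cast at h ⊢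
  linear_combination (-(charge v : LaurentN N) * powerEval N (MvPolynomial.pderiv v F)) * h

end Casimir

/-! ### Traces of powers as power sums of eigenvalues -/

section Eigenvalues

variable {n : Type*} [Fintype n] [DecidableEq n]

/-- Spectral mapping without diagonalisation: both sides are multiplicative in p, and for a linear
factor the claim is the factorisation of the characteristic polynomial. -/
lemma det_aeval_eq_prod_roots (A : Matrix n n ℂ) (p : Polynomial ℂ) :
    (Polynomial.aeval A p).det = (A.charpoly.roots.map fun x => p.eval x).prod := by
  have hcard : A.charpoly.roots.card = Fintype.card n := by
    rw [← (IsAlgClosed.splits A.charpoly).natDegree_eq_card_roots, Matrix.charpoly_natDegree_eq_dim]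
  have hlin : ∀ r : ℂ, (Polynomial.aeval A (Polynomial.X - Polynomial.C r)).det =
      (A.charpoly.roots.map fun x => (Polynomial.X - Polynomial.C r).eval x).prod := by
    intro r
    have h1 := Matrix.eval_charpoly A r
    have h2 := (IsAlgClosed.splits A.charpoly).eval_eq_prod_roots_of_monic A.charpoly_monic r
    have h3 : Polynomial.aeval A (Polynomial.X - Polynomial.C r) = -(Matrix.scalar n r - A) := by
      simp [Matrix.algebraMap_eq_diagonal, Pi.algebraMap_def]
    rw [h3, Matrix.det_neg, ← h1, h2, ← hcard, ← Multiset.card_map (fun a => r - a),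
      ← Multiset.prod_map_neg, Multiset.map_map]
    simp
  have hmul : ∀ s : Multiset ℂ,
      (Polynomial.aeval A (s.map fun r => Polynomial.X - Polynomial.C r).prod).det =
      (A.charpoly.roots.map fun x =>
        (s.map fun r => Polynomial.X - Polynomial.C r).prod.eval x).prod := by
    intro s
    induction s using Multiset.induction_on with
    | empty => simp
    | cons r s ih =>
      simp only [Multiset.map_cons, Multiset.prod_cons, map_mul, Matrix.det_mul, ih, hlin,
        Polynomial.eval_mul, Multiset.prod_map_mul]
  rw [(IsAlgClosed.splits p).eq_prod_roots]
  simp only [map_mul, Matrix.det_mul, hmul, Polynomial.eval_mul, Multiset.prod_map_mul]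
  congr 1
  simp [Matrix.algebraMap_eq_diagonal, hcard]

/-- Applying the determinant formula to r - p for all r shows that the eigenvalues of p(A), with
multiplicity, are the p(x). -/
lemma trace_aeval_eq_sum_roots (A : Matrix n n ℂ) (p : Polynomial ℂ) :
    (Polynomial.aeval A p).trace = (A.charpoly.roots.map fun x => p.eval x).sum := by
  have h : (Polynomial.aeval A p).charpoly =
      ((A.charpoly.roots.map fun x => p.eval x).map
        fun r => Polynomial.X - Polynomial.C r).prod := by
    refine Polynomial.funext fun r => ?_
    rw [Matrix.eval_charpoly, Polynomial.eval_multiset_prod, Multiset.map_map, Multiset.map_map]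
    have h1 := det_aeval_eq_prod_roots A (Polynomial.C r - p)
    have h2 : Polynomial.aeval A (Polynomial.C r - p) =
        Matrix.scalar n r - Polynomial.aeval A p := by
      rw [map_sub, Polynomial.aeval_C]
      rfl
    rw [h2] at h1
    rw [h1]
    simp [Function.comp_def]
  rw [Matrix.trace_eq_sum_roots_charpoly, h, Polynomial.roots_multiset_prod_X_sub_C]

/-- The traces of all powers of a unitary matrix are power sums. -/
lemma exists_eigenvalues {N : ℕ} (V : U N) : ∃ x : Fin N → ℂˣ, ∀ l : ℤ,
    tr (V ^ l) = ∑ i, ((x i ^ l : ℂˣ) : ℂ) := by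
  obtain ⟨A, hA⟩ : ∃ A : Matrix (Fin N) (Fin N) ℂ, (V : Matrix (Fin N) (Fin N) ℂ) = A := ⟨_, rfl⟩
  have hcard : A.charpoly.roots.card = N := by
    rw [← (IsAlgClosed.splits A.charpoly).natDegree_eq_card_roots, Matrix.charpoly_natDegree_eq_dim,
      Fintype.card_fin]
  obtain ⟨y, hy⟩ : ∃ y : Fin N → ℂ, Multiset.map y univ.val = A.charpoly.roots := by
    obtain ⟨l, hl⟩ := Quot.exists_rep A.charpoly.roots
    change (l : Multiset ℂ) = _ at hl
    rw [← hl, Multiset.coe_card] at hcard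
    subst hcard
    exact ⟨l.get, by rw [Fin.univ_val_map, List.ofFn_get, hl]⟩
  have hVA : ((V⁻¹ : U N) : Matrix (Fin N) (Fin N) ℂ) * A = 1 := by
    rw [← hA]
    exact congrArg Subtype.val (inv_mul_cancel V)
  have hAV : A * ((V⁻¹ : U N) : Matrix (Fin N) (Fin N) ℂ) = 1 := by
    rw [← hA]
    exact congrArg Subtype.val (mul_inv_cancel V)
  have hdet : A.det ≠ 0 := by
    intro h
    have := congrArg Matrix.det hAV
    rw [Matrix.det_mul, h, zero_mul, Matrix.det_one] at this
    exact zero_ne_one this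
  have hy0 : ∀ i, y i ≠ 0 := by
    have h := Matrix.det_eq_prod_roots_charpoly A
    rw [← hy] at h
    rw [h] at hdet
    exact fun i => (Finset.prod_ne_zero_iff.mp hdet) i (mem_univ i)
  have htr : ∀ p : Polynomial ℂ, (Polynomial.aeval A p).trace = ∑ i, p.eval (y i) := by
    intro p
    rw [trace_aeval_eq_sum_roots, ← hy, Multiset.map_map]
    rfl
  -- Cayley–Hamilton makes V⁻¹ a polynomial in V, so the trace formula for polynomials also covers
  -- negative powers.
  obtain ⟨q, hq, hqy⟩ : ∃ q : Polynomial ℂ, Polynomial.aeval A q = ((V⁻¹ : U N) : Matrix _ _ ℂ) ∧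
      ∀ i, q.eval (y i) = (y i)⁻¹ := by
    have hc : A.charpoly.coeff 0 ≠ 0 := by
      intro h
      apply hdet
      rw [Matrix.det_eq_sign_charpoly_coeff, h, mul_zero]
    have hX := Polynomial.divX_mul_X_add A.charpoly
    refine ⟨Polynomial.C (-(A.charpoly.coeff 0)⁻¹) * A.charpoly.divX, ?_, fun i => ?_⟩
    · have h1 := congrArg (Polynomial.aeval A) hX
      rw [Matrix.aeval_self_charpoly, map_add, map_mul, Polynomial.aeval_X, Polynomial.aeval_C,
        Algebra.algebraMap_eq_smul_one] at h1
      have h2 : Polynomial.aeval A A.charpoly.divX * A = -(A.charpoly.coeff 0 • 1) :=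
        eq_neg_of_add_eq_zero_left h1
      have h3 : Polynomial.aeval A (Polynomial.C (-(A.charpoly.coeff 0)⁻¹) * A.charpoly.divX) * A =
          1 := by
        rw [map_mul, Polynomial.aeval_C, Algebra.algebraMap_eq_smul_one, smul_mul_assoc, one_mul,
          smul_mul_assoc, h2, smul_neg, smul_smul, neg_mul, inv_mul_cancel₀ hc, neg_smul, one_smul,
          neg_neg]
      rw [← mul_one (Polynomial.aeval A _), ← hAV, ← mul_assoc, h3, one_mul]
    · have h0 : A.charpoly.eval (y i) = 0 := by
        have : y i ∈ A.charpoly.roots := by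
          rw [← hy]
          exact Multiset.mem_map_of_mem _ (mem_univ i)
        exact (Polynomial.mem_roots'.mp this).2
      have h1 := congrArg (Polynomial.eval (y i)) hX
      rw [h0, Polynomial.eval_add, Polynomial.eval_mul, Polynomial.eval_X, Polynomial.eval_C] at h1
      rw [Polynomial.eval_mul, Polynomial.eval_C, eq_comm]
      refine inv_eq_of_mul_eq_one_left ?_
      field_simp
      linear_combination -h1
  refine ⟨fun i => Units.mk0 (y i) (hy0 i), fun l => ?_⟩
  rcases l with m | m
  · have h := htr (Polynomial.X ^ m)
    simp only [map_pow, Polynomial.aeval_X, Polynomial.eval_pow, Polynomial.eval_X] at h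
    simpa [tr, hA] using h
  · have h := htr (q ^ (m + 1))
    simp only [map_pow, hq, Polynomial.eval_pow, hqy] at h
    have h2 : (V ^ Int.negSucc m : U N) = V⁻¹ ^ (m + 1) := by
      rw [zpow_negSucc, inv_pow]
    rw [h2]
    simp only [zpow_negSucc]
    simpa [tr] using h

end Eigenvalues

/-! ### The Weyl integration formula -/

section WeylIntegration

variable {N : ℕ}

/-- The value of a Laurent polynomial at nonzero complex numbers. -/
def laurentEval (x : Fin N → ℂˣ) : LaurentN N →ₐ[ℂ] ℂ :=
  AddMonoidAlgebra.lift ℂ ℂ (Fin N → ℤ)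
    { toFun := fun μ => ∏ i : Fin N, ((x i ^ (Multiplicative.toAdd μ : Fin N → ℤ) i : ℂˣ) : ℂ)
      map_one' := by simp
      map_mul' := fun μ ν => by
        simp only [toAdd_mul, Pi.add_apply, zpow_add, Units.val_mul, Finset.prod_mul_distrib] }

lemma laurentEval_xpow (x : Fin N → ℂˣ) (i : Fin N) (l : ℤ) :
    laurentEval x (xpow i l) = ((x i ^ l : ℂˣ) : ℂ) := by
  rw [laurentEval, xpow, AddMonoidAlgebra.lift_single, one_smul]
  change ∏ j, ((x j ^ (Pi.single i l : Fin N → ℤ) j : ℂˣ) : ℂ) = _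
  rw [Finset.prod_eq_single i]
  · rw [Pi.single_eq_same]
  · intro j _ hj
    rw [Pi.single_eq_of_ne hj, zpow_zero, Units.val_one]
  · simp

/-- The trace of a polynomial in the power sums only depends on its value as a symmetric Laurent
polynomial. -/
lemma traceEval_eq (V : U N) {F : MvPolynomial TVar ℂ} {c : ℂ}
    (hF : powerEval N F = algebraMap ℂ _ c) : traceEval V F = c := by
  obtain ⟨x, hx⟩ := exists_eigenvalues V
  have h : traceEval V = (laurentEval x).comp (powerEval N) := by
    refine MvPolynomial.algHom_ext fun v => ?_
    rw [traceEval_X, AlgHom.comp_apply, powerEval_X, map_sum, hx]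
    exact Finset.sum_congr rfl fun i _ => (laurentEval_xpow x i _).symm
  rw [h, AlgHom.comp_apply, hF, AlgHom.commutes]
  rfl

lemma haarIntegral_eq_of_powerEval {F : MvPolynomial TVar ℂ} {c : ℂ}
    (hF : powerEval N F = algebraMap ℂ _ c) : haarIntegral N F = c := by
  change ∫ V, traceEval V F ∂(haarU N) = c
  simp [traceEval_eq _ hF]

/-- Permutation of the coordinates of an exponent. -/
def permuteExponents (σ : Equiv.Perm (Fin N)) : (Fin N → ℤ) ≃+ (Fin N → ℤ) where
  toFun μ := μ ∘ σ.symm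
  invFun μ := μ ∘ σ
  left_inv μ := by ext; simp
  right_inv μ := by ext; simp
  map_add' μ ν := rfl

/-- Permutation of the variables of a Laurent polynomial. -/
def permuteVars (σ : Equiv.Perm (Fin N)) : LaurentN N ≃ₐ[ℂ] LaurentN N :=
  AddMonoidAlgebra.domCongr ℂ ℂ (permuteExponents σ)

lemma coeff_permuteVars (σ : Equiv.Perm (Fin N)) (f : LaurentN N) (μ : Fin N → ℤ) :
    (permuteVars σ f).coeff μ = f.coeff (μ ∘ σ) :=
  AddMonoidAlgebra.coeff_domCongr _ _ _

lemma permuteVars_xpow (σ : Equiv.Perm (Fin N)) (i : Fin N) (l : ℤ) :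
    permuteVars σ (xpow i l) = xpow (σ i) l := by
  rw [permuteVars, xpow, AddMonoidAlgebra.domCongr_single, xpow]
  congr 1
  funext j
  change (Pi.single i l : Fin N → ℤ) (σ.symm j) = _
  simp only [Pi.single_apply, Equiv.symm_apply_eq]

lemma permuteVars_powerEval (σ : Equiv.Perm (Fin N)) (F : MvPolynomial TVar ℂ) :
    permuteVars σ (powerEval N F) = powerEval N F := by
  have h : (permuteVars σ).toAlgHom.comp (powerEval N) = powerEval N := by
    refine MvPolynomial.algHom_ext fun v => ?_
    rw [AlgHom.comp_apply, powerEval_X, map_sum]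
    exact (Finset.sum_congr rfl fun i _ => permuteVars_xpow σ i _).trans
      (Equiv.sum_comp σ fun i => xpow i (charge v))
  exact DFunLike.congr_fun h F

lemma permuteVars_vdm (σ : Equiv.Perm (Fin N)) :
    permuteVars σ (vdm N) = ((Equiv.Perm.sign σ : ℤ) : ℂ) • vdm N := by
  have h : (permuteVars σ).toAlgHom.toRingHom.mapMatrix
        (Matrix.vandermonde fun i : Fin N => xpow i 1) =
      (Matrix.vandermonde fun i : Fin N => xpow i 1).submatrix σ id := by
    ext1 i j
    change permuteVars σ (xpow i 1 ^ (j : ℕ)) = xpow (σ i) 1 ^ (j : ℕ)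
    rw [map_pow, permuteVars_xpow]
  have h2 := RingHom.map_det (permuteVars σ).toAlgHom.toRingHom
    (Matrix.vandermonde fun i : Fin N => xpow i 1)
  rw [h, Matrix.det_permute] at h2
  refine h2.trans ?_
  rw [Int.cast_smul_eq_zsmul, zsmul_eq_mul]
  rfl

/-- Antisymmetry of the coefficients. -/
def Antisymmetric (g : LaurentN N) : Prop :=
  ∀ (σ : Equiv.Perm (Fin N)) (μ : Fin N → ℤ),
    g.coeff (μ ∘ σ) = ((Equiv.Perm.sign σ : ℤ) : ℂ) * g.coeff μ

lemma antisymmetric_powerEval_mul_vdm (F : MvPolynomial TVar ℂ) :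
    Antisymmetric (powerEval N F * vdm N) := by
  intro σ μ
  rw [← coeff_permuteVars, map_mul, permuteVars_powerEval, permuteVars_vdm, mul_smul_comm,
    AddMonoidAlgebra.coeff_smul_apply, smul_eq_mul]

lemma Antisymmetric.coeff_eq_zero {g : LaurentN N} (hg : Antisymmetric g) {μ : Fin N → ℤ}
    (hμ : ¬ Function.Injective μ) : g.coeff μ = 0 := by
  obtain ⟨i, j, hij, hne⟩ : ∃ i j, μ i = μ j ∧ i ≠ j := by
    simpa [Function.Injective] using hμ
  have h := hg (Equiv.swap i j) μ
  have h2 : μ ∘ Equiv.swap i j = μ := by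
    funext k
    rw [Function.comp_apply]
    by_cases hk : k = i
    · rw [hk, Equiv.swap_apply_left, hij]
    · by_cases hk' : k = j
      · rw [hk', Equiv.swap_apply_right, hij]
      · rw [Equiv.swap_apply_of_ne_of_ne hk hk']
  rw [h2, Equiv.Perm.sign_swap hne] at h
  push_cast at h
  linear_combination (2⁻¹ : ℂ) * h

/-- The only injective exponents in the kernel of the Casimir operator are the permutations
of `ρ`. -/
lemma exists_perm_of_casimirValue_eq_zero {μ : Fin N → ℤ} (hμ : Function.Injective μ)
    (h : casimirValue μ = 0) : ∃ σ : Equiv.Perm (Fin N), μ = rho N ∘ σ := by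
  set c : ℤ → ℤ := fun x => x * (x - (N - 1)) with hc
  set S : Finset ℤ := univ.image μ with hS
  set T : Finset ℤ := univ.image (rho N) with hT
  have hρ : Function.Injective (rho N) := fun i j hij => Fin.ext (by simpa [rho] using hij)
  have hmemT : ∀ x, x ∈ T ↔ 0 ≤ x ∧ x < N := by
    intro x
    constructor
    · intro hx
      obtain ⟨i, -, rfl⟩ := Finset.mem_image.mp hx
      simp [rho]
    · rintro ⟨h0, h1⟩
      refine Finset.mem_image.mpr ⟨⟨x.toNat, by omega⟩, mem_univ _, ?_⟩
      simp [rho, h0]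
  have hsum : ∑ x ∈ S, c x = ∑ x ∈ T, c x := by
    rw [hS, hT, Finset.sum_image fun i _ j _ hij => hμ hij,
      Finset.sum_image fun i _ j _ hij => hρ hij]
    exact sub_eq_zero.mp h
  have hcard : #S = #T := by
    rw [hS, hT, Finset.card_image_of_injective _ hμ, Finset.card_image_of_injective _ hρ]
  have h1 : ∑ x ∈ S \ T, c x = ∑ x ∈ T \ S, c x := by
    have h2 := Finset.sum_inter_add_sum_sdiff S T c
    have h3 := Finset.sum_inter_add_sum_sdiff T S c
    rw [Finset.inter_comm] at h3
    linarith
  -- The function x(x - (N - 1)) is positive on integers outside {0, …, N-1} and nonpositive inside,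
  -- so N distinct integers with the same sum of c as 0, …, N-1 cannot leave that set.
  have hpos : ∀ x ∈ S \ T, 0 < c x := by
    intro x hx
    have hx' := (Finset.mem_sdiff.mp hx).2
    rw [hmemT] at hx'
    have hN : 0 < N := by
      obtain ⟨i, -⟩ := Finset.mem_image.mp (Finset.mem_sdiff.mp hx).1
      exact i.pos
    by_cases h0 : 0 ≤ x
    · have : (N : ℤ) ≤ x := by
        by_contra hlt
        exact hx' ⟨h0, by omega⟩
      refine mul_pos ?_ (by omega)
      omega
    · exact mul_pos_of_neg_of_neg (by omega) (by omega)
  have hneg : ∀ x ∈ T \ S, c x ≤ 0 := by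
    intro x hx
    have hx' := (hmemT x).mp (Finset.mem_sdiff.mp hx).1
    exact mul_nonpos_of_nonneg_of_nonpos hx'.1 (by omega)
  have hempty : S \ T = ∅ := by
    by_contra hne
    have h2 := Finset.sum_pos hpos (Finset.nonempty_iff_ne_empty.mpr hne)
    have h3 := Finset.sum_nonpos hneg
    omega
  have hmem : ∀ i, 0 ≤ μ i ∧ μ i < N := fun i =>
    (hmemT _).mp (Finset.sdiff_eq_empty_iff_subset.mp hempty
      (Finset.mem_image_of_mem μ (mem_univ i)))
  set τ : Fin N → Fin N := fun i => ⟨(μ i).toNat, by have := hmem i; omega⟩ with hτ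
  have hτi : Function.Injective τ := by
    intro i j hij
    apply hμ
    have h2 : (μ i).toNat = (μ j).toNat := congrArg Fin.val hij
    have := hmem i
    have := hmem j
    omega
  refine ⟨Equiv.ofBijective τ (Finite.injective_iff_bijective.mp hτi), ?_⟩
  funext i
  simp [rho, hτ, (hmem i).1]

lemma coeff_vdm_rho : (vdm N).coeff (rho N) = 1 := by
  rw [vdm_eq_sum, AddMonoidAlgebra.coeff_sum, Finsupp.finsetSum_apply, Finset.sum_eq_single 1]
  · simp
  · intro σ _ hσ
    rw [AddMonoidAlgebra.coeff_single, Finsupp.single_eq_of_ne]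
    intro h
    apply hσ
    ext i
    have := congrFun h i
    simpa [rho] using this.symm
  · simp

lemma vdm_ne_zero : vdm N ≠ 0 := by
  intro h
  have := coeff_vdm_rho (N := N)
  rw [h] at this
  simp at this

lemma antisymmetric_vdm : Antisymmetric (vdm N) := by
  have h := antisymmetric_powerEval_mul_vdm (N := N) 1
  rwa [map_one, one_mul] at h

/-- The kernel of the Casimir operator on antisymmetric Laurent polynomials is spanned by the
Vandermonde determinant. -/
lemma Antisymmetric.eq_smul_vdm {g : LaurentN N} (hg : Antisymmetric g)
    (hc : ∀ μ, g.coeff μ ≠ 0 → casimirValue μ = 0) : g = g.coeff (rho N) • vdm N := by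
  apply AddMonoidAlgebra.coeff_injective
  ext μ
  rw [AddMonoidAlgebra.coeff_smul_apply, smul_eq_mul]
  by_cases hμ : ∃ σ : Equiv.Perm (Fin N), μ = rho N ∘ σ
  · obtain ⟨σ, rfl⟩ := hμ
    rw [hg, antisymmetric_vdm, coeff_vdm_rho]
    ring
  · have hv : ∀ f : LaurentN N, Antisymmetric f → (casimirValue μ ≠ 0 → f.coeff μ = 0) →
        f.coeff μ = 0 := by
      intro f hf h0
      by_cases hi : Function.Injective μ
      · exact h0 fun h => hμ (exists_perm_of_casimirValue_eq_zero hi h)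
      · exact hf.coeff_eq_zero hi
    rw [hv g hg fun h => by_contra fun h' => h (hc μ h'), hv (vdm N) antisymmetric_vdm, mul_zero]
    intro h
    have := congrArg (fun f : LaurentN N => f.coeff μ) (casimir_vdm (N := N))
    rw [casimir] at this
    simp only [coeff_diagonal] at this
    exact (mul_eq_zero.mp this).resolve_left (by exact_mod_cast h)

/-- The Weyl integration formula for polynomials in the power sums. -/
theorem haarIntegral_eq_coeff (F : MvPolynomial TVar ℂ) :
    haarIntegral N F = (powerEval N F * vdm N).coeff (rho N) := by
  classical
  obtain ⟨T, hT⟩ : ∃ T : Finset ℤ, 0 ∉ T ∧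
      ∀ μ, (powerEval N F * vdm N).coeff μ ≠ 0 → casimirValue μ ∈ insert 0 T := by
    refine ⟨((powerEval N F * vdm N).coeff.support.image casimirValue).erase 0,
      Finset.notMem_erase _ _, fun μ hμ => ?_⟩
    by_cases h0 : casimirValue μ = 0
    · rw [h0]
      exact Finset.mem_insert_self _ _
    · exact Finset.mem_insert_of_mem (Finset.mem_erase.mpr ⟨h0,
        Finset.mem_image_of_mem _ (Finsupp.mem_support_iff.mpr hμ)⟩)
  -- T lists the nonzero Casimir eigenvalues allowed in F Δ. Subtracting e⁻¹ times the loop operator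
  -- removes the eigenvalue e; it changes neither the integral, by the loop equations, nor the
  -- coefficient at ρ, where the eigenvalue is 0.
  induction T using Finset.induction_on generalizing F with
  | empty =>
    -- With only eigenvalue 0 left, F Δ is a multiple of Δ, so F evaluates to a constant, which
    -- total mass 1 reproduces.
    have h := (antisymmetric_powerEval_mul_vdm F).eq_smul_vdm fun μ hμ => by
      simpa using hT.2 μ hμ
    rw [← smul_one_mul, ← Algebra.algebraMap_eq_smul_one] at h
    exact haarIntegral_eq_of_powerEval (mul_right_cancel₀ vdm_ne_zero h)
  | insert e T he ih =>
    obtain ⟨s, hs⟩ := exists_loopOperator (N := N) F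
    have he0 : (e : ℂ) ≠ 0 := by
      intro h
      apply hT.1
      rw [Int.cast_eq_zero.mp h]
      exact Finset.mem_insert_self _ _
    have hcoeff : ∀ μ, (powerEval N (F - (e : ℂ)⁻¹ • loopOperator N s F) * vdm N).coeff μ =
        (1 - (e : ℂ)⁻¹ * casimirValue μ) * (powerEval N F * vdm N).coeff μ := by
      intro μ
      rw [map_sub, map_smul, sub_mul, smul_mul_assoc, hs, AddMonoidAlgebra.coeff_sub,
        Finsupp.sub_apply, AddMonoidAlgebra.coeff_smul_apply, casimir, coeff_diagonal, smul_eq_mul]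
      ring
    have h := ih (F - (e : ℂ)⁻¹ • loopOperator N s F)
      ⟨fun h => hT.1 (Finset.mem_insert_of_mem h), fun μ hμ => ?_⟩
    · rw [hcoeff, casimirValue_rho, map_sub, map_smul, haarIntegral_loopOperator] at h
      simpa using h
    · rw [hcoeff] at hμ
      have h2 := hT.2 μ (right_ne_zero_of_mul hμ)
      have h3 : casimirValue μ ≠ e := by
        intro h3
        apply left_ne_zero_of_mul hμ
        rw [h3, inv_mul_cancel₀ he0, sub_self]
      simp only [Finset.mem_insert] at h2 ⊢
      tauto

end WeylIntegration

/-! ### The generating function as a Toeplitz determinant -/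

section Toeplitz

variable {N : ℕ}

lemma coeff_expLinear_smul {σ A : Type*} [CommRing A] [Algebra ℂ A] (γ : σ → ℂ) (c : σ → A)
    (d : σ →₀ ℕ) : MvPowerSeries.coeff d (expLinear fun v => γ v • c v) =
      MvPowerSeries.coeff d (expLinear γ) • d.prod fun v n => c v ^ n := by
  rw [coeff_expLinear, coeff_expLinear, Finsupp.prod, Finsupp.prod, Finsupp.prod,
    ← Finset.prod_smul]
  exact Finset.prod_congr rfl fun v _ => by rw [smul_pow, smul_smul, smul_eq_mul]

/-- The average over `U(N)` of `exp (-∑_k (1/k) (t⁺_k Tr V^k + t⁻_k Tr V^{-k}))`. -/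
def haarSeries (N : ℕ) : MvPowerSeries TVar ℂ := fun d =>
  MvPowerSeries.coeff d (vertex (-1) (-1)) * haarIntegral N (MvPolynomial.monomial d 1)

lemma coeff_haarSeries (d : TVar →₀ ℕ) : MvPowerSeries.coeff d (haarSeries N) =
    MvPowerSeries.coeff d (vertex (-1) (-1)) * haarIntegral N (MvPolynomial.monomial d 1) := rfl

lemma prod_single_coordinates (a : Fin N → ℤ) (c : Fin N → ℂ) :
    ∏ i, (AddMonoidAlgebra.single (a i • (Pi.single i 1 : Fin N → ℤ)) (c i) : LaurentN N) =
      AddMonoidAlgebra.single a (∏ i, c i) := by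
  rw [AddMonoidAlgebra.prod_single]
  congr 1
  funext j
  simp [Finset.sum_apply, Pi.single_apply]

lemma coeff_prod_expLinear (γ : TVar → ℂ) (d : TVar →₀ ℕ) (μ : Fin N → ℤ) :
    (MvPowerSeries.coeff d (∏ i : Fin N, expLinear fun v =>
      AddMonoidAlgebra.single (charge v • (Pi.single i 1 : Fin N → ℤ)) (γ v))).coeff μ =
      MvPowerSeries.coeff d (∏ i : Fin N, cut {μ i} (expLinear γ)) := by
  classical
  rw [MvPowerSeries.coeff_prod, MvPowerSeries.coeff_prod, AddMonoidAlgebra.coeff_sum,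
    Finsupp.finsetSum_apply]
  refine Finset.sum_congr rfl fun l _ => ?_
  simp only [coeff_expLinear_single, prod_single_coordinates, AddMonoidAlgebra.coeff_single]
  simp only [coeff_cut, Set.mem_singleton_iff]
  by_cases h : (fun i => totalCharge (l i)) = μ
  · subst h
    simp
  · rw [Finsupp.single_eq_of_ne (Ne.symm h)]
    obtain ⟨i, hi⟩ : ∃ i, totalCharge (l i) ≠ μ i := by
      by_contra hne
      push Not at hne
      exact h (funext hne)
    rw [Finset.prod_eq_zero (mem_univ i)]
    rw [if_neg hi]

/-- The integrand is a product of one exponential per eigenvalue. Extracting x^ρ after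
multiplication by Δ = ∑ sgn(σ) x^{ρ∘σ} selects charge i - σ(i) from the i-th factor, which is the
Leibniz expansion of the determinant. -/
theorem haarSeries_eq_det_toeplitz (N : ℕ) :
    haarSeries N = (toeplitz N (vertex (-1) (-1))).det := by
  ext d
  set γ : TVar → ℂ := Sum.elim (fun k : ℕ+ => (-1) * (k : ℂ)⁻¹) fun k : ℕ+ => (-1) * (k : ℂ)⁻¹
    with hγ
  have h1 : MvPowerSeries.coeff d (expLinear γ) • powerEval N (MvPolynomial.monomial d 1) =
      MvPowerSeries.coeff d (∏ i : Fin N, expLinear fun v =>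
        AddMonoidAlgebra.single (charge v • (Pi.single i 1 : Fin N → ℤ)) (γ v)) := by
    rw [← expLinear_sum, powerEval, MvPolynomial.aeval_monomial, map_one, one_mul,
      ← coeff_expLinear_smul]
    congr 2
    funext v
    rw [Finset.sum_apply, Finset.smul_sum]
    refine Finset.sum_congr rfl fun i _ => ?_
    rw [xpow, AddMonoidAlgebra.smul_single', mul_one, ← Pi.single_smul, smul_eq_mul, mul_one]
  rw [coeff_haarSeries, haarIntegral_eq_coeff, ← smul_eq_mul,
    ← AddMonoidAlgebra.coeff_smul_apply, ← smul_mul_assoc, vertex, ← hγ, h1, coeff_mul_vdm,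
    ← Matrix.det_transpose, Matrix.det_apply', map_sum]
  refine Finset.sum_congr rfl fun σ _ => ?_
  rw [coeff_prod_expLinear, ← MvPowerSeries.coeff_C_mul]
  congr 2
  simp

end Toeplitz

/-! ### The limit of large N and the Wick rule -/

section LargeRank

lemma powerVar_eq (N : ℕ) (l : ℤ) :
    powerVar N l = (if l = 0 then MvPolynomial.C (N : ℂ) else 0) + powerVar 0 l := by
  rcases l with (_ | n) | n
  · simp [powerVar]
  · rw [if_neg (by simp; omega), zero_add]
    rfl
  · rw [if_neg (by simp), zero_add]
    rfl

/-- N enters only through p_0, that is, through the term a = 0. Together with `shiftDer_natCast`,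
where only p_{-k} is sent to a multiple of p_0, this makes the loop equation affine in N. -/
lemma splitSum_natCast (N : ℕ) (k : ℕ+) : splitSum N (k : ℕ) =
    (N : ℂ) • MvPolynomial.X (Sum.inl k) + splitSum 0 (k : ℕ) := by
  obtain ⟨n, hn⟩ : ∃ n : ℕ, (k : ℕ) = n + 1 := ⟨k.natPred, by simp⟩
  change ∑ a ∈ range k, powerVar N a * powerVar N ((k : ℕ) - a) =
    _ + ∑ a ∈ range k, powerVar 0 a * powerVar 0 ((k : ℕ) - a)
  have hk : powerVar N ((k : ℕ) - (0 : ℕ) : ℤ) = MvPolynomial.X (Sum.inl k) := by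
    rw [← powerVar_charge N]
    congr 1
  have h : ∀ a ∈ range n, powerVar N ((a + 1 : ℕ) : ℤ) * powerVar N ((k : ℕ) - (a + 1 : ℕ)) =
      powerVar 0 ((a + 1 : ℕ) : ℤ) * powerVar 0 ((k : ℕ) - (a + 1 : ℕ)) := by
    intro a ha
    rw [Finset.mem_range] at ha
    rw [powerVar_eq N, powerVar_eq N ((k : ℕ) - (a + 1 : ℕ)), if_neg (by omega),
      if_neg (by omega), zero_add, zero_add]
  rw [hn] at hk h ⊢
  rw [Finset.sum_range_succ', Finset.sum_range_succ', Finset.sum_congr rfl h, hk, Nat.cast_zero,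
    powerVar_zero, powerVar_zero, MvPolynomial.smul_eq_C_mul]
  simp
  ring

lemma shiftDer_natCast (N : ℕ) (k : ℕ+) (F : MvPolynomial TVar ℂ) : shiftDer N (k : ℕ) F =
    shiftDer 0 (k : ℕ) F - (N : ℂ) • ((k : ℂ) • MvPolynomial.pderiv (Sum.inr k) F) := by
  have h : shiftDer N (k : ℕ) = shiftDer 0 (k : ℕ) -
      (N : ℂ) • ((k : ℂ) • MvPolynomial.pderiv (Sum.inr k)) := by
    refine MvPolynomial.derivation_ext fun v => ?_
    rw [Derivation.sub_apply, Derivation.smul_apply, Derivation.smul_apply, shiftDer, shiftDer,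
      MvPolynomial.mkDerivation_X, MvPolynomial.mkDerivation_X, powerVar_eq N, smul_add,
      add_comm, sub_eq_add_neg]
    congr 1
    rw [MvPolynomial.pderiv_X, Pi.single_apply]
    rcases v with j | j
    · have : ¬ ((k : ℕ) : ℤ) + charge (Sum.inl j) = 0 := by
        have := j.pos
        simp only [charge, Sum.elim_inl]
        omega
      simp [this]
    · by_cases hj : j = k
      · subst hj
        simp [charge, MvPolynomial.smul_eq_C_mul, mul_comm]
      · have : ¬ ((k : ℕ) : ℤ) + charge (Sum.inr j) = 0 := by
          intro h0
          apply hj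
          simp only [charge, Sum.elim_inr] at h0
          exact PNat.coe_injective (by omega)
        rw [if_neg this, if_neg (by simpa using hj)]
        simp
  rw [h]
  rfl

lemma fredholmTerm_empty : fredholmTerm ∅ = 1 := by
  simp [fredholmTerm]

lemma constantCoeff_fredholm (N : ℕ) : MvPowerSeries.constantCoeff (fredholm N) = 1 := by
  rw [← MvPowerSeries.coeff_zero_eq_constantCoeff_apply]
  change ∑ s ∈ (Ico N (plusWeight 0)).powerset, MvPowerSeries.coeff 0 (fredholmTerm s) = 1
  simp [fredholmTerm_empty]

lemma fredholm_sub_one_mem (N : ℕ) : fredholm N - 1 ∈ lowIdeal N := by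
  intro d hd
  rw [map_sub, coeff_fredholm N d N hd]
  simp [fredholmTerm_empty]

/-- The limit of `haarSeries N` for large `N`. -/
def stableSeries : MvPowerSeries TVar ℂ := (fredholm 0)⁻¹

lemma stableSeries_mul_fredholm_zero : stableSeries * fredholm 0 = 1 := by
  refine MvPowerSeries.inv_mul_cancel _ ?_
  rw [constantCoeff_fredholm]
  exact one_ne_zero

lemma haarSeries_eq_mul (N : ℕ) : haarSeries N = stableSeries * fredholm N := by
  rw [← fredholm_zero_mul_det_toeplitz, ← mul_assoc, stableSeries_mul_fredholm_zero, one_mul,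
    haarSeries_eq_det_toeplitz]

lemma coeff_haarSeries_of_le {N : ℕ} {d : TVar →₀ ℕ} (hd : plusWeight d ≤ N) :
    MvPowerSeries.coeff d (haarSeries N) = MvPowerSeries.coeff d stableSeries := by
  rw [← sub_eq_zero, ← map_sub, haarSeries_eq_mul]
  have h := Ideal.mul_mem_left _ stableSeries (fredholm_sub_one_mem N)
  rw [mul_sub, mul_one] at h
  exact h d hd

/-- At t⁺-weight zero no level contributes, so the Fredholm determinant is 1 there. This supplies
the initial values for the Wick recursion. -/
lemma coeff_stableSeries {d : TVar →₀ ℕ} (hd : plusWeight d = 0) :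
    MvPowerSeries.coeff d stableSeries = MvPowerSeries.coeff d (1 : MvPowerSeries TVar ℂ) := by
  have h := Ideal.mul_mem_left _ stableSeries (fredholm_sub_one_mem 0)
  rw [mul_sub, mul_one, stableSeries_mul_fredholm_zero] at h
  have h2 := h d hd.le
  rw [map_sub, sub_eq_zero] at h2
  exact h2.symm

lemma coeff_vertex_ne_zero (d : TVar →₀ ℕ) : MvPowerSeries.coeff d (vertex (-1) (-1)) ≠ 0 := by
  rw [vertex, coeff_expLinear]
  refine Finset.prod_ne_zero_iff.mpr fun v _ => ?_
  rcases v with k | k <;>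
    simp [smul_eq_mul, Nat.factorial_ne_zero]

/-- The limit of the integrals over `U(N)` for large `N`. -/
def stableIntegral : MvPolynomial TVar ℂ →ₗ[ℂ] ℂ :=
  (MvPolynomial.basisMonomials TVar ℂ).constr ℂ fun d =>
    (MvPowerSeries.coeff d (vertex (-1) (-1)))⁻¹ * MvPowerSeries.coeff d stableSeries

lemma coeff_stableSeries_eq (d : TVar →₀ ℕ) : MvPowerSeries.coeff d stableSeries =
    MvPowerSeries.coeff d (vertex (-1) (-1)) *
      stableIntegral (MvPolynomial.monomial d 1) := by
  have h := (MvPolynomial.basisMonomials TVar ℂ).constr_basis ℂ (fun d =>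
    (MvPowerSeries.coeff d (vertex (-1) (-1)))⁻¹ * MvPowerSeries.coeff d stableSeries) d
  rw [MvPolynomial.coe_basisMonomials] at h
  rw [stableIntegral, h, mul_inv_cancel_left₀ (coeff_vertex_ne_zero d)]

/-- The integrals stabilise exactly: that of a monomial is constant once N reaches its t⁺-weight. -/
lemma eventually_haarIntegral (F : MvPolynomial TVar ℂ) :
    ∀ᶠ N in Filter.atTop, haarIntegral N F = stableIntegral F := by
  induction F using MvPolynomial.induction_on' with
  | monomial d a =>
    filter_upwards [Filter.eventually_ge_atTop (plusWeight d)] with N hN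
    have h1 : MvPolynomial.monomial d a = a • MvPolynomial.monomial d (1 : ℂ) := by
      rw [MvPolynomial.smul_monomial, smul_eq_mul, mul_one]
    have h2 := coeff_haarSeries_of_le hN
    rw [coeff_haarSeries, coeff_stableSeries_eq] at h2
    rw [h1, map_smul, map_smul, mul_left_cancel₀ (coeff_vertex_ne_zero d) h2]
  | add F G hF hG =>
    filter_upwards [hF, hG] with N h1 h2
    rw [map_add, map_add, h1, h2]

/-- For large N the loop equation reads N⟨A⟩ + ⟨B⟩ = 0 with A and B independent of N. Two
consecutive values of N force ⟨A⟩ = 0, the Wick rule for a complex Gaussian of variance k. -/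
lemma stableIntegral_mul (k : ℕ+) (G : MvPolynomial TVar ℂ) :
    stableIntegral (MvPolynomial.X (Sum.inl k) * G) =
      (k : ℂ) * stableIntegral (MvPolynomial.pderiv (Sum.inr k) G) := by
  set A := MvPolynomial.X (Sum.inl k) * G - (k : ℂ) • MvPolynomial.pderiv (Sum.inr k) G with hA
  set B := splitSum 0 (k : ℕ) * G + shiftDer 0 (k : ℕ) G with hB
  have h : ∀ᶠ N : ℕ in Filter.atTop, (N : ℂ) * stableIntegral A + stableIntegral B = 0 := by
    filter_upwards [eventually_haarIntegral A, eventually_haarIntegral B] with N h1 h2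
    rw [← h1, ← h2, ← smul_eq_mul, ← map_smul, ← map_add, ← loop_equation N (k : ℕ) G]
    congr 1
    rw [splitSum_natCast, shiftDer_natCast, hA, hB, smul_sub, add_mul, smul_mul_assoc]
    ring
  obtain ⟨N₀, hN⟩ := Filter.eventually_atTop.mp h
  have h1 := hN N₀ le_rfl
  have h2 := hN (N₀ + 1) (Nat.le_succ _)
  push_cast at h2
  have h3 : stableIntegral A = 0 := by linear_combination h2 - h1
  rw [hA, map_sub, map_smul, smul_eq_mul, sub_eq_zero] at h3
  exact h3

end LargeRank

/-! ### The strong Szegő limit -/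

section Stable

lemma stableSeries_pair (k : ℕ+) (d : TVar →₀ ℕ) :
    ((d (Sum.inl k) : ℂ) + 1) * MvPowerSeries.coeff
      (d + Finsupp.single (Sum.inr k) 1 + Finsupp.single (Sum.inl k) 1) stableSeries =
      (k : ℂ)⁻¹ * MvPowerSeries.coeff d stableSeries := by
  have h1 := expLinear_succ (Sum.elim (fun k : ℕ+ => (-1) * (k : ℂ)⁻¹)
    fun k : ℕ+ => (-1) * (k : ℂ)⁻¹) (d + Finsupp.single (Sum.inr k) 1) (Sum.inl k)
  have h2 := expLinear_succ (Sum.elim (fun k : ℕ+ => (-1) * (k : ℂ)⁻¹)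
    fun k : ℕ+ => (-1) * (k : ℂ)⁻¹) d (Sum.inr k)
  rw [← vertex] at h1 h2
  have h3 := stableIntegral_mul k (MvPolynomial.monomial (d + Finsupp.single (Sum.inr k) 1) 1)
  rw [MvPolynomial.X, MvPolynomial.monomial_mul, MvPolynomial.pderiv_monomial, one_mul, one_mul,
    add_comm (Finsupp.single _ _), add_tsub_cancel_right] at h3
  have h4 : MvPolynomial.monomial d
        (((d + Finsupp.single (Sum.inr k) 1 : TVar →₀ ℕ) (Sum.inr k) : ℕ) : ℂ) =
      ((d (Sum.inr k) : ℂ) + 1) • MvPolynomial.monomial d (1 : ℂ) := by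
    rw [MvPolynomial.smul_monomial, smul_eq_mul, mul_one]
    simp
  rw [h4, map_smul, smul_eq_mul] at h3
  have hd : (d + Finsupp.single (Sum.inr k) 1 : TVar →₀ ℕ) (Sum.inl k) = d (Sum.inl k) := by simp
  rw [hd] at h1
  rw [coeff_stableSeries_eq, coeff_stableSeries_eq, h3, ← mul_assoc, h1]
  simp only [Sum.elim_inl, Sum.elim_inr] at h2 ⊢
  have hk : (k : ℂ) ≠ 0 := by exact_mod_cast k.ne_zero
  field_simp at h2 ⊢
  linear_combination (-stableIntegral (MvPolynomial.monomial d 1)) * h2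

/-- Without a factor p_{-k} there is nothing for p_k to contract with. -/
lemma stableSeries_unpaired (k : ℕ+) (d : TVar →₀ ℕ) (hd : d (Sum.inr k) = 0) :
    MvPowerSeries.coeff (d + Finsupp.single (Sum.inl k) 1) stableSeries = 0 := by
  have h3 := stableIntegral_mul k (MvPolynomial.monomial d 1)
  rw [MvPolynomial.X, MvPolynomial.monomial_mul, MvPolynomial.pderiv_monomial, one_mul, one_mul,
    add_comm (Finsupp.single _ _), hd] at h3
  rw [coeff_stableSeries_eq, h3]
  simp

lemma hasSubst_pairs : MvPowerSeries.HasSubst fun k : ℕ+ =>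
    (MvPowerSeries.X (Sum.inl k) * MvPowerSeries.X (Sum.inr k) : MvPowerSeries TVar ℂ) where
  const_coeff k := by simp
  coeff_zero d := by
    classical
    refine Set.Subsingleton.finite fun k hk l hl => ?_
    simp only [Set.mem_ofPred_eq, MvPowerSeries.X, MvPowerSeries.monomial_mul_monomial,
      MvPowerSeries.coeff_monomial, ne_eq, ite_eq_right_iff, not_forall] at hk hl
    have h := DFunLike.congr_fun (hk.1.symm.trans hl.1) (Sum.inl k)
    simp [Finsupp.single_apply] at h
    exact h.symm

lemma exists_sumElim (d : TVar →₀ ℕ) : ∃ a b : ℕ+ →₀ ℕ, d = Finsupp.sumElim a b := by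
  refine ⟨d.comapDomain Sum.inl Sum.inl_injective.injOn,
    d.comapDomain Sum.inr Sum.inr_injective.injOn, ?_⟩
  ext v
  rcases v with j | j <;> simp

lemma sumElim_inj {a b a' b' : ℕ+ →₀ ℕ} (h : Finsupp.sumElim a b = Finsupp.sumElim a' b') :
    a = a' ∧ b = b' := by
  constructor <;> ext k
  · simpa using DFunLike.congr_fun h (Sum.inl k)
  · simpa using DFunLike.congr_fun h (Sum.inr k)

lemma prod_pairs (e : ℕ+ →₀ ℕ) :
    (e.prod fun k n => (MvPowerSeries.X (Sum.inl k) * MvPowerSeries.X (Sum.inr k) :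
      MvPowerSeries TVar ℂ) ^ n) = MvPowerSeries.monomial (Finsupp.sumElim e e) 1 := by
  induction e using Finsupp.induction_linear with
  | zero =>
    rw [Finsupp.prod_zero_index, Finsupp.sumElim_zero_zero]
    rfl
  | add e e' he he' =>
    rw [Finsupp.prod_add_index' (fun _ => pow_zero _) (fun _ _ _ => pow_add _ _ _), he, he',
      MvPowerSeries.monomial_mul_monomial, one_mul, Finsupp.sumElim_add]
  | single k n =>
    rw [Finsupp.prod_single_index (h := fun k n => (MvPowerSeries.X (Sum.inl k) *
      MvPowerSeries.X (Sum.inr k) : MvPowerSeries TVar ℂ) ^ n) (pow_zero _), mul_pow,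
      MvPowerSeries.X_pow_eq, MvPowerSeries.X_pow_eq, MvPowerSeries.monomial_mul_monomial, one_mul,
      ← Finsupp.sumElim_single_zero,
      ← Finsupp.sumElim_zero_single, ← Finsupp.sumElim_add, add_zero, zero_add]

lemma coeff_ZtildeInfty (a b : ℕ+ →₀ ℕ) :
    MvPowerSeries.coeff (Finsupp.sumElim a b) ZtildeInfty =
      if a = b then MvPowerSeries.coeff a (expLinear fun k : ℕ+ => (k : ℂ)⁻¹) else 0 := by
  classical
  rw [ZtildeInfty, expSeries_formalSum hasSubst_pairs, MvPowerSeries.coeff_subst hasSubst_pairs,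
    finsum_eq_single _ a]
  · rw [prod_pairs, MvPowerSeries.coeff_monomial]
    by_cases h : a = b
    · subst h
      simp
    · rw [if_neg h, if_neg fun h' => h (sumElim_inj h').2.symm, smul_zero]
  · intro e he
    rw [prod_pairs, MvPowerSeries.coeff_monomial, if_neg fun h => he (sumElim_inj h).1.symm,
      smul_zero]

/-- Every t⁺_k is either contracted with a t⁻_k, lowering the degree by two, or makes the
coefficient vanish; monomials without t⁺ are known from `coeff_stableSeries`. Loop equations with k
> 0 therefore suffice. -/
theorem stableSeries_eq : stableSeries = ZtildeInfty := by
  ext d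
  induction hn : d.degree using Nat.strong_induction_on generalizing d with
  | _ n ih =>
    by_cases hplus : ∃ k : ℕ+, d (Sum.inl k) ≠ 0
    · obtain ⟨k, hk⟩ := hplus
      obtain ⟨d, rfl⟩ : ∃ d', d = d' + Finsupp.single (Sum.inl k) 1 :=
        ⟨d - Finsupp.single (Sum.inl k) 1, by
          rw [tsub_add_cancel_of_le]
          simpa [Nat.one_le_iff_ne_zero] using hk⟩
      by_cases hk' : d (Sum.inr k) = 0
      · rw [stableSeries_unpaired k d hk']
        obtain ⟨a, b, rfl⟩ := exists_sumElim d
        rw [← Finsupp.sumElim_single_zero, ← Finsupp.sumElim_add, add_zero, coeff_ZtildeInfty,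
          if_neg]
        rintro rfl
        simp at hk'
      · obtain ⟨d, rfl⟩ : ∃ d', d = d' + Finsupp.single (Sum.inr k) 1 :=
          ⟨d - Finsupp.single (Sum.inr k) 1, by
            rw [tsub_add_cancel_of_le]
            simpa [Nat.one_le_iff_ne_zero] using hk'⟩
        refine natCast_succ_mul_cancel (d (Sum.inl k)) ?_
        rw [stableSeries_pair, ih d.degree
          (by rw [← hn]; simp [map_add, Finsupp.degree_single]) d rfl]
        obtain ⟨a, b, rfl⟩ := exists_sumElim d
        have h := expLinear_succ (fun k : ℕ+ => (k : ℂ)⁻¹) a k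
        rw [← Finsupp.sumElim_single_zero, ← Finsupp.sumElim_zero_single,
          ← Finsupp.sumElim_add, ← Finsupp.sumElim_add, add_zero,
          add_zero, coeff_ZtildeInfty, coeff_ZtildeInfty]
        simp only [add_left_inj, Finsupp.sumElim_inl]
        split_ifs with hab
        · exact h.symm
        · ring
    · push Not at hplus
      have h0 : plusWeight d = 0 := by
        rw [plusWeight, Finsupp.weight_apply]
        refine Finset.sum_eq_zero fun v _ => ?_
        rcases v with k | k
        · simp [hplus k]
        · simp
      rw [coeff_stableSeries h0]
      obtain ⟨a, b, rfl⟩ := exists_sumElim d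
      have ha : a = 0 := by
        ext k
        simpa using hplus k
      subst ha
      rw [coeff_ZtildeInfty]
      split_ifs with hb
      · subst hb
        rw [Finsupp.sumElim_zero_zero, MvPowerSeries.coeff_zero_eq_constantCoeff_apply,
          MvPowerSeries.coeff_zero_eq_constantCoeff_apply, constantCoeff_expLinear, map_one]
      · classical
        rw [MvPowerSeries.coeff_one, if_neg]
        intro h
        apply hb
        ext k
        simpa using (DFunLike.congr_fun h (Sum.inr k)).symm

theorem haarSeries_eq (N : ℕ) : haarSeries N = ZtildeInfty * fredholm N := by
  rw [haarSeries_eq_mul, stableSeries_eq]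

end Stable

/-! ### The averaging map and Z_∞ -/

section Averages

/-- The weight of a monomial in the variables `g_k`, where `g_k` has weight `k`. -/
def gWeight : (ℕ+ →₀ ℕ) →+ ℕ := Finsupp.weight fun k : ℕ+ => (k : ℕ)

lemma gWeight_single (k : ℕ+) (n : ℕ) : gWeight (Finsupp.single k n) = n * k := by
  simp [gWeight, Finsupp.weight_single]

lemma plusWeight_sumElim (a b : ℕ+ →₀ ℕ) : plusWeight (Finsupp.sumElim a b) = gWeight a := by
  have h : Finsupp.sumElim a b = Finsupp.sumElim a 0 + Finsupp.sumElim 0 b := by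
    rw [← Finsupp.sumElim_add, add_zero, zero_add]
  rw [h, map_add]
  have h1 : plusWeight (Finsupp.sumElim a 0) = gWeight a := by
    induction a using Finsupp.induction_linear with
    | zero =>
      rw [Finsupp.sumElim_zero_zero, map_zero, map_zero]
    | add a a' ha ha' =>
      rw [← add_zero (0 : ℕ+ →₀ ℕ), Finsupp.sumElim_add, map_add, map_add,
        ha (by rw [← Finsupp.sumElim_add]; simp),
        ha' (by rw [← Finsupp.sumElim_add]; simp)]
    | single k n =>
      rw [Finsupp.sumElim_single_zero, gWeight_single, plusWeight, Finsupp.weight_single]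
      simp
  have h2 : plusWeight (Finsupp.sumElim 0 b) = 0 := by
    rw [plusWeight, Finsupp.weight_apply]
    refine Finset.sum_eq_zero fun v _ => ?_
    rcases v with k | k <;> simp
  rw [h1, h2, add_zero]

lemma le_gWeight (d : ℕ+ →₀ ℕ) (k : ℕ+) (hk : d k ≠ 0) : (k : ℕ) ≤ gWeight d := by
  classical
  rw [← Finsupp.single_add_erase k d, map_add, gWeight_single]
  have : 1 * (k : ℕ) ≤ d k * k := Nat.mul_le_mul_right _ (Nat.one_le_iff_ne_zero.mpr hk)
  omega

lemma apply_le_gWeight (d : ℕ+ →₀ ℕ) (k : ℕ+) : d k ≤ gWeight d := by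
  classical
  have h : gWeight (Finsupp.single k (d k) + d.erase k) = gWeight d := by
    rw [Finsupp.single_add_erase]
  rw [map_add, gWeight_single] at h
  have : d k * 1 ≤ d k * k := Nat.mul_le_mul_left _ k.pos
  omega

lemma finite_pnat_le (n : ℕ) : {k : ℕ+ | (k : ℕ) ≤ n}.Finite :=
  Set.Finite.preimage PNat.coe_injective.injOn (Set.finite_Iic n)

lemma finite_gWeight_le (n : ℕ) : {d | gWeight d ≤ n}.Finite := by
  refine (Set.finite_Iic (∑ k ∈ (finite_pnat_le n).toFinset, Finsupp.single k n)).subset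
    fun d hd k => ?_
  rw [Finsupp.finsetSum_apply]
  by_cases hk : d k = 0
  · rw [hk]
    exact Nat.zero_le _
  · refine (((apply_le_gWeight d k).trans hd).trans_eq ?_).trans (Finset.single_le_sum
      (f := fun j => (Finsupp.single j n : ℕ+ →₀ ℕ) k) (fun _ _ => Nat.zero_le _)
      ((finite_pnat_le n).mem_toFinset.mpr ((le_gWeight d k hk).trans hd)))
    simp

/-- The monomials of weight at most `n`. -/
def lowWeight (n : ℕ) : Finset (ℕ+ →₀ ℕ) := (finite_gWeight_le n).toFinset

lemma mem_lowWeight {n : ℕ} {d : ℕ+ →₀ ℕ} : d ∈ lowWeight n ↔ gWeight d ≤ n :=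
  (finite_gWeight_le n).mem_toFinset

/-- The series all of whose coefficients with exponents supported in `s` are `1`. -/
def geometricSeries (s : Set ℕ+) : MvPowerSeries ℕ+ ℂ := fun d =>
  open Classical in if (d.support : Set ℕ+) ⊆ s then 1 else 0

lemma coeff_geometricSeries (s : Set ℕ+) (d : ℕ+ →₀ ℕ) :
    MvPowerSeries.coeff d (geometricSeries s) =
      open Classical in if (d.support : Set ℕ+) ⊆ s then 1 else 0 := rfl

lemma geometricSeries_insert {s : Set ℕ+} {k : ℕ+} (hk : k ∉ s) :
    geometricSeries (insert k s) * (1 - MvPowerSeries.X k) = geometricSeries s := by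
  classical
  ext d
  rw [mul_sub, mul_one, map_sub, MvPowerSeries.X, MvPowerSeries.coeff_mul_monomial, mul_one,
    coeff_geometricSeries, coeff_geometricSeries, coeff_geometricSeries]
  by_cases hd : d k = 0
  · have h1 : ¬ Finsupp.single k 1 ≤ d := by simp [hd]
    have h2 : (d.support : Set ℕ+) ⊆ insert k s ↔ (d.support : Set ℕ+) ⊆ s :=
      Set.subset_insert_iff_of_notMem (by simpa using hd)
    rw [if_neg h1, sub_zero]
    exact if_congr h2 rfl rfl
  · have h1 : Finsupp.single k 1 ≤ d := by simpa [Nat.one_le_iff_ne_zero] using hd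
    have h2 : ¬ (d.support : Set ℕ+) ⊆ s := fun h => hk (h (by simpa using hd))
    have h3 : (d.support : Set ℕ+) ⊆ insert k s ↔
        ((d - Finsupp.single k 1).support : Set ℕ+) ⊆ insert k s := by
      constructor
      · exact fun h j hj => h (by
          simp only [Finset.mem_coe, Finsupp.mem_support_iff, Finsupp.tsub_apply] at hj ⊢
          omega)
      · intro h j hj
        by_cases hjk : j = k
        · exact Or.inl hjk
        · refine h ?_
          simp only [Finset.mem_coe, Finsupp.mem_support_iff, Finsupp.tsub_apply] at hj ⊢
          rw [Finsupp.single_eq_of_ne hjk]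
          simpa using hj
    rw [if_pos h1, if_neg h2, if_congr h3 rfl rfl, sub_self]

lemma geometricSeries_empty : geometricSeries ∅ = 1 := by
  classical
  ext d
  rw [coeff_geometricSeries, MvPowerSeries.coeff_one]
  simp

lemma geometricSeries_mul_prod (s : Finset ℕ+) :
    geometricSeries s * ∏ k ∈ s, (1 - MvPowerSeries.X k) = 1 := by
  classical
  induction s using Finset.induction_on with
  | empty => simp [geometricSeries_empty]
  | insert k s hk ih =>
    rw [Finset.prod_insert hk, ← mul_assoc, Finset.coe_insert,
      geometricSeries_insert (by simpa using hk), ih]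

open scoped MvPowerSeries.WithPiTopology in
lemma ZInfty_eq : ZInfty = geometricSeries Set.univ := by
  classical
  refine HasProd.tprod_eq ?_
  refine (MvPowerSeries.WithPiTopology.tendsto_iff_coeff_tendsto _ _ _).mpr fun d => ?_
  refine tendsto_const_nhds.congr' ?_
  -- Once a partial product contains the support of d, its coefficient at d is 1 for good.
  filter_upwards [Filter.eventually_ge_atTop d.support] with s hs
  have h : ∏ k ∈ s, (1 - MvPowerSeries.X k : MvPowerSeries ℕ+ ℂ)⁻¹ = geometricSeries s := by
    have h1 := geometricSeries_mul_prod s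
    have h2 : (∏ k ∈ s, (1 - MvPowerSeries.X k : MvPowerSeries ℕ+ ℂ)) *
        ∏ k ∈ s, (1 - MvPowerSeries.X k : MvPowerSeries ℕ+ ℂ)⁻¹ = 1 := by
      rw [← Finset.prod_mul_distrib]
      refine Finset.prod_eq_one fun k _ => MvPowerSeries.mul_inv_cancel _ ?_
      simp
    exact (left_inv_eq_right_inv h1 h2).symm
  rw [h, coeff_geometricSeries, coeff_geometricSeries, if_pos (Set.subset_univ _), if_pos]
  exact_mod_cast hs

lemma coeff_ZInfty (d : ℕ+ →₀ ℕ) : MvPowerSeries.coeff d ZInfty = 1 := by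
  rw [ZInfty_eq, coeff_geometricSeries, if_pos (Set.subset_univ _)]

lemma constantCoeff_ZInfty : MvPowerSeries.constantCoeff ZInfty = 1 := by
  rw [← MvPowerSeries.coeff_zero_eq_constantCoeff_apply, coeff_ZInfty]

lemma ZInfty_inv_mul : ZInfty⁻¹ * ZInfty = 1 := by
  refine MvPowerSeries.inv_mul_cancel _ ?_
  rw [constantCoeff_ZInfty]
  exact one_ne_zero

lemma coeff_average (F : MvPowerSeries TVar ℂ) (d : ℕ+ →₀ ℕ) :
    MvPowerSeries.coeff d (average F) = (d.prod fun k n => (n ! : ℂ) * (k : ℂ) ^ n) *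
      MvPowerSeries.coeff (Finsupp.sumElim d d) F := rfl

lemma prod_mul_coeff_expLinear (d : ℕ+ →₀ ℕ) :
    (d.prod fun k n => (n ! : ℂ) * (k : ℂ) ^ n) *
      MvPowerSeries.coeff d (expLinear fun k : ℕ+ => (k : ℂ)⁻¹) = 1 := by
  rw [coeff_expLinear, ← Finsupp.prod_mul]
  refine Finset.prod_eq_one fun k _ => ?_
  change ((d k)! : ℂ) * (k : ℂ) ^ d k * (((d k)! : ℂ)⁻¹ • (k : ℂ)⁻¹ ^ d k) = 1
  have h1 : ((d k)! : ℂ) ≠ 0 := by exact_mod_cast Nat.factorial_ne_zero _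
  have h2 : (k : ℂ) ≠ 0 := by exact_mod_cast k.ne_zero
  rw [smul_eq_mul, inv_pow]
  field_simp

/-- The Gaussian moments a! k^a cancel the exponential's coefficients exactly, so every coefficient
of the average is 1. -/
lemma average_ZtildeInfty : average ZtildeInfty = ZInfty := by
  ext d
  rw [coeff_average, coeff_ZtildeInfty, if_pos rfl, prod_mul_coeff_expLinear, coeff_ZInfty]

/-- On monomials with equal exponents of t⁺ and t⁻ the signs cancel, and one of the two factors
1/(a! k^a) is absorbed by the moment. What remains is the integral of exp(∑ g_k p_k p_{-k} / k). -/
lemma coeff_average_haarSeries (N : ℕ) (d : ℕ+ →₀ ℕ) :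
    MvPowerSeries.coeff d (average (haarSeries N)) =
      MvPowerSeries.coeff d (expLinear fun k : ℕ+ => (k : ℂ)⁻¹) *
        haarIntegral N (MvPolynomial.monomial (Finsupp.sumElim d d) 1) := by
  rw [coeff_average, coeff_haarSeries, ← mul_assoc, vertex, coeff_expLinear, coeff_expLinear,
    Finsupp.prod_sumElim, ← Finsupp.prod_mul, ← Finsupp.prod_mul]
  congr 1
  refine Finset.prod_congr rfl fun k _ => ?_
  have h1 : ((d k)! : ℂ) ≠ 0 := by exact_mod_cast Nat.factorial_ne_zero _
  have h2 : (k : ℂ) ≠ 0 := by exact_mod_cast k.ne_zero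
  have h3 : ((-1 : ℂ) ^ d k) ^ 2 = 1 := by rw [← pow_mul, mul_comm, pow_mul]; simp
  simp only [Function.comp_apply, Sum.elim_inl, Sum.elim_inr, smul_eq_mul, mul_pow, inv_pow]
  field_simp
  linear_combination h3

end Averages

/-! ### Specialisation to g_k = f(q^k) -/

section Couplings

variable {f : PowerSeries ℤ}

lemma order_coupling (f : PowerSeries ℤ) (k : ℕ+) :
    ((k : ℕ) : ℕ∞) * f.order ≤ (coupling f k).order := by
  rw [coupling, PowerSeries.order_expand, nsmul_eq_mul]
  gcongr
  exact PowerSeries.le_order_map _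

/-- The order of f(q^k) is at least kα, which is why g_k is given weight k. -/
lemma order_prod_coupling (f : PowerSeries ℤ) (d : ℕ+ →₀ ℕ) :
    f.order * (gWeight d : ℕ∞) ≤
      (d.prod fun k n => coupling f k ^ n : PowerSeries ℂ).order := by
  rw [Finsupp.prod, gWeight, Finsupp.weight_apply, Finsupp.sum]
  refine le_trans ?_ (PowerSeries.le_order_prod _ _)
  push_cast
  rw [Finset.mul_sum]
  refine Finset.sum_le_sum fun k _ => ?_
  rw [PowerSeries.order_pow]
  simp only [nsmul_eq_mul]
  push_cast
  rw [mul_left_comm, mul_comm f.order]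
  exact mul_le_mul' le_rfl (order_coupling f k)

lemma coeff_prod_coupling_eq_zero {d : ℕ+ →₀ ℕ} {n : ℕ}
    (h : (n : ℕ∞) < f.order * (gWeight d : ℕ∞)) :
    PowerSeries.coeff n (d.prod fun k e => coupling f k ^ e : PowerSeries ℂ) = 0 :=
  PowerSeries.coeff_of_lt_order n (h.trans_le (order_prod_coupling f d))

lemma one_le_order (hf : PowerSeries.constantCoeff f = 0) : 1 ≤ f.order :=
  PowerSeries.one_le_order_iff_constCoeff_eq_zero.mpr hf

lemma coeff_prod_coupling_of_lt (hf : PowerSeries.constantCoeff f = 0) {d : ℕ+ →₀ ℕ} {n : ℕ}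
    (h : n < gWeight d) :
    PowerSeries.coeff n (d.prod fun k e => coupling f k ^ e : PowerSeries ℂ) = 0 := by
  have h1 : (n : ℕ∞) < (gWeight d : ℕ∞) := by exact_mod_cast h
  refine coeff_prod_coupling_eq_zero (h1.trans_le ?_)
  exact le_mul_of_one_le_left (zero_le) (one_le_order hf)

lemma constantCoeff_coupling (hf : PowerSeries.constantCoeff f = 0) (k : ℕ+) :
    PowerSeries.constantCoeff (coupling f k) = 0 := by
  rw [← PowerSeries.one_le_order_iff_constCoeff_eq_zero]
  refine le_trans ?_ (order_coupling f k)
  exact (one_le_order hf).trans (le_mul_of_one_le_left (zero_le) (by exact_mod_cast k.pos))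

lemma hasSubst_coupling (hf : PowerSeries.constantCoeff f = 0) :
    MvPowerSeries.HasSubst (coupling f : ℕ+ → MvPowerSeries Unit ℂ) where
  const_coeff k := by
    have h : MvPowerSeries.constantCoeff (coupling f k : MvPowerSeries Unit ℂ) = 0 :=
      constantCoeff_coupling hf k
    rw [h]
    exact IsNilpotent.zero
  coeff_zero d := by
    obtain ⟨n, rfl⟩ : ∃ n, d = Finsupp.single () n := ⟨d (), by ext; simp⟩
    refine (finite_pnat_le n).subset fun k hk => ?_
    by_contra hlt
    refine hk (PowerSeries.coeff_of_lt_order n (lt_of_lt_of_le ?_ (order_coupling f k)))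
    have h1 : (n : ℕ∞) < (k : ℕ) := by exact_mod_cast not_le.mp hlt
    exact h1.trans_le (le_mul_of_one_le_right (zero_le) (one_le_order hf))

/-- Since α ≥ 1, monomials of weight above n do not reach q^n; a fixed finite set of monomials
serves all F, so finite sums and integrals can be exchanged. -/
lemma coeff_subst_coupling (hf : PowerSeries.constantCoeff f = 0) (F : MvPowerSeries ℕ+ ℂ)
    (n : ℕ) : PowerSeries.coeff n (MvPowerSeries.subst (coupling f) F : PowerSeries ℂ) =
      ∑ d ∈ lowWeight n, MvPowerSeries.coeff d F *
        PowerSeries.coeff n (d.prod fun k e => coupling f k ^ e : PowerSeries ℂ) := by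
  refine (MvPowerSeries.coeff_subst (hasSubst_coupling hf) F _).trans ?_
  refine finsum_eq_sum_of_support_subset _ fun d hd => ?_
  rw [Finset.mem_coe, mem_lowWeight]
  by_contra h
  refine hd ?_
  change _ • PowerSeries.coeff n (d.prod fun k e => coupling f k ^ e : PowerSeries ℂ) = 0
  rw [coeff_prod_coupling_of_lt hf (not_le.mp h), smul_zero]

lemma traceEval_monomial_sumElim {N : ℕ} (V : U N) (d : ℕ+ →₀ ℕ) :
    traceEval V (MvPolynomial.monomial (Finsupp.sumElim d d) 1) =
      d.prod fun k n => (tr (V ^ (k : ℕ)) * tr (V⁻¹ ^ (k : ℕ))) ^ n := by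
  rw [traceEval, MvPolynomial.aeval_monomial, map_one, one_mul, Finsupp.prod_sumElim,
    ← Finsupp.prod_mul]
  refine Finset.prod_congr rfl fun k _ => ?_
  have h1 : V ^ charge (Sum.inl k) = V ^ (k : ℕ) := zpow_natCast V k
  have h2 : V ^ charge (Sum.inr k) = V⁻¹ ^ (k : ℕ) := by
    rw [inv_pow, ← zpow_natCast, ← zpow_neg]
    rfl
  simp only [Function.comp_apply, h1, h2, mul_pow]

lemma index_eq (hf : PowerSeries.constantCoeff f = 0) (N : ℕ) :
    index f N = MvPowerSeries.subst (coupling f) (average (haarSeries N)) := by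
  ext n
  have h : ∀ V : U N, PowerSeries.coeff n (expSeries (action f V) : PowerSeries ℂ) =
      ∑ d ∈ lowWeight n, MvPowerSeries.coeff d (expLinear fun k : ℕ+ => (k : ℂ)⁻¹) *
        traceEval V (MvPolynomial.monomial (Finsupp.sumElim d d) 1) *
          PowerSeries.coeff n (d.prod fun k e => coupling f k ^ e : PowerSeries ℂ) := by
    intro V
    have h1 : (expSeries (action f V) : PowerSeries ℂ) = MvPowerSeries.subst (coupling f)
        (expLinear fun k : ℕ+ => (k : ℂ)⁻¹ * tr (V ^ (k : ℕ)) * tr (V⁻¹ ^ (k : ℕ))) :=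
      expSeries_formalSum (hasSubst_coupling hf) _
    rw [h1, coeff_subst_coupling hf]
    refine Finset.sum_congr rfl fun d _ => ?_
    rw [traceEval_monomial_sumElim]
    have h2 := coeff_expLinear_smul (fun k : ℕ+ => (k : ℂ)⁻¹)
      (fun k : ℕ+ => tr (V ^ (k : ℕ)) * tr (V⁻¹ ^ (k : ℕ))) d
    simp only [smul_eq_mul, ← mul_assoc] at h2
    rw [h2]
  rw [index, PowerSeries.coeff_mk, coeff_subst_coupling hf]
  simp only [h]
  rw [MeasureTheory.integral_finsetSum]
  · refine Finset.sum_congr rfl fun d _ => ?_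
    rw [MeasureTheory.integral_mul_const, MeasureTheory.integral_const_mul,
      coeff_average_haarSeries]
    rfl
  · intro d _
    exact integrable_of_continuous
      ((continuous_const.mul (continuous_traceEval _)).mul continuous_const)

open scoped PowerSeries.WithPiTopology in
lemma indexInfty_eq (hf : PowerSeries.constantCoeff f = 0) :
    indexInfty f = MvPowerSeries.subst (coupling f) ZInfty := by
  classical
  refine HasProd.tprod_eq ?_
  refine (PowerSeries.WithPiTopology.tendsto_iff_coeff_tendsto _ _ _ _).mpr fun n => ?_
  refine tendsto_const_nhds.congr' ?_
  filter_upwards [Filter.eventually_ge_atTop (finite_pnat_le n).toFinset] with s hs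
  have ha := hasSubst_coupling hf
  have h : ∏ k ∈ s, (1 - coupling f k)⁻¹ =
      MvPowerSeries.subst (coupling f) (geometricSeries s) := by
    have h1 := congrArg (MvPowerSeries.substAlgHom (R := ℂ) ha) (geometricSeries_mul_prod s)
    rw [map_mul, map_prod, map_one] at h1
    simp only [map_sub, map_one, MvPowerSeries.substAlgHom_apply, MvPowerSeries.subst_X ha] at h1
    have h2 : (∏ k ∈ s, (1 - coupling f k)) * ∏ k ∈ s, (1 - coupling f k)⁻¹ = 1 := by
      rw [← Finset.prod_mul_distrib]
      refine Finset.prod_eq_one fun k _ => PowerSeries.mul_inv_cancel _ ?_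
      rw [map_sub, map_one, constantCoeff_coupling hf, sub_zero]
      exact one_ne_zero
    exact (left_inv_eq_right_inv h1 h2).symm
  rw [h, coeff_subst_coupling hf, coeff_subst_coupling hf]
  refine Finset.sum_congr rfl fun d hd => ?_
  rw [coeff_ZInfty, coeff_geometricSeries, if_pos]
  intro k hk
  refine hs ((finite_pnat_le n).mem_toFinset.mpr ?_)
  exact (le_gWeight d k (by simpa using hk)).trans (mem_lowWeight.mp hd)

lemma index_mul_inv (hf : PowerSeries.constantCoeff f = 0) (N : ℕ) :
    index f N * (indexInfty f)⁻¹ = MvPowerSeries.subst (coupling f)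
      (ZInfty⁻¹ * average (ZtildeInfty * fredholm N)) := by
  have ha := hasSubst_coupling hf
  have h1 := congrArg (MvPowerSeries.substAlgHom (R := ℂ) ha) ZInfty_inv_mul
  rw [map_mul, map_one, MvPowerSeries.substAlgHom_apply, MvPowerSeries.substAlgHom_apply,
    ← indexInfty_eq hf] at h1
  -- A nonzero constant term ensures that the inverse of the series is a genuine inverse and not the
  -- default value 0.
  have h0 : PowerSeries.constantCoeff (indexInfty f) ≠ 0 := by
    intro h0
    have := congrArg PowerSeries.constantCoeff h1
    rw [show PowerSeries.constantCoeff (MvPowerSeries.subst (coupling f) ZInfty⁻¹ * indexInfty f) =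
      PowerSeries.constantCoeff (MvPowerSeries.subst (coupling f) ZInfty⁻¹) *
        PowerSeries.constantCoeff (indexInfty f) from map_mul _ _ _, h0, mul_zero] at this
    exact zero_ne_one (this.trans (map_one PowerSeries.constantCoeff))
  rw [← (PowerSeries.eq_inv_iff_mul_eq_one h0).mpr h1, MvPowerSeries.subst_mul ha, index_eq hf,
    haarSeries_eq, mul_comm]

end Couplings

/-! ### Lower bounds on weights -/

section Weights

variable {σ : Type*} {w : (σ →₀ ℕ) →+ ℕ} {D D' : ℤ} {F G : MvPowerSeries σ ℂ}

/-- All monomials of `F` have weight at least `D`. -/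
def WeightGE (w : (σ →₀ ℕ) →+ ℕ) (D : ℤ) (F : MvPowerSeries σ ℂ) : Prop :=
  ∀ d, MvPowerSeries.coeff d F ≠ 0 → D ≤ w d

lemma weightGE_zero (F : MvPowerSeries σ ℂ) : WeightGE w 0 F := fun _ _ => Int.natCast_nonneg _

lemma WeightGE.mul (hF : WeightGE w D F) (hG : WeightGE w D' G) :
    WeightGE w (D + D') (F * G) := by
  intro d hd
  obtain ⟨d₁, d₂, rfl, h₁, h₂⟩ := exists_of_coeff_mul_ne_zero hd
  rw [map_add]
  push_cast
  exact add_le_add (hF d₁ h₁) (hG d₂ h₂)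

lemma WeightGE.mul_left (hF : WeightGE w D F) (G : MvPowerSeries σ ℂ) : WeightGE w D (G * F) := by
  simpa using (weightGE_zero G).mul hF

lemma weightGE_sum {ι : Type*} (s : Finset ι) (f : ι → MvPowerSeries σ ℂ)
    (h : ∀ a ∈ s, WeightGE w D (f a)) : WeightGE w D (∑ a ∈ s, f a) := by
  intro d hd
  rw [map_sum] at hd
  obtain ⟨a, ha, hne⟩ := Finset.exists_ne_zero_of_sum_ne_zero hd
  exact h a ha d hne

lemma weightGE_prod {ι : Type*} (s : Finset ι) (D : ι → ℤ) (f : ι → MvPowerSeries σ ℂ)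
    (h : ∀ a ∈ s, WeightGE w (D a) (f a)) : WeightGE w (∑ a ∈ s, D a) (∏ a ∈ s, f a) := by
  classical
  induction s using Finset.induction_on with
  | empty => exact weightGE_zero _
  | insert a s ha ih =>
    rw [Finset.sum_insert ha, Finset.prod_insert ha]
    exact (h a (Finset.mem_insert_self _ _)).mul
      (ih fun b hb => h b (Finset.mem_insert_of_mem hb))

end Weights

/-! ### The giant graviton terms as parts of the Fredholm expansion -/

section GiantTerms

lemma average_add (F G : MvPowerSeries TVar ℂ) : average (F + G) = average F + average G := by
  ext d
  rw [map_add, coeff_average, coeff_average, coeff_average, map_add, mul_add]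

/-- The map `F ↦ Z_∞⁻¹ ⟨Z̃_∞ F⟩`. -/
def dressedAverage : MvPowerSeries TVar ℂ →ₗ[ℂ] MvPowerSeries ℕ+ ℂ where
  toFun F := ZInfty⁻¹ * average (ZtildeInfty * F)
  map_add' F G := by
    rw [mul_add, average_add, mul_add]
  map_smul' c F := by
    rw [RingHom.id_apply, ← mul_smul_comm, mul_smul_comm c ZtildeInfty F]
    congr 1
    ext d
    rw [MvPowerSeries.coeff_smul, coeff_average, coeff_average, MvPowerSeries.coeff_smul,
      mul_left_comm]

lemma dressedAverage_one : dressedAverage 1 = 1 := by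
  change ZInfty⁻¹ * average (ZtildeInfty * 1) = 1
  rw [mul_one, average_ZtildeInfty, ZInfty_inv_mul]

lemma WeightGE.dressedAverage {D : ℤ} {F : MvPowerSeries TVar ℂ} (hF : WeightGE plusWeight D F) :
    WeightGE gWeight D (dressedAverage F) := by
  refine WeightGE.mul_left ?_ _
  intro d hd
  rw [coeff_average] at hd
  rw [← plusWeight_sumElim d d]
  exact (hF.mul_left ZtildeInfty) _ (right_ne_zero_of_mul hd)

lemma Kg_eq {m : ℕ} (i : Fin m → ℤ) :
    Kg i = dressedAverage (Matrix.of fun a b => Ktilde (i a) (i b)).det := rfl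

lemma weightGE_Ktilde (i j : ℤ) : WeightGE plusWeight (i + 1) (Ktilde i j) := by
  intro d hd
  by_contra h
  exact hd (Ktilde_coeff_eq_zero i j d (by omega))

/-- Each term of the determinant takes one entry from every row, and row i_a contributes weight at
least i_a + 1. The factors Z̃_∞ and Z_∞⁻¹ cannot lower the weight, and averaging turns t⁺-weight
into g-weight. -/
lemma weightGE_Kg {m : ℕ} (i : Fin m → ℤ) : WeightGE gWeight (∑ a, (i a + 1)) (Kg i) := by
  rw [Kg_eq]
  refine WeightGE.dressedAverage ?_
  rw [Matrix.det_apply']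
  refine weightGE_sum _ _ fun τ _ => WeightGE.mul_left ?_ _
  rw [← Equiv.sum_comp τ]
  exact weightGE_prod _ _ _ fun a _ => weightGE_Ktilde _ _

lemma sum_add_one (N m : ℕ) :
    ∑ a ∈ range m, (N + a + 1) = m * N + m * (m + 1) / 2 := by
  induction m with
  | zero => simp
  | succ m ih =>
    rw [Finset.sum_range_succ, ih, show (m + 1) * (m + 1 + 1) = m * (m + 1) + (m + 1) * 2 by ring,
      Nat.add_mul_div_right _ _ (by norm_num)]
    ring

lemma Levels.le_apply {N m : ℕ} (r : Levels N m) (a : Fin m) : (N : ℤ) + a ≤ r.1 a := by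
  obtain ⟨a, ha⟩ := a
  induction a with
  | zero => simpa using r.2.2 ⟨0, ha⟩
  | succ a ih =>
    have h1 := ih (by omega)
    have h2 : r.1 ⟨a, by omega⟩ < r.1 ⟨a + 1, ha⟩ := r.2.1 (by simp)
    push_cast at h1 ⊢
    omega

/-- The minimum is attained by the consecutive levels N, N + 1, …, N + m - 1. -/
lemma Levels.le_sum {N m : ℕ} (r : Levels N m) :
    ((m * N + m * (m + 1) / 2 : ℕ) : ℤ) ≤ ∑ a, (r.1 a + 1) := by
  rw [← sum_add_one, ← Fin.sum_univ_eq_sum_range (fun a => N + a + 1) m]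
  push_cast
  exact Finset.sum_le_sum fun a _ => by linarith [r.le_apply a]

lemma Levels.apply_le {N m : ℕ} (r : Levels N m) {d : ℕ+ →₀ ℕ}
    (hd : MvPowerSeries.coeff d (Kg r.1) ≠ 0) (a : Fin m) : r.1 a < gWeight d := by
  have h1 := weightGE_Kg r.1 d hd
  have h2 : r.1 a + 1 ≤ ∑ b, (r.1 b + 1) :=
    Finset.single_le_sum (f := fun b => r.1 b + 1)
      (fun b _ => by have := r.2.2 b; omega) (mem_univ a)
  omega

lemma formalSummable_Kg (N m : ℕ) : FormalSummable fun r : Levels N m => Kg r.1 := by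
  intro d
  refine Set.Finite.of_finite_image (f := Subtype.val) ?_ Subtype.val_injective.injOn
  refine (Set.finite_Icc (fun _ : Fin m => (N : ℤ)) (fun _ => (gWeight d : ℤ))).subset ?_
  rintro _ ⟨r, hr, rfl⟩
  exact ⟨fun a => r.2.2 a, fun a => (r.apply_le hr a).le⟩

/-- The set of levels of a configuration. -/
def Levels.toFinset {N m : ℕ} (r : Levels N m) : Finset ℕ := univ.image fun a => (r.1 a).toNat

lemma Levels.coe_toNat {N m : ℕ} (r : Levels N m) (a : Fin m) : ((r.1 a).toNat : ℤ) = r.1 a :=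
  Int.toNat_of_nonneg ((Int.natCast_nonneg N).trans (r.2.2 a))

lemma Levels.toNat_strictMono {N m : ℕ} (r : Levels N m) :
    StrictMono fun a => (r.1 a).toNat := by
  intro a b hab
  have h := r.2.1 hab
  rw [← r.coe_toNat a, ← r.coe_toNat b] at h
  exact Int.ofNat_lt.mp h

lemma Levels.toFinset_injective (N m : ℕ) :
    Function.Injective (Levels.toFinset : Levels N m → Finset ℕ) := by
  intro r r' h
  have h1 : Set.range (fun a => (r.1 a).toNat) = Set.range fun a => (r'.1 a).toNat := by
    simpa [Levels.toFinset] using congrArg (fun s : Finset ℕ => (s : Set ℕ)) h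
  have h2 := (StrictMono.range_inj r.toNat_strictMono r'.toNat_strictMono).mp h1
  apply Subtype.ext
  funext a
  rw [← r.coe_toNat, ← r'.coe_toNat]
  exact congrArg Nat.cast (congrFun h2 a)

lemma Levels.range_toFinset (N m : ℕ) : Set.range (Levels.toFinset : Levels N m → Finset ℕ) =
    {s | #s = m ∧ ∀ x ∈ s, N ≤ x} := by
  ext s
  constructor
  · rintro ⟨r, rfl⟩
    refine ⟨?_, fun x hx => ?_⟩
    · rw [Levels.toFinset, Finset.card_image_of_injective _ r.toNat_strictMono.injective,
        Finset.card_univ, Fintype.card_fin]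
    · obtain ⟨a, -, rfl⟩ := Finset.mem_image.mp hx
      have := r.2.2 a
      omega
  · rintro ⟨hs, hN⟩
    refine ⟨⟨fun a => (s.orderEmbOfFin hs a : ℕ), fun a b hab => ?_, fun a => ?_⟩, ?_⟩
    · exact Int.ofNat_lt.mpr ((s.orderEmbOfFin hs).strictMono hab)
    · exact Int.ofNat_le.mpr <| hN _ (s.orderEmbOfFin_mem hs a)
    · simp [Levels.toFinset]

lemma neg_one_pow_mul_eq_smul {σ : Type*} (m : ℕ) (F : MvPowerSeries σ ℂ) :
    (-1) ^ m * F = (-1 : ℂ) ^ m • F := by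
  rw [MvPowerSeries.smul_eq_C_mul, map_pow, map_neg, map_one]

/-- A principal minor does not depend on how its index set is enumerated, so increasing tuples may
be replaced by finite sets. -/
lemma dressedAverage_fredholmTerm {N m : ℕ} (r : Levels N m) :
    dressedAverage (fredholmTerm r.toFinset) = (-1) ^ m * Kg r.1 := by
  classical
  have hc : #r.toFinset = m := by
    have : r.toFinset ∈ Set.range (Levels.toFinset : Levels N m → Finset ℕ) := ⟨r, rfl⟩
    rw [Levels.range_toFinset] at this
    exact this.1
  let e : Fin m ≃ r.toFinset := Equiv.ofBijective
    (fun a => ⟨(r.1 a).toNat, Finset.mem_image_of_mem _ (mem_univ a)⟩)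
    ⟨fun a b hab => r.toNat_strictMono.injective (congrArg Subtype.val hab), fun x => by
      obtain ⟨a, -, ha⟩ := Finset.mem_image.mp x.2
      exact ⟨a, Subtype.ext ha⟩⟩
  have h1 : (Matrix.of fun a b : r.toFinset => Ktilde (a : ℕ) (b : ℕ)).det =
      (Matrix.of fun a b => Ktilde (r.1 a) (r.1 b)).det := by
    rw [← Matrix.det_submatrix_equiv_self e]
    congr 1
    ext1 a b
    change Ktilde ((r.1 a).toNat : ℤ) ((r.1 b).toNat : ℤ) = Ktilde (r.1 a) (r.1 b)
    rw [r.coe_toNat, r.coe_toNat]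
  rw [fredholmTerm, hc, h1, Kg_eq]
  rw [neg_one_pow_mul_eq_smul, neg_one_pow_mul_eq_smul, map_smul]

lemma coeff_dressedAverage_eq_zero {D : ℕ} {F : MvPowerSeries TVar ℂ} (hF : F ∈ lowIdeal D)
    {d : ℕ+ →₀ ℕ} (hd : gWeight d ≤ D) : MvPowerSeries.coeff d (dressedAverage F) = 0 := by
  have h : WeightGE plusWeight (D + 1) F := by
    intro e he
    by_contra hlt
    exact he (hF e (by omega))
  by_contra hne
  have := h.dressedAverage d hne
  omega

/-- Tuples become m-element sets of levels, and sets reaching to M or beyond are invisible at weight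
at most M. This makes the sum finite and comparable with the truncated Fredholm expansion. -/
lemma coeff_giant (N m : ℕ) {d : ℕ+ →₀ ℕ} {M : ℕ} (hd : gWeight d ≤ M) :
    MvPowerSeries.coeff d (giant N m) = ∑ s ∈ powersetCard m (Ico N M),
      MvPowerSeries.coeff d (dressedAverage (fredholmTerm s)) := by
  rcases m with _ | m
  · rw [powersetCard_zero, Finset.sum_singleton, fredholmTerm_empty, dressedAverage_one]
    rfl
  · change MvPowerSeries.coeff d ((-1) ^ (m + 1) * formalSum fun r : Levels N (m + 1) => Kg r.1) = _
    rw [neg_one_pow_mul_eq_smul, MvPowerSeries.coeff_smul, ← smul_eq_mul]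
    change _ • ∑ᶠ r : Levels N (m + 1), MvPowerSeries.coeff d (Kg r.1) = _
    rw [smul_finsum]
    have h : ∀ r : Levels N (m + 1), (-1 : ℂ) ^ (m + 1) • MvPowerSeries.coeff d (Kg r.1) =
        MvPowerSeries.coeff d (dressedAverage (fredholmTerm r.toFinset)) := by
      intro r
      rw [dressedAverage_fredholmTerm, neg_one_pow_mul_eq_smul, MvPowerSeries.coeff_smul,
        smul_eq_mul]
    rw [finsum_congr h, ← finsum_mem_range (Levels.toFinset_injective N (m + 1))
      (f := fun s => MvPowerSeries.coeff d (dressedAverage (fredholmTerm s))),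
      Levels.range_toFinset]
    refine finsum_mem_eq_sum_of_inter_support_eq _ ?_
    ext s
    simp only [Set.mem_inter_iff, Set.mem_ofPred_eq, Finset.mem_coe, mem_powersetCard,
      Function.mem_support]
    refine and_congr_left fun hne => ⟨fun ⟨hs, hN⟩ => ⟨fun x hx => ?_, hs⟩, fun ⟨hsub, hs⟩ =>
      ⟨hs, fun x hx => (Finset.mem_Ico.mp (hsub hx)).1⟩⟩
    refine Finset.mem_Ico.mpr ⟨hN x hx, ?_⟩
    by_contra hlt
    exact hne (coeff_dressedAverage_eq_zero (fredholmTerm_mem_lowIdeal hx (not_lt.mp hlt)) hd)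

lemma coeff_dressedAverage_fredholm (N : ℕ) {d : ℕ+ →₀ ℕ} {M : ℕ} (hd : gWeight d ≤ M) :
    MvPowerSeries.coeff d (dressedAverage (fredholm N)) =
      ∑ m ∈ range (M + 1), MvPowerSeries.coeff d (giant N m) := by
  have h1 : fredholm N - ∑ s ∈ (Ico N M).powerset, fredholmTerm s ∈ lowIdeal M := by
    intro e he
    rw [map_sub, coeff_fredholm N e M he, map_sum, sub_self]
  have h2 := coeff_dressedAverage_eq_zero h1 hd
  rw [map_sub, map_sub, sub_eq_zero] at h2
  rw [h2, map_sum, map_sum, Finset.sum_powerset, Finset.sum_congr rfl fun m _ => coeff_giant N m hd]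
  refine Finset.sum_subset (Finset.range_mono ?_) fun m _ hm => ?_
  · simp
  · rw [Finset.powersetCard_eq_empty.mpr, Finset.sum_empty]
    simpa [Nat.lt_succ_iff] using hm

lemma weightGE_giant (N m : ℕ) :
    WeightGE gWeight ((m * N + m * (m + 1) / 2 : ℕ) : ℤ) (giant N m) := by
  intro d hd
  rw [coeff_giant N m le_rfl] at hd
  obtain ⟨s, hs, hne⟩ := Finset.exists_ne_zero_of_sum_ne_zero hd
  rw [mem_powersetCard] at hs
  obtain ⟨r, rfl⟩ : s ∈ Set.range (Levels.toFinset : Levels N m → Finset ℕ) := by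
    rw [Levels.range_toFinset]
    exact ⟨hs.2, fun x hx => (Finset.mem_Ico.mp (hs.1 hx)).1⟩
  rw [dressedAverage_fredholmTerm] at hne
  exact r.le_sum.trans ((weightGE_Kg r.1).mul_left _ d hne)

end GiantTerms

/-! ### Orders in q and the final expansion -/

section Expansion

variable {f : PowerSeries ℤ}

lemma le_of_coeff_giantIndex_ne_zero (hf : PowerSeries.constantCoeff f = 0) {N m n : ℕ}
    (h : PowerSeries.coeff n (giantIndex f N m) ≠ 0) :
    f.order * ((m * N + m * (m + 1) / 2 : ℕ) : ℕ∞) ≤ n := by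
  rw [giantIndex, coeff_subst_coupling hf] at h
  obtain ⟨d, -, hd⟩ := Finset.exists_ne_zero_of_sum_ne_zero h
  have h1 := weightGE_giant N m d (left_ne_zero_of_mul hd)
  have h2 : m * N + m * (m + 1) / 2 ≤ gWeight d := by exact_mod_cast h1
  refine (mul_le_mul' le_rfl (Nat.cast_le.mpr h2)).trans (not_lt.mp fun hlt => ?_)
  exact right_ne_zero_of_mul hd (coeff_prod_coupling_eq_zero hlt)

/-- As α ≥ 1 and m ≤ m(m+1)/2, the m-th term starts no earlier than q^m, even for N = 0. This gives
convergence of the sum over m. -/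
lemma coeff_giantIndex_eq_zero (hf : PowerSeries.constantCoeff f = 0) {N m n : ℕ} (h : n < m) :
    PowerSeries.coeff n (giantIndex f N m) = 0 := by
  by_contra hne
  have h1 := le_of_coeff_giantIndex_ne_zero hf hne
  have h2 : ((m * N + m * (m + 1) / 2 : ℕ) : ℕ∞) ≤ n :=
    (le_mul_of_one_le_left zero_le (one_le_order hf)).trans h1
  have h3 : m * N + m * (m + 1) / 2 ≤ n := by exact_mod_cast h2
  have h4 : m ≤ m * (m + 1) / 2 := by
    rw [Nat.le_div_iff_mul_le (by norm_num)]
    exact Nat.mul_le_mul_left _ (by omega)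
  omega

lemma formalSummable_giantIndex (hf : PowerSeries.constantCoeff f = 0) (N : ℕ) :
    FormalSummable fun m : ℕ => giantIndex f N m := by
  intro e
  obtain ⟨n, rfl⟩ : ∃ n, e = Finsupp.single () n := ⟨e (), by ext; simp⟩
  refine (Set.finite_Iic n).subset fun m hm => ?_
  by_contra hlt
  exact hm (coeff_giantIndex_eq_zero hf (not_le.mp hlt))

lemma index_mul_inv_eq_formalSum (hf : PowerSeries.constantCoeff f = 0) (N : ℕ) :
    index f N * (indexInfty f)⁻¹ = formalSum fun m : ℕ => giantIndex f N m := by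
  ext n
  have h : PowerSeries.coeff n (formalSum fun m : ℕ => giantIndex f N m : PowerSeries ℂ) =
      ∑ m ∈ range (n + 1), PowerSeries.coeff n (giantIndex f N m) := by
    refine finsum_eq_sum_of_support_subset _ fun m hm => ?_
    rw [Finset.mem_coe, Finset.mem_range]
    by_contra hlt
    exact hm (coeff_giantIndex_eq_zero hf (by omega))
  rw [h, index_mul_inv hf]
  change PowerSeries.coeff n (MvPowerSeries.subst (coupling f) (dressedAverage (fredholm N))) = _
  simp only [giantIndex, coeff_subst_coupling hf]
  rw [Finset.sum_comm]
  refine Finset.sum_congr rfl fun d hd => ?_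
  rw [coeff_dressedAverage_fredholm N (mem_lowWeight.mp hd), Finset.sum_mul]

end Expansion

end GiantGraviton

end

theorem mainTheorem4 (f : PowerSeries ℤ) (hf : PowerSeries.constantCoeff f = 0) (N : ℕ) :
    (∀ m : ℕ, GiantGraviton.FormalSummable
      (fun r : GiantGraviton.Levels N m => GiantGraviton.Kg r.1)) ∧
    (∀ m : ℕ, f.order * ((m * N + m * (m + 1) / 2 : ℕ) : ℕ∞) ≤
      (GiantGraviton.giantIndex f N m).order) ∧
    GiantGraviton.FormalSummable (fun m : ℕ => GiantGraviton.giantIndex f N m) ∧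
    GiantGraviton.index f N * (GiantGraviton.indexInfty f)⁻¹ =
      GiantGraviton.formalSum (fun m : ℕ => GiantGraviton.giantIndex f N m) := by
  refine ⟨GiantGraviton.formalSummable_Kg N, fun m => ?_,
    GiantGraviton.formalSummable_giantIndex hf N, GiantGraviton.index_mul_inv_eq_formalSum hf N⟩
  refine PowerSeries.le_order _ _ fun n hn => ?_
  by_contra hne
  exact absurd (GiantGraviton.le_of_coeff_giantIndex_ne_zero hf hne) (not_le.mpr hn)
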